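/- Let $(X,d)$ be a compact metric space and $\mu$ a Borel probability measure on $X$ that charges every non-empty open set. Let $(\mathcal E,\operatorname{Dom}\mathcal E)$ be a symmetric, strictly local, regular Dirichlet form on $L^2(X,\mu)$ that admits a carré du champ $\Gamma$ (write $\Gamma(f)=\Gamma(f,f)$, so $\mathcal E(f,f)=\int\Gamma(f)\,d\mu$). Let $\Delta\le 0$ be its generator, $\mathcal E(u,v)=-\int v\,\Delta u\,d\mu$, and $P_t=e^{t\Delta}$ its heat semigroup. Let $\mathcal C=C_b(X)\cap\operatorname{Dom}\mathcal E$, and let $\mathcal B_b(X)$ be the bounded Borel functions on $X$. Let $\mathcal H$ be the Hilbert space of one-forms, i.e. the (Hausdorff) completion of $\mathcal C\otimes\mathcal B_b(X)$ for $\langle f_1\otimes g_1,f_2\otimes g_2\rangle_{\mathcal H}=\int g_1g_2\,\Gamma(f_1,f_2)\,d\mu$. Let $\|\eta\|_{\mathcal H_x}$ denote the fibre norm, which is $\big(\sum_{i,j}g_i(x)g_j(x)\Gamma(f_i,f_j)(x)\big)^{1/2}$ for $\eta=\sum_i f_i\otimes g_i$ and extends by continuity to a map $\eta\mapsto\|\eta\|_{\mathcal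 H_\cdot}$ from $\mathcal H$ to $L^2(X,\mu)$. Let $\partial$ be the closed operator from $L^2(X,\mu)$ to $\mathcal H$, with domain $\operatorname{Dom}\mathcal E$, that extends $f\mapsto f\otimes\mathbf 1$, $f\in\mathcal C$, and let $\partial^*$ be its adjoint. For $f\in\mathcal B_b(X)$ put $$\operatorname{Var}f=\sup\Big\{\int f\,\partial^*\eta\,d\mu\ :\ \eta\in\operatorname{Dom}\partial^*,\ \|\eta\|_{\mathcal H_x}\le 1\ \text{for }\mu\text{-a.e. }x\Big\},\qquad BV(X)=\{f\in\mathcal B_b(X):\operatorname{Var}f<\infty\}.$$ Assume that for some constant $C_1\ge 1$ the weak Bakry–Émery estimate holds with $C_2=0$, that is $$\sqrt{\Gamma(P_tf)}\le C_1\,P_t\sqrt{\Gamma(f)}\quad\mu\text{-a.e.},\qquad f\in\operatorname{Dom}\mathcal E,\ t\ge 0.$$ Assume also that $P_t$ has a heat kernel $p_t(x,y)$, that is, $p_t$ is measurable on $X\times X$ and $P_tf(x)=\int p_t(x,y)f(y)\,d\mu(y)$ for $\mu$-a.e. $x$, for all $t>0$ and $f\in L^2(X,\mu)$, and that for some constant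 $Q>1$ $$\sup_{x,y\in X,\ t\in(0,1]}t^{Q/2}p_t(x,y)<+\infty .$$ Then there exists a constant $C_Q>0$ such that for every $f\in BV(X)$ $$\|f\|_p\le C_Q\big(\operatorname{Var}f+\|f\|_1\big),\qquad p=\frac{Q}{Q-1}.$$ -/

import Mathlib

open MeasureTheory Filter Topology
open scoped ENNReal TensorProduct BoundedContinuousFunction

noncomputable section

namespace DirichletSpace

/-! ## Dirichlet forms -/

/-- A symmetric Dirichlet form on `L²(X, μ)`: a densely defined, symmetric, non-negative bilinear
form which is closed and Markovian (the unit contraction operates on it). -/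
structure DirichletForm {X : Type*} [MeasurableSpace X] (μ : Measure X) where
  /-- the domain of the form -/
  dom : Submodule ℝ (Lp ℝ 2 μ)
  /-- the form itself -/
  form : dom →ₗ[ℝ] dom →ₗ[ℝ] ℝ
  dense_dom : Dense (dom : Set (Lp ℝ 2 μ))
  symm : ∀ u v : dom, form u v = form v u
  nonneg : ∀ u : dom, 0 ≤ form u u
  /-- `dom` is complete for the norm `(form u u + ‖u‖₂²)^(1/2)` -/
  closed : ∀ u : ℕ → dom,
    (∀ ε > 0, ∃ N, ∀ m ≥ N, ∀ n ≥ N,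
      form (u m - u n) (u m - u n) + ‖((u m - u n : dom) : Lp ℝ 2 μ)‖ ^ 2 < ε) →
    ∃ v : dom, Tendsto
      (fun n => form (u n - v) (u n - v) + ‖((u n - v : dom) : Lp ℝ 2 μ)‖ ^ 2) atTop (𝓝 0)
  markov : ∀ u : dom, ∃ v : dom,
    (∀ᵐ x ∂μ, (v : Lp ℝ 2 μ) x = min (max ((u : Lp ℝ 2 μ) x) 0) 1) ∧ form v v ≤ form u u

namespace DirichletForm

variable {X : Type*} [MeasurableSpace X] {μ : Measure X}

/-- The squared form norm `ℰ₁(u, u) = ℰ(u, u) + ‖u‖₂²`. -/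
def normSq (E : DirichletForm μ) (u : E.dom) : ℝ :=
  E.form u u + ‖(u : Lp ℝ 2 μ)‖ ^ 2

/-- `u ∈ Dom Δ` and `Δ u = v`: `u ∈ Dom ℰ` and `ℰ(u, φ) = -⟨v, φ⟩` for all `φ ∈ Dom ℰ`. -/
def HasLaplacian (E : DirichletForm μ) (u v : Lp ℝ 2 μ) : Prop :=
  ∃ hu : u ∈ E.dom, ∀ φ : E.dom, E.form ⟨u, hu⟩ φ = -inner ℝ v (φ : Lp ℝ 2 μ)

/-- `P t = e^{tΔ}`, `t ≥ 0`: the strongly continuous semigroup on `L²(X, μ)` whose infinitesimal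
generator (with its domain) is `Δ`. The values of `P` at negative times play no role. -/
structure IsHeatSemigroup (E : DirichletForm μ) (P : ℝ → Lp ℝ 2 μ →L[ℝ] Lp ℝ 2 μ) : Prop where
  zero : ∀ u, P 0 u = u
  add : ∀ s t, 0 ≤ s → 0 ≤ t → ∀ u, P (s + t) u = P s (P t u)
  tendsto_zero : ∀ u, Tendsto (fun t => P t u) (𝓝[>] 0) (𝓝 u)
  generator : ∀ u v, Tendsto (fun t : ℝ => t⁻¹ • (P t u - u)) (𝓝[>] 0) (𝓝 v) ↔
    E.HasLaplacian u v

/-- The support of a class `u ∈ L²(X, μ)`, i.e. the support of the measure `|u| μ`: the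
complement of the largest open set on which `u = 0` almost everywhere. -/
def aeSupport [TopologicalSpace X] (u : Lp ℝ 2 μ) : Set X :=
  {x | ∀ U ∈ 𝓝 x, ¬ ∀ᵐ y ∂μ, y ∈ U → u y = 0}

/-- Strict (also called strong) locality: `ℰ(u, v) = 0` whenever `u, v` have compact support and
`v` is constant on a neighbourhood of the support of `u`. -/
def IsStrictlyLocal [TopologicalSpace X] (E : DirichletForm μ) : Prop :=
  ∀ u v : E.dom, IsCompact (aeSupport (u : Lp ℝ 2 μ)) → IsCompact (aeSupport (v : Lp ℝ 2 μ)) →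
    (∃ U : Set X, IsOpen U ∧ aeSupport (u : Lp ℝ 2 μ) ⊆ U ∧
      ∃ c : ℝ, ∀ᵐ x ∂μ, x ∈ U → (v : Lp ℝ 2 μ) x = c) →
    E.form u v = 0

/-- Regularity: `C_c(X) ∩ Dom ℰ` is dense in `Dom ℰ` for the form norm and dense in `C_c(X)` for
the uniform norm. -/
structure IsRegular [TopologicalSpace X] (E : DirichletForm μ) : Prop where
  dense_form : ∀ u : E.dom, ∀ ε > 0, ∃ v : E.dom,
    (∃ g : X → ℝ, Continuous g ∧ HasCompactSupport g ∧ (v : Lp ℝ 2 μ) =ᵐ[μ] g) ∧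
      E.normSq (u - v) < ε
  dense_unif : ∀ f : X → ℝ, Continuous f → HasCompactSupport f → ∀ ε > 0, ∃ g : X → ℝ,
    Continuous g ∧ HasCompactSupport g ∧ (∃ v : E.dom, (v : Lp ℝ 2 μ) =ᵐ[μ] g) ∧
      ∀ x, |f x - g x| < ε

/-- The carré du champ of `ℰ`: the symmetric, positive, continuous bilinear map
`Γ : Dom ℰ × Dom ℰ → L¹(X, μ)` with
`ℰ(fh, g) + ℰ(gh, f) - ℰ(h, fg) = 2 ∫ h Γ(f, g) dμ` for all bounded `f, g, h ∈ Dom ℰ`. It is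
unique when it exists; `ℰ` admits a carré du champ when this type is inhabited. -/
structure CarreDuChamp (E : DirichletForm μ) where
  /-- the bilinear map `Γ` -/
  toFun : E.dom →ₗ[ℝ] E.dom →ₗ[ℝ] Lp ℝ 1 μ
  symm : ∀ u v, toFun u v = toFun v u
  nonneg : ∀ u, ∀ᵐ x ∂μ, 0 ≤ toFun u u x
  continuous : ∃ K : ℝ, ∀ u v, ‖toFun u v‖ ≤ K * (√(E.normSq u) * √(E.normSq v))
  identity : ∀ f g h fg fh gh : E.dom,
    MemLp (f : Lp ℝ 2 μ) ∞ μ → MemLp (g : Lp ℝ 2 μ) ∞ μ → MemLp (h : Lp ℝ 2 μ) ∞ μ →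
    (∀ᵐ x ∂μ, (fg : Lp ℝ 2 μ) x = (f : Lp ℝ 2 μ) x * (g : Lp ℝ 2 μ) x) →
    (∀ᵐ x ∂μ, (fh : Lp ℝ 2 μ) x = (f : Lp ℝ 2 μ) x * (h : Lp ℝ 2 μ) x) →
    (∀ᵐ x ∂μ, (gh : Lp ℝ 2 μ) x = (g : Lp ℝ 2 μ) x * (h : Lp ℝ 2 μ) x) →
    E.form fh g + E.form gh f - E.form h fg =
      2 * ∫ x, (h : Lp ℝ 2 μ) x * toFun f g x ∂μ

/-- `𝒞 = C_b(X) ∩ Dom ℰ`, as a subspace of `L²(X, μ)`. -/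
def contDom [TopologicalSpace X] (E : DirichletForm μ) : Submodule ℝ (Lp ℝ 2 μ) where
  carrier := {u | u ∈ E.dom ∧ ∃ g : X →ᵇ ℝ, u =ᵐ[μ] g}
  zero_mem' := ⟨E.dom.zero_mem, 0, by simpa using Lp.coeFn_zero ℝ 2 μ⟩
  add_mem' := by
    rintro u v ⟨hu, g, hg⟩ ⟨hv, h, hh⟩
    refine ⟨E.dom.add_mem hu hv, g + h, ?_⟩
    filter_upwards [Lp.coeFn_add u v, hg, hh] with x h1 h2 h3
    rw [h1, Pi.add_apply, h2, h3, BoundedContinuousFunction.add_apply]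
  smul_mem' := by
    rintro c u ⟨hu, g, hg⟩
    refine ⟨E.dom.smul_mem c hu, c • g, ?_⟩
    filter_upwards [Lp.coeFn_smul c u, hg] with x h1 h2
    rw [h1, Pi.smul_apply, h2, BoundedContinuousFunction.smul_apply]

/-- The inclusion `𝒞 → Dom ℰ`. -/
def contDomIncl [TopologicalSpace X] (E : DirichletForm μ) : E.contDom →ₗ[ℝ] E.dom :=
  Submodule.inclusion fun _ hu => hu.1

end DirichletForm

/-! ## The Hilbert space of one-forms -/

/-- The algebra `ℬ_b(X)` of bounded measurable functions. -/
def BddMeas (X : Type*) [MeasurableSpace X] : Subalgebra ℝ (X → ℝ) where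
  carrier := {g | Measurable g ∧ ∃ M : ℝ, ∀ x, |g x| ≤ M}
  mul_mem' := by
    rintro f g ⟨hf, M, hM⟩ ⟨hg, N, hN⟩
    refine ⟨hf.mul hg, M * N, fun x => ?_⟩
    rw [Pi.mul_apply, abs_mul]
    exact mul_le_mul (hM x) (hN x) (abs_nonneg _) ((abs_nonneg _).trans (hM x))
  add_mem' := by
    rintro f g ⟨hf, M, hM⟩ ⟨hg, N, hN⟩
    exact ⟨hf.add hg, M + N, fun x => (abs_add_le _ _).trans (add_le_add (hM x) (hN x))⟩
  algebraMap_mem' := fun c => ⟨measurable_const, |c|, fun x => by simp [Pi.algebraMap_apply]⟩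

section OneForms

open DirichletForm

variable {X : Type*} [MeasurableSpace X] {μ : Measure X}

theorem BddMeas.memLp_top (g : BddMeas X) : MemLp (g : X → ℝ) ∞ μ := by
  obtain ⟨hg, M, hM⟩ := g.2
  exact memLp_top_of_bound hg.aestronglyMeasurable M (Eventually.of_forall hM)

/-- The class in `L^∞(X, μ)` of a bounded measurable function. -/
def BddMeas.toLpTop (μ : Measure X) : BddMeas X →ₗ[ℝ] Lp ℝ ∞ μ where
  toFun g := (BddMeas.memLp_top g).toLp
  map_add' _ _ := rfl
  map_smul' _ _ := rfl

/-- The product `(γ, g) ↦ g γ` of `γ ∈ L¹(X, μ)` and a bounded measurable function `g`. -/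
def mulL1 (μ : Measure X) : Lp ℝ 1 μ →ₗ[ℝ] BddMeas X →ₗ[ℝ] Lp ℝ 1 μ :=
  (((ContinuousLinearMap.mul ℝ ℝ).holderₗ μ ∞ 1 1).comp (BddMeas.toLpTop μ)).flip

theorem mulL1_apply (γ : Lp ℝ 1 μ) (g : BddMeas X) :
    mulL1 μ γ g =ᵐ[μ] fun x => (g : X → ℝ) x * γ x := by
  have h1 := (ContinuousLinearMap.mul ℝ ℝ).coeFn_holder (r := 1)
    (BddMeas.toLpTop μ g) γ
  have h2 : BddMeas.toLpTop μ g =ᵐ[μ] (g : X → ℝ) :=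
    MemLp.coeFn_toLp (BddMeas.memLp_top g)
  filter_upwards [h1, h2] with x hx1 hx2
  rw [← hx2]
  exact hx1

theorem memLp_sqrt (γ : Lp ℝ 1 μ) : MemLp (fun x => √(γ x)) 2 μ := by
  have hm : AEStronglyMeasurable (fun x => √(γ x)) μ :=
    Real.continuous_sqrt.comp_aestronglyMeasurable (Lp.aestronglyMeasurable γ)
  rw [memLp_two_iff_integrable_sq hm]
  refine (L1.integrable_coeFn γ).norm.mono (hm.pow 2) (Eventually.of_forall fun x => ?_)
  rcases le_total 0 (γ x) with h | h
  · simp [Real.sq_sqrt h]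
  · simp [Real.sqrt_eq_zero_of_nonpos h]

/-- The class of `√γ` in `L²(X, μ)`, for `γ ∈ L¹(X, μ)` (used for `γ ≥ 0` only). -/
def sqrtLp (γ : Lp ℝ 1 μ) : Lp ℝ 2 μ := (memLp_sqrt γ).toLp

theorem sqrtLp_apply (γ : Lp ℝ 1 μ) : sqrtLp γ =ᵐ[μ] fun x => √(γ x) := MemLp.coeFn_toLp _

/-- `√Γ(f) ∈ L²(X, μ)`, with `Γ(f) = Γ(f, f)`. -/
def DirichletForm.CarreDuChamp.grad {E : DirichletForm μ} (Γ : CarreDuChamp E) (f : E.dom) :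
    Lp ℝ 2 μ :=
  sqrtLp (Γ.toFun f f)

theorem coeFn_sum_ae {ι : Type*} (S : Finset ι) (F : ι → Lp ℝ 1 μ) :
    ∀ᵐ x ∂μ, (∑ i ∈ S, F i : Lp ℝ 1 μ) x = ∑ i ∈ S, F i x := by
  classical
  induction S using Finset.induction_on with
  | empty =>
    filter_upwards [Lp.coeFn_zero ℝ 1 μ] with x hx
    rw [Finset.sum_empty, Finset.sum_empty, hx, Pi.zero_apply]
  | insert a S ha ih =>
    simp only [Finset.sum_insert ha]
    filter_upwards [ih, Lp.coeFn_add (F a) (∑ i ∈ S, F i)] with x h1 h2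
    rw [h2, Pi.add_apply, h1]

variable [TopologicalSpace X] {E : DirichletForm μ}

/-- The space `𝒞 ⊗ ℬ_b(X)` of simple one-forms (with the semi-inner product attached to `Γ`). -/
def SimpleForm (_Γ : CarreDuChamp E) : Type _ := E.contDom ⊗[ℝ] BddMeas X

namespace SimpleForm

variable (Γ : CarreDuChamp E)

instance : AddCommGroup (SimpleForm Γ) := inferInstanceAs (AddCommGroup (_ ⊗[ℝ] _))
instance : Module ℝ (SimpleForm Γ) := inferInstanceAs (Module ℝ (_ ⊗[ℝ] _))

/-- The fibrewise product: the `L¹(X, μ)`-valued bilinear map with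
`⟨f₁ ⊗ g₁, f₂ ⊗ g₂⟩_x = g₁(x) g₂(x) Γ(f₁, f₂)(x)`. -/
def fiberInner : SimpleForm Γ →ₗ[ℝ] SimpleForm Γ →ₗ[ℝ] Lp ℝ 1 μ :=
  (LinearMap.BilinMap.tmul (R := ℝ) (A := ℝ)
    (Γ.toFun.compl₁₂ E.contDomIncl E.contDomIncl)
    (LinearMap.mul ℝ (BddMeas X))).compr₂ (TensorProduct.lift (mulL1 μ))

/-- The simple tensor `f ⊗ g`. -/
def tmul (f : E.contDom) (g : BddMeas X) : SimpleForm Γ := f ⊗ₜ[ℝ] g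

theorem fiberInner_tmul (f₁ f₂ : E.contDom) (g₁ g₂ : BddMeas X) :
    fiberInner Γ (tmul Γ f₁ g₁) (tmul Γ f₂ g₂) =
      mulL1 μ (Γ.toFun (E.contDomIncl f₁) (E.contDomIncl f₂)) (g₁ * g₂) := rfl

theorem fiberInner_symm (ω η : SimpleForm Γ) : fiberInner Γ ω η = fiberInner Γ η ω := by
  have := LinearMap.BilinMap.tmul_isSymm (R := ℝ) (A := ℝ)
    (B₁ := Γ.toFun.compl₁₂ E.contDomIncl E.contDomIncl)
    (B₂ := LinearMap.mul ℝ (BddMeas X)) (fun x y => Γ.symm _ _) (fun x y => mul_comm _ _) ω η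
  exact congrArg (TensorProduct.lift (mulL1 μ)) this

theorem fiberInner_self_nonneg (ω : SimpleForm Γ) : ∀ᵐ x ∂μ, 0 ≤ fiberInner Γ ω ω x := by
  obtain ⟨S, hS⟩ := TensorProduct.exists_finset (R := ℝ) (M := E.contDom) (N := BddMeas X) ω
  let G : E.contDom × BddMeas X → E.contDom × BddMeas X → Lp ℝ 1 μ := fun s t =>
    Γ.toFun (E.contDomIncl s.1) (E.contDomIncl t.1)
  have hω : fiberInner Γ ω ω = ∑ s ∈ S, ∑ t ∈ S, mulL1 μ (G s t) (s.2 * t.2) := by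
    have h : ω = ∑ s ∈ S, tmul Γ s.1 s.2 := hS
    rw [h]
    simp only [map_sum, LinearMap.sum_apply, fiberInner_tmul]
    rw [Finset.sum_comm]
  have h1 : ∀ᵐ x ∂μ, fiberInner Γ ω ω x =
      ∑ s ∈ S, ∑ t ∈ S, (s.2 : X → ℝ) x * (t.2 : X → ℝ) x * G s t x := by
    have ha := coeFn_sum_ae (μ := μ) S (fun s => ∑ t ∈ S, mulL1 μ (G s t) (s.2 * t.2))
    have hb : ∀ᵐ x ∂μ, ∀ s ∈ S, (∑ t ∈ S, mulL1 μ (G s t) (s.2 * t.2) : Lp ℝ 1 μ) x =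
        ∑ t ∈ S, mulL1 μ (G s t) (s.2 * t.2) x :=
      (Finset.eventually_all S).2 fun s _ => coeFn_sum_ae (μ := μ) S _
    have hc : ∀ᵐ x ∂μ, ∀ s ∈ S, ∀ t ∈ S, mulL1 μ (G s t) (s.2 * t.2) x =
        (s.2 : X → ℝ) x * (t.2 : X → ℝ) x * G s t x :=
      (Finset.eventually_all S).2 fun s _ => (Finset.eventually_all S).2 fun t _ =>
        mulL1_apply _ _
    filter_upwards [ha, hb, hc] with x ha hb hc
    rw [hω, ha]
    exact Finset.sum_congr rfl fun s hs => (hb s hs).trans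
      (Finset.sum_congr rfl fun t ht => hc s hs t ht)
  have h2 : ∀ᵐ x ∂μ, ∀ q : S → ℚ,
      0 ≤ ∑ s : S, ∑ t : S, (q s : ℝ) * (q t : ℝ) * G s t x := by
    rw [ae_all_iff]
    intro q
    let u : E.dom := ∑ s : S, (q s : ℝ) • E.contDomIncl s.1.1
    have hu : Γ.toFun u u = ∑ s : S, ∑ t : S, ((q s : ℝ) * (q t : ℝ)) • G s t := by
      simp only [u, map_sum, LinearMap.sum_apply, map_smul, LinearMap.smul_apply,
        Finset.smul_sum, smul_smul]
      rw [Finset.sum_comm]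
      exact Finset.sum_congr rfl fun s _ => Finset.sum_congr rfl fun t _ => by rw [mul_comm]
    have ha := coeFn_sum_ae (μ := μ) Finset.univ
      (fun s : S => ∑ t : S, ((q s : ℝ) * (q t : ℝ)) • G s t)
    have hb : ∀ᵐ x ∂μ, ∀ s : S, (∑ t : S, ((q s : ℝ) * (q t : ℝ)) • G s t : Lp ℝ 1 μ) x =
        ∑ t : S, (((q s : ℝ) * (q t : ℝ)) • G s t : Lp ℝ 1 μ) x :=
      ae_all_iff.2 fun s => coeFn_sum_ae (μ := μ) Finset.univ _
    have hc : ∀ᵐ x ∂μ, ∀ s t : S, (((q s : ℝ) * (q t : ℝ)) • G s t : Lp ℝ 1 μ) x =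
        (q s : ℝ) * (q t : ℝ) * G s t x :=
      ae_all_iff.2 fun s => ae_all_iff.2 fun t => Lp.coeFn_smul _ _
    filter_upwards [Γ.nonneg u, ha, hb, hc] with x hn ha hb hc
    rw [hu, ha] at hn
    simpa only [hb, hc] using hn
  filter_upwards [h1, h2] with x h1 h2
  have hd : DenseRange (Pi.map (fun (_ : S) (q : ℚ) => (q : ℝ))) :=
    DenseRange.piMap fun _ => Rat.denseRange_cast
  have key : ∀ y : S → ℝ, 0 ≤ ∑ s : S, ∑ t : S, y s * y t * G s t x := fun y =>
    hd.induction_on y (isClosed_le continuous_const (by fun_prop)) fun q => h2 q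
  rw [h1, ← Finset.sum_coe_sort]
  simpa only [← Finset.sum_coe_sort S] using key fun s => (s.1.2 : X → ℝ) x

/-- The semi-inner product `⟨f₁ ⊗ g₁, f₂ ⊗ g₂⟩ = ∫ g₁ g₂ Γ(f₁, f₂) dμ`. -/
@[reducible]
def core : PreInnerProductSpace.Core ℝ (SimpleForm Γ) where
  inner ω η := ∫ x, fiberInner Γ ω η x ∂μ
  conj_inner_symm ω η := by simp [fiberInner_symm Γ η ω]
  re_inner_nonneg ω := integral_nonneg_of_ae (fiberInner_self_nonneg Γ ω)
  add_left ω η ζ := by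
    simp only [map_add, LinearMap.add_apply]
    rw [← integral_add (L1.integrable_coeFn _) (L1.integrable_coeFn _)]
    exact integral_congr_ae (Lp.coeFn_add _ _)
  smul_left ω η r := by
    simp only [map_smul, LinearMap.smul_apply]
    rw [conj_trivial, ← integral_const_mul]
    exact integral_congr_ae (Lp.coeFn_smul _ _)

instance : SeminormedAddCommGroup (SimpleForm Γ) :=
  @InnerProductSpace.Core.toSeminormedAddCommGroup ℝ (SimpleForm Γ) _ _ _ (core Γ)

instance : InnerProductSpace ℝ (SimpleForm Γ) := InnerProductSpace.ofCore (core Γ)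

theorem fiberInner_sq_le (ω η : SimpleForm Γ) : ∀ᵐ x ∂μ,
    fiberInner Γ ω η x ^ 2 ≤ fiberInner Γ ω ω x * fiberInner Γ η η x := by
  have h : ∀ᵐ x ∂μ, ∀ q : ℚ, 0 ≤ fiberInner Γ ω ω x + 2 * (q : ℝ) * fiberInner Γ ω η x +
      (q : ℝ) ^ 2 * fiberInner Γ η η x := by
    rw [ae_all_iff]
    intro q
    have he : fiberInner Γ (ω + (q : ℝ) • η) (ω + (q : ℝ) • η) =
        (fiberInner Γ ω ω + (2 * (q : ℝ)) • fiberInner Γ ω η) +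
          ((q : ℝ) ^ 2) • fiberInner Γ η η := by
      simp only [map_add, map_smul, LinearMap.add_apply, LinearMap.smul_apply]
      rw [fiberInner_symm Γ η ω]
      module
    filter_upwards [fiberInner_self_nonneg Γ (ω + (q : ℝ) • η),
      Lp.coeFn_add (fiberInner Γ ω ω + (2 * (q : ℝ)) • fiberInner Γ ω η)
        (((q : ℝ) ^ 2) • fiberInner Γ η η),
      Lp.coeFn_add (fiberInner Γ ω ω) ((2 * (q : ℝ)) • fiberInner Γ ω η),
      Lp.coeFn_smul (2 * (q : ℝ)) (fiberInner Γ ω η),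
      Lp.coeFn_smul ((q : ℝ) ^ 2) (fiberInner Γ η η)] with x h0 h1 h2 h3 h4
    rw [he, h1, Pi.add_apply, h2, Pi.add_apply, h3, h4] at h0
    simpa using h0
  filter_upwards [h] with x hx
  have key : ∀ r : ℝ, 0 ≤ fiberInner Γ η η x * (r * r) + 2 * fiberInner Γ ω η x * r +
      fiberInner Γ ω ω x := fun r =>
    Rat.denseRange_cast.induction_on r (isClosed_le continuous_const (by fun_prop))
      fun q => by linarith [hx q]
  have := discrim_le_zero key
  rw [discrim] at this
  nlinarith

theorem fiberInner_sub_self (ω η : SimpleForm Γ) : ∀ᵐ x ∂μ,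
    fiberInner Γ (ω - η) (ω - η) x =
      fiberInner Γ ω ω x - 2 * fiberInner Γ ω η x + fiberInner Γ η η x := by
  have he : fiberInner Γ (ω - η) (ω - η) =
      (fiberInner Γ ω ω - (2 : ℝ) • fiberInner Γ ω η) + fiberInner Γ η η := by
    simp only [map_sub, LinearMap.sub_apply]
    rw [fiberInner_symm Γ η ω]
    module
  filter_upwards [Lp.coeFn_add (fiberInner Γ ω ω - (2 : ℝ) • fiberInner Γ ω η)
      (fiberInner Γ η η), Lp.coeFn_sub (fiberInner Γ ω ω) ((2 : ℝ) • fiberInner Γ ω η),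
    Lp.coeFn_smul (2 : ℝ) (fiberInner Γ ω η)] with x h1 h2 h3
  rw [he, h1, Pi.add_apply, h2, Pi.sub_apply, h3]
  simp

theorem norm_sq_eq (ω : SimpleForm Γ) : ‖ω‖ ^ 2 = ∫ x, fiberInner Γ ω ω x ∂μ := by
  rw [← real_inner_self_eq_norm_sq]
  rfl

theorem norm_sqrtLp_sub_le (ω η : SimpleForm Γ) :
    ‖sqrtLp (fiberInner Γ ω ω) - sqrtLp (fiberInner Γ η η)‖ ≤ ‖ω - η‖ := by
  refine (sq_le_sq₀ (norm_nonneg _) (norm_nonneg _)).1 ?_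
  rw [norm_sq_eq, ← real_inner_self_eq_norm_sq, L2.inner_def]
  refine integral_mono_ae (L2.integrable_inner _ _) (L1.integrable_coeFn _) ?_
  filter_upwards [fiberInner_sq_le Γ ω η, fiberInner_sub_self Γ ω η,
    fiberInner_self_nonneg Γ ω, fiberInner_self_nonneg Γ η, sqrtLp_apply (fiberInner Γ ω ω),
    sqrtLp_apply (fiberInner Γ η η),
    Lp.coeFn_sub (sqrtLp (fiberInner Γ ω ω)) (sqrtLp (fiberInner Γ η η))]
    with x h1 h2 h3 h4 h5 h6 h7
  have h8 : fiberInner Γ ω η x ≤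
      √(fiberInner Γ ω ω x) * √(fiberInner Γ η η x) := by
    rw [← Real.sqrt_mul h3]
    exact Real.le_sqrt_of_sq_le h1
  rw [h2, h7, Pi.sub_apply, h5, h6]
  simp only [inner_self_eq_norm_sq_to_K, Real.norm_eq_abs, RCLike.ofReal_real_eq_id, id, sq_abs]
  nlinarith [Real.sq_sqrt h3, Real.sq_sqrt h4]

theorem uniformContinuous_sqrtLp :
    UniformContinuous fun ω : SimpleForm Γ => sqrtLp (fiberInner Γ ω ω) :=
  (LipschitzWith.of_dist_le_mul (K := 1) fun ω η => by
    rw [dist_eq_norm, dist_eq_norm, NNReal.coe_one, one_mul]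
    exact norm_sqrtLp_sub_le Γ ω η).uniformContinuous

theorem inner_def (ω η : SimpleForm Γ) : inner ℝ ω η = ∫ x, fiberInner Γ ω η x ∂μ := rfl

end SimpleForm

variable (Γ : CarreDuChamp E)

/-- The Hilbert space `ℋ` of `L²` one-forms: the (Hausdorff) completion of `𝒞 ⊗ ℬ_b(X)`. -/
abbrev OneForm : Type _ := UniformSpace.Completion (SimpleForm Γ)

/-- The fibre norm `x ↦ ‖η‖_{ℋ_x}` of a one-form, as an element of `L²(X, μ)`: on simple forms
it is `x ↦ (∑ᵢⱼ gᵢ(x) gⱼ(x) Γ(fᵢ, fⱼ)(x))^(1/2)`, and it is extended by continuity. -/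
def fiberNorm : OneForm Γ → Lp ℝ 2 μ :=
  UniformSpace.Completion.extension fun ω : SimpleForm Γ => sqrtLp (SimpleForm.fiberInner Γ ω ω)

/-- On simple forms the continuous extension `fiberNorm` has the prescribed value. -/
theorem fiberNorm_coe (ω : SimpleForm Γ) :
    fiberNorm Γ (ω : OneForm Γ) = sqrtLp (SimpleForm.fiberInner Γ ω ω) :=
  UniformSpace.Completion.extension_coe (SimpleForm.uniformContinuous_sqrtLp Γ) ω

/-- `f ↦ f ⊗ 1` on `𝒞`, as a partially defined operator from `L²(X, μ)` to `ℋ`. -/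
def exteriorDerivativeCore : Lp ℝ 2 μ →ₗ.[ℝ] OneForm Γ where
  domain := E.contDom
  toFun := (UniformSpace.Completion.toComplₗᵢ (𝕜 := ℝ) (E := SimpleForm Γ)).toLinearMap.comp
    ((TensorProduct.mk ℝ E.contDom (BddMeas X)).flip 1)

/-- The exterior derivative `∂`: the closure of `f ↦ f ⊗ 1`, `f ∈ 𝒞`. -/
def exteriorDerivative : Lp ℝ 2 μ →ₗ.[ℝ] OneForm Γ := (exteriorDerivativeCore Γ).closure

/-- The co-differential `∂*`, the adjoint of `∂`. -/
def codifferential : OneForm Γ →ₗ.[ℝ] Lp ℝ 2 μ := (exteriorDerivative Γ).adjoint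

/-! ## Functions of bounded variation -/

/-- `Var f = sup {⟨f, ∂*η⟩ : η ∈ Dom ∂*, ‖η‖_{ℋ_x} ≤ 1 for μ-a.e. x}`, with values in `[0, ∞]`.
The family contains `η = 0`, so cutting off negative values does not change the supremum. -/
def Var (f : X → ℝ) : ℝ≥0∞ :=
  ⨆ (η : (codifferential Γ).domain) (_ : ∀ᵐ x ∂μ, fiberNorm Γ η x ≤ 1),
    ENNReal.ofReal (∫ x, f x * codifferential Γ η x ∂μ)

/-- `BV(X)`: the bounded measurable functions of finite variation. -/
def BV : Set (X → ℝ) := {f | f ∈ BddMeas X ∧ Var Γ f < ∞}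

end OneForms

/-! ## The weak Bakry–Émery estimate and the heat kernel -/

/-- The weak Bakry–Émery estimate `√Γ(P_t f) ≤ C₁ e^{C₂ t} P_t √Γ(f)` μ-a.e., for all
`f ∈ Dom ℰ` and `t ≥ 0` (here `g` stands for `P_t f`). -/
def WeakBakryEmery {X : Type*} [MeasurableSpace X] {μ : Measure X} {E : DirichletForm μ}
    (Γ : E.CarreDuChamp) (P : ℝ → Lp ℝ 2 μ →L[ℝ] Lp ℝ 2 μ) (C₁ C₂ : ℝ) : Prop :=
  ∀ t, 0 ≤ t → ∀ f g : E.dom, (g : Lp ℝ 2 μ) = P t f →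
    ∀ᵐ x ∂μ, Γ.grad g x ≤ C₁ * Real.exp (C₂ * t) * P t (Γ.grad f) x

/-- `p` is a heat kernel of the semigroup `P`: for every `t > 0`, `p t` is measurable on `X × X`
and `P_t f(x) = ∫ p_t(x, y) f(y) dμ(y)` for all `f ∈ L²(X, μ)` and almost every `x`. -/
structure IsHeatKernel {X : Type*} [MeasurableSpace X] {μ : Measure X}
    (P : ℝ → Lp ℝ 2 μ →L[ℝ] Lp ℝ 2 μ) (p : ℝ → X → X → ℝ) : Prop where
  measurable : ∀ t, 0 < t → Measurable (Function.uncurry (p t))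
  integrable : ∀ t, 0 < t → ∀ f : Lp ℝ 2 μ, ∀ᵐ x ∂μ, Integrable (fun y => p t x y * f y) μ
  eq_integral : ∀ t, 0 < t → ∀ f : Lp ℝ 2 μ, ∀ᵐ x ∂μ, P t f x = ∫ y, p t x y * f y ∂μ

end DirichletSpace

end

/-! The heat semigroup turns the gradient bound into a Sobolev inequality for continuous functions,
and Hahn–Banach carries that inequality over to BV.

Differentiating `s ↦ ∫ P_s h (P_{t-s} g)² dμ` and using the Bakry–Émery bound gives the reverse
Poincaré inequality `Γ(P_t g) ≤ C₁² / (2t)` for `|g| ≤ 1` (`carre_le_of_abs_le_one`). Its dual is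
the pseudo-Poincaré inequality `‖v - P_t v‖₁ ≤ C₁ √(2t) ∫ √Γ(v) dμ` (`integral_abs_sub_le`).

For continuous `g ≥ 0` in the domain put `B = ∫ g^p dμ` and `a^p = 2MB`, and truncate `g` to the
dyadic bands `[b, 2b]`, `b = a 2^k`. The truncation `v` has its gradient confined to the band by
strict locality. Ultracontractivity gives `P_t v ≤ b/2` at a suitable time `t ≤ 1`, so `v - P_t v ≥
b/2` on `{g ≥ 2b}`. The pseudo-Poincaré inequality then bounds `b^p μ(g ≥ 2b)` by `a^(p-1)` times
the gradient integral over the band, with a constant independent of `k` (`level_set_le`). Summing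
over `k` controls `g^p` above the level `2a`; below it `g^p ≤ (2a)^(p-1) g`. Dividing by `a^(p-1)`
gives `sobolev_of_nonneg`. The restriction `t ≤ 1` is why the levels start at `a` and why the `L¹`
norm appears.

For `f` in BV the key bound is `∫ √Γ(P_s f) dμ ≤ C₁ Var f` (`integral_grad_le_var`). With `w = P_s
f`, the functional `u ↦ ∫ Γ(P_s u, w) / √Γ(w) dμ` is bounded on `L²` and dominated on `𝒞` by `C₁ ∫
√Γ(u) dμ`. Hahn–Banach on simple forms and Riesz representation (`exists_oneForm_of_le`) produce an
admissible one-form whose codifferential represents this functional up to the factor `C₁`; pairing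
it with `f` gives the bound. Regularity replaces `P_s f` by a continuous function with nearly the
same gradient, and Fatou's lemma passes to the limit.

The semigroup facts used (contractivity, symmetry, smoothing, Markov property, calculus for `Γ`) are
derived from the generator by differentiating in time, without spectral theory. -/

noncomputable section

namespace DirichletSpace

/-! ## The heat semigroup on `L²` -/

namespace DirichletForm

variable {X : Type*} [MeasurableSpace X] {μ : Measure X} {E : DirichletForm μ}

theorem HasLaplacian.add {u v u' v' : Lp ℝ 2 μ} (h : E.HasLaplacian u v)
    (h' : E.HasLaplacian u' v') : E.HasLaplacian (u + u') (v + v') := by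
  obtain ⟨hu, h⟩ := h
  obtain ⟨hu', h'⟩ := h'
  refine ⟨E.dom.add_mem hu hu', fun φ => ?_⟩
  have : (⟨u + u', E.dom.add_mem hu hu'⟩ : E.dom) = ⟨u, hu⟩ + ⟨u', hu'⟩ := rfl
  rw [this, map_add, LinearMap.add_apply, h, h', inner_add_left]
  ring

theorem HasLaplacian.smul {u v : Lp ℝ 2 μ} (c : ℝ) (h : E.HasLaplacian u v) :
    E.HasLaplacian (c • u) (c • v) := by
  obtain ⟨hu, h⟩ := h
  refine ⟨E.dom.smul_mem c hu, fun φ => ?_⟩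
  have : (⟨c • u, E.dom.smul_mem c hu⟩ : E.dom) = c • ⟨u, hu⟩ := rfl
  rw [this, map_smul, LinearMap.smul_apply, h, real_inner_smul_left, smul_eq_mul]
  ring

theorem HasLaplacian.sub {u v u' v' : Lp ℝ 2 μ} (h : E.HasLaplacian u v)
    (h' : E.HasLaplacian u' v') : E.HasLaplacian (u - u') (v - v') := by
  simpa [sub_eq_add_neg] using h.add (h'.smul (-1))

theorem HasLaplacian.inner_symm {u v u' v' : Lp ℝ 2 μ} (h : E.HasLaplacian u v)
    (h' : E.HasLaplacian u' v') : inner ℝ v u' = inner ℝ u v' := by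
  obtain ⟨hu, h⟩ := h
  obtain ⟨hu', h'⟩ := h'
  have h1 := h ⟨u', hu'⟩
  have h2 := h' ⟨u, hu⟩
  rw [E.symm] at h1
  rw [h1] at h2
  have h3 := neg_injective h2
  rw [h3, real_inner_comm]

theorem HasLaplacian.inner_nonpos {u v : Lp ℝ 2 μ} (h : E.HasLaplacian u v) :
    inner ℝ v u ≤ 0 := by
  obtain ⟨hu, h⟩ := h
  have h1 := h ⟨u, hu⟩
  have h2 := E.nonneg ⟨u, hu⟩
  rw [h1] at h2
  linarith

namespace IsHeatSemigroup

variable {P : ℝ → Lp ℝ 2 μ →L[ℝ] Lp ℝ 2 μ} (hP : E.IsHeatSemigroup P)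
include hP

theorem laplacian_unique {u v w : Lp ℝ 2 μ} (h : E.HasLaplacian u v) (h' : E.HasLaplacian u w) :
    v = w :=
  tendsto_nhds_unique ((hP.generator u v).2 h) ((hP.generator u w).2 h')

theorem tendsto_zero' (u : Lp ℝ 2 μ) : Tendsto (fun t => P t u) (𝓝[≥] 0) (𝓝 u) := by
  have h : ContinuousWithinAt (fun t => P t u) (Set.Ioi 0) 0 := by
    simpa [ContinuousWithinAt, hP.zero] using hP.tendsto_zero u
  have h2 := (continuousWithinAt_Ioi_iff_Ici.1 h)
  simpa [ContinuousWithinAt, hP.zero] using h2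

/-- Contractivity is not part of `IsHeatSemigroup`. Boundedness near 0 comes from Banach–Steinhaus:
along any sequence of times tending to 0 the orbits are bounded by strong continuity. -/
theorem exists_bound_near : ∃ δ > 0, ∃ M : ℝ, ∀ t, 0 ≤ t → t ≤ δ → ‖P t‖ ≤ M := by
  by_contra! hcon
  have hx : ∀ n : ℕ, ∃ t : ℝ, 0 ≤ t ∧ t ≤ 1 / ((n : ℝ) + 1) ∧ (n : ℝ) < ‖P t‖ :=
    fun n => hcon _ Nat.one_div_pos_of_nat n
  choose t ht0 ht1 ht2 using hx
  have hlim : Tendsto t atTop (𝓝[≥] 0) :=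
    tendsto_nhdsWithin_iff.2 ⟨squeeze_zero ht0 ht1 tendsto_one_div_add_atTop_nhds_zero_nat,
      Eventually.of_forall ht0⟩
  obtain ⟨C, hC⟩ := banach_steinhaus (g := fun n => P (t n)) fun u => by
    obtain ⟨C, hC⟩ := ((hP.tendsto_zero' u).comp hlim).norm.bddAbove_range
    exact ⟨C, fun n => hC ⟨n, rfl⟩⟩
  obtain ⟨n, hn⟩ := exists_nat_gt C
  linarith [hC n, ht2 n]

theorem exists_bound (T : ℝ) : ∃ M : ℝ, ∀ t, 0 ≤ t → t ≤ T → ‖P t‖ ≤ M := by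
  obtain ⟨δ, hδ, M, hM⟩ := hP.exists_bound_near
  have key : ∀ n : ℕ, ∀ t, 0 ≤ t → t ≤ n * δ → ‖P t‖ ≤ (max M 1) ^ n := by
    intro n
    induction n with
    | zero =>
      intro t h0 h1
      have : t = 0 := le_antisymm (by simpa using h1) h0
      subst this
      refine ContinuousLinearMap.opNorm_le_bound _ (by simp) fun u => by simp [hP.zero]
    | succ n ih =>
      intro t h0 h1
      have hM1 : (1 : ℝ) ≤ max M 1 := le_max_right _ _
      rcases le_or_gt t δ with h | h
      · calc ‖P t‖ ≤ M := hM t h0 h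
          _ ≤ max M 1 := le_max_left _ _
          _ ≤ (max M 1) ^ (n + 1) := le_self_pow₀ hM1 (by simp)
      · have h2 : t - δ ≤ n * δ := by push_cast at h1; linarith
        refine ContinuousLinearMap.opNorm_le_bound _ (by positivity) fun u => ?_
        have : P t u = P (t - δ) (P δ u) := by
          rw [← hP.add _ _ (by linarith) hδ.le]; congr 2; ring
        rw [this, pow_succ, mul_assoc]
        exact ((P (t - δ)).le_of_opNorm_le (ih _ (by linarith) h2) _).trans
          (by gcongr; exact (P δ).le_of_opNorm_le ((hM δ hδ.le le_rfl).trans (le_max_left _ _)) u)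
  obtain ⟨n, hn⟩ := exists_nat_gt (T / δ)
  exact ⟨_, fun t h0 h1 => key n t h0 (h1.trans ((div_lt_iff₀ hδ).1 hn).le)⟩

theorem continuousOn (u : Lp ℝ 2 μ) : ContinuousOn (fun t => P t u) (Set.Ici 0) := by
  intro t₀ ht₀
  have ht₀ : (0 : ℝ) ≤ t₀ := ht₀
  obtain ⟨M, hM⟩ := hP.exists_bound (t₀ + 1)
  have hle : ∀ s, 0 ≤ s → s ≤ t₀ + 1 → ‖P s u - P t₀ u‖ ≤ M * ‖P |s - t₀| u - u‖ := by
    intro s hs hs1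
    rcases le_total t₀ s with h | h
    · have : P s u - P t₀ u = P t₀ (P |s - t₀| u - u) := by
        rw [map_sub, abs_of_nonneg (by linarith), ← hP.add _ _ ht₀ (by linarith)]
        congr 3; ring
      rw [this]
      exact (P t₀).le_of_opNorm_le (hM _ ht₀ (by linarith)) _
    · have : P s u - P t₀ u = -P s (P |s - t₀| u - u) := by
        rw [map_sub, abs_of_nonpos (by linarith), ← hP.add _ _ hs (by linarith), neg_sub]
        congr 3; ring
      rw [this, norm_neg]
      exact (P s).le_of_opNorm_le (hM _ hs hs1) _
  have habs : Tendsto (fun s : ℝ => |s - t₀|) (𝓝[Set.Ici 0] t₀) (𝓝[≥] 0) := by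
    refine tendsto_nhdsWithin_iff.2 ⟨?_, Eventually.of_forall fun s => Set.mem_Ici.2 (abs_nonneg _)⟩
    simpa using ((continuous_id.sub (continuous_const (y := t₀))).abs.tendsto t₀).mono_left
      nhdsWithin_le_nhds
  have hlim : Tendsto (fun s => M * ‖P |s - t₀| u - u‖) (𝓝[Set.Ici 0] t₀) (𝓝 0) := by
    have h := (((hP.tendsto_zero' u).comp habs).sub_const u).norm.const_mul M
    simpa using h
  refine tendsto_iff_norm_sub_tendsto_zero.2 (squeeze_zero' (Eventually.of_forall fun s =>
    norm_nonneg _) ?_ hlim)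
  have h1 : ∀ᶠ s in 𝓝[Set.Ici 0] t₀, s ≤ t₀ + 1 :=
    nhdsWithin_le_nhds (Iic_mem_nhds (by linarith))
  filter_upwards [h1, self_mem_nhdsWithin] with s hs hs0 using hle s hs0 hs

/-- Values at negative times are arbitrary; clamping the time gives an integrand continuous on all
of `ℝ`, so the fundamental theorem of calculus applies at 0 as well. -/
theorem continuous_ext (u : Lp ℝ 2 μ) : Continuous fun t : ℝ => P (max t 0) u :=
  (hP.continuousOn u).comp_continuous (by fun_prop) fun t => Set.mem_Ici.2 (le_max_right _ _)

theorem laplacian_comm {u v : Lp ℝ 2 μ} (h : E.HasLaplacian u v) {t : ℝ} (ht : 0 ≤ t) :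
    E.HasLaplacian (P t u) (P t v) := by
  refine (hP.generator _ _).1 ?_
  have h1 := ((P t).continuous.tendsto v).comp ((hP.generator u v).2 h)
  refine h1.congr' ?_
  filter_upwards [self_mem_nhdsWithin] with s (hs : 0 < s)
  simp only [Function.comp, map_smul, map_sub]
  rw [← hP.add _ _ ht hs.le, ← hP.add _ _ hs.le ht, add_comm]

theorem hasDerivWithinAt_Ioi {u v : Lp ℝ 2 μ} (h : E.HasLaplacian u v) {t : ℝ} (ht : 0 ≤ t) :
    HasDerivWithinAt (fun s => P s u) (P t v) (Set.Ioi t) t := by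
  rw [hasDerivWithinAt_iff_tendsto_slope' (by simp)]
  have h1 := (hP.generator _ _).2 (hP.laplacian_comm h ht)
  have h2 : Tendsto (fun s : ℝ => s - t) (𝓝[>] t) (𝓝[>] 0) := by
    refine tendsto_nhdsWithin_iff.2 ⟨?_, ?_⟩
    · have h : Continuous fun s : ℝ => s - t := by fun_prop
      simpa using (h.tendsto t).mono_left nhdsWithin_le_nhds
    · filter_upwards [self_mem_nhdsWithin] with s (hs : t < s) using sub_pos.2 hs
  refine (h1.comp h2).congr' ?_
  filter_upwards [self_mem_nhdsWithin] with s (hs : t < s)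
  simp only [Function.comp, slope, vsub_eq_sub]
  rw [← hP.add _ _ (by linarith) ht]
  congr 4; ring

theorem integral_eq_sub {u v : Lp ℝ 2 μ} (h : E.HasLaplacian u v) {t : ℝ} (ht : 0 ≤ t) :
    ∫ s in (0 : ℝ)..t, P (max s 0) v = P t u - u := by
  have := intervalIntegral.integral_eq_sub_of_hasDeriv_right (f := fun s => P s u)
    (f' := fun s => P (max s 0) v) (a := 0) (b := t)
    ((hP.continuousOn u).mono fun s hs => by rw [Set.uIcc_of_le ht] at hs; exact hs.1)
    (fun s hs => by
      rw [min_eq_left ht] at hs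
      have := hs.1
      rw [max_eq_left this.le]
      exact hP.hasDerivWithinAt_Ioi h this.le)
    ((hP.continuous_ext v).intervalIntegrable _ _)
  rw [this, hP.zero]

/-- The generator only provides a right derivative; the two-sided one comes from writing the orbit
as the integral of a continuous function. -/
theorem hasDerivAt {u v : Lp ℝ 2 μ} (h : E.HasLaplacian u v) {t : ℝ} (ht : 0 < t) :
    HasDerivAt (fun s => P s u) (P t v) t := by
  have h1 : HasDerivAt (fun s => ∫ r in (0 : ℝ)..s, P (max r 0) v) (P (max t 0) v) t :=
    ((hP.continuous_ext v).integral_hasStrictDerivAt 0 t).hasDerivAt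
  rw [max_eq_left ht.le] at h1
  refine (h1.add_const u).congr_of_eventuallyEq ?_
  filter_upwards [Ioi_mem_nhds ht] with s (hs : 0 < s)
  rw [hP.integral_eq_sub h hs.le]
  simp

/-- Together with `integral_eq_sub` this turns the relation `Δu = v` into an integrated identity
that is stable under `L²` limits. -/
theorem laplacian_of_integral_eq {u v : Lp ℝ 2 μ}
    (h : ∀ t, 0 ≤ t → ∫ s in (0 : ℝ)..t, P (max s 0) v = P t u - u) : E.HasLaplacian u v := by
  refine (hP.generator _ _).1 ?_
  have h1 : HasDerivAt (fun s => ∫ r in (0 : ℝ)..s, P (max r 0) v) (P (max 0 0) v) 0 :=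
    ((hP.continuous_ext v).integral_hasStrictDerivAt 0 0).hasDerivAt
  rw [max_self, hP.zero] at h1
  have h2 := (hasDerivWithinAt_iff_tendsto_slope' (by simp)).1
    (h1.hasDerivWithinAt (s := Set.Ioi 0))
  refine h2.congr' ?_
  filter_upwards [self_mem_nhdsWithin] with s (hs : 0 < s)
  simp only [slope, vsub_eq_sub, intervalIntegral.integral_same, sub_zero]
  rw [h s hs.le]

theorem hasLaplacian_average (u : Lp ℝ 2 μ) {t : ℝ} (ht : 0 ≤ t) :
    E.HasLaplacian (∫ s in (0 : ℝ)..t, P (max s 0) u) (P t u - u) := by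
  refine (hP.generator _ _).1 ?_
  have hc := hP.continuous_ext u
  have hd : ∀ x, HasDerivAt (fun s => ∫ r in (0 : ℝ)..s, P (max r 0) u) (P (max x 0) u) x :=
    fun x => (hc.integral_hasStrictDerivAt 0 x).hasDerivAt
  have hd1 : HasDerivAt (fun r => ∫ s in (0 : ℝ)..t + r, P (max s 0) u) (P t u) 0 := by
    have h := hd (t + 0)
    rw [add_zero, max_eq_left ht] at h
    simpa using HasDerivAt.comp_const_add t 0 (by simpa using h)
  have hd0 := hd 0
  rw [max_self, hP.zero] at hd0
  have h2 := (hasDerivWithinAt_iff_tendsto_slope' (by simp)).1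
    ((hd1.sub hd0).hasDerivWithinAt (s := Set.Ioi 0))
  refine h2.congr' ?_
  filter_upwards [self_mem_nhdsWithin] with r (hr : 0 < r)
  simp only [slope, vsub_eq_sub, Pi.sub_apply, intervalIntegral.integral_same, sub_zero, add_zero]
  congr 1
  -- Applying `P_r` shifts the window `[0, t]` to `[r, t + r]`; the difference of the two integrals
  -- is the one over `[t, t + r]` minus the one over `[0, r]`.
  have h3 : P r (∫ s in (0 : ℝ)..t, P (max s 0) u) =
      ∫ s in r..t + r, P (max s 0) u := by
    rw [← ContinuousLinearMap.intervalIntegral_comp_comm _ (hc.intervalIntegrable _ _)]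
    have h4 := intervalIntegral.integral_comp_add_right (a := 0) (b := t)
      (fun s => P (max s 0) u) r
    rw [zero_add] at h4
    rw [← h4]
    refine intervalIntegral.integral_congr fun s hs => ?_
    rw [Set.uIcc_of_le ht] at hs
    rw [max_eq_left hs.1, max_eq_left (add_nonneg hs.1 hr.le), ← hP.add _ _ hr.le hs.1, add_comm]
  rw [h3]
  have hi : ∀ a b, IntervalIntegrable (fun s => P (max s 0) u) volume a b :=
    fun a b => hc.intervalIntegrable a b
  rw [← intervalIntegral.integral_add_adjacent_intervals (hi 0 r) (hi r (t + r))]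
  abel

theorem exists_laplacian_approx (u : Lp ℝ 2 μ) : ∃ f g : ℕ → Lp ℝ 2 μ,
    (∀ n, E.HasLaplacian (f n) (g n)) ∧ Tendsto f atTop (𝓝 u) := by
  let t : ℕ → ℝ := fun n => 1 / ((n : ℝ) + 1)
  have ht : ∀ n, 0 < t n := fun n => Nat.one_div_pos_of_nat
  refine ⟨fun n => (t n)⁻¹ • ∫ s in (0 : ℝ)..t n, P (max s 0) u, fun n => _,
    fun n => (hP.hasLaplacian_average u (ht n).le).smul (t n)⁻¹, ?_⟩
  have h1 : HasDerivAt (fun s => ∫ r in (0 : ℝ)..s, P (max r 0) u) (P (max 0 0) u) 0 :=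
    ((hP.continuous_ext u).integral_hasStrictDerivAt 0 0).hasDerivAt
  rw [max_self, hP.zero] at h1
  have h2 := (hasDerivWithinAt_iff_tendsto_slope' (by simp)).1
    (h1.hasDerivWithinAt (s := Set.Ioi 0))
  have h3 : Tendsto t atTop (𝓝[>] 0) :=
    tendsto_nhdsWithin_iff.2 ⟨tendsto_one_div_add_atTop_nhds_zero_nat, Eventually.of_forall ht⟩
  refine (h2.comp h3).congr fun n => ?_
  simp [slope]

/-! ### Symmetry, contractivity and smoothing -/

theorem norm_le_of_laplacian {u v : Lp ℝ 2 μ} (h : E.HasLaplacian u v) {t : ℝ} (ht : 0 ≤ t) :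
    ‖P t u‖ ≤ ‖u‖ := by
  have hanti : AntitoneOn (fun s => ‖P s u‖ ^ 2) (Set.Ici 0) := by
    refine antitoneOn_of_hasDerivWithinAt_nonpos (convex_Ici 0)
      ((hP.continuousOn u).norm.pow 2)
      (f' := fun s => 2 * inner ℝ (P s u) (P s v)) (fun s hs => ?_) (fun s hs => ?_)
    · rw [interior_Ici] at hs
      exact (hP.hasDerivAt h hs).norm_sq.hasDerivWithinAt
    · rw [interior_Ici] at hs
      have := (hP.laplacian_comm h (le_of_lt hs)).inner_nonpos
      rw [real_inner_comm] at this
      linarith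
  have := hanti (Set.mem_Ici.2 le_rfl) (Set.mem_Ici.2 ht) ht
  simp only [hP.zero] at this
  exact (sq_le_sq₀ (norm_nonneg _) (norm_nonneg _)).1 this

theorem norm_apply_le {t : ℝ} (ht : 0 ≤ t) (u : Lp ℝ 2 μ) : ‖P t u‖ ≤ ‖u‖ := by
  obtain ⟨f, g, hfg, hf⟩ := hP.exists_laplacian_approx u
  exact le_of_tendsto_of_tendsto' (((P t).continuous.tendsto u).comp hf).norm hf.norm
    fun n => hP.norm_le_of_laplacian (hfg n) ht

/-- The function `s ↦ ⟨P_s u, P_{t-s} u'⟩` has derivative 0 because `Δ` is symmetric, so its values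
at 0 and `t` agree. -/
theorem inner_symm_of_laplacian {u v u' v' : Lp ℝ 2 μ} (h : E.HasLaplacian u v)
    (h' : E.HasLaplacian u' v') {t : ℝ} (ht : 0 ≤ t) :
    inner ℝ (P t u) u' = inner ℝ u (P t u') := by
  rcases ht.eq_or_lt with rfl | ht
  · simp [hP.zero]
  have hcont : ContinuousOn (fun s => inner ℝ (P s u) (P (t - s) u')) (Set.Icc 0 t) := by
    refine ContinuousOn.inner (𝕜 := ℝ) ((hP.continuousOn u).mono fun s hs => hs.1) ?_
    exact (hP.continuousOn u').comp (by fun_prop) fun s hs => sub_nonneg.2 hs.2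
  have hder : ∀ s ∈ interior (Set.Icc 0 t), HasDerivWithinAt
      (fun s => inner ℝ (P s u) (P (t - s) u') : ℝ → ℝ) 0 (interior (Set.Icc 0 t)) s := by
    intro s hs
    rw [interior_Icc] at hs
    have h1 := hP.hasDerivAt h hs.1
    have h2 : HasDerivAt (fun s => P (t - s) u') (-P (t - s) v') s :=
      HasDerivAt.comp_const_sub t s (hP.hasDerivAt h' (sub_pos.2 hs.2))
    have h3 := (h1.inner ℝ h2)
    have h4 := (hP.laplacian_comm h hs.1.le).inner_symm
      (hP.laplacian_comm h' (sub_nonneg.2 hs.2.le))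
    rw [inner_neg_right, ← h4] at h3
    simpa using h3.hasDerivWithinAt
  have h1 := antitoneOn_of_hasDerivWithinAt_nonpos (convex_Icc 0 t) hcont hder (fun _ _ => le_rfl)
    (Set.left_mem_Icc.2 ht.le) (Set.right_mem_Icc.2 ht.le) ht.le
  have h2 := monotoneOn_of_hasDerivWithinAt_nonneg (convex_Icc 0 t) hcont hder (fun _ _ => le_rfl)
    (Set.left_mem_Icc.2 ht.le) (Set.right_mem_Icc.2 ht.le) ht.le
  have h3 := le_antisymm h1 h2
  simpa [hP.zero] using h3

theorem inner_symm {t : ℝ} (ht : 0 ≤ t) (u v : Lp ℝ 2 μ) :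
    inner ℝ (P t u) v = inner ℝ u (P t v) := by
  obtain ⟨f, g, hfg, hf⟩ := hP.exists_laplacian_approx u
  obtain ⟨f', g', hfg', hf'⟩ := hP.exists_laplacian_approx v
  have h1 := Tendsto.inner (𝕜 := ℝ) (((P t).continuous.tendsto u).comp hf) hf'
  have h2 := Tendsto.inner (𝕜 := ℝ) hf (((P t).continuous.tendsto v).comp hf')
  exact tendsto_nhds_unique h1 (h2.congr fun n =>
    (hP.inner_symm_of_laplacian (hfg n) (hfg' n) ht).symm)

/-- An elementary substitute for the spectral theorem. One has `(‖P_s u‖²)' = -2 e` and `e' = -2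
‖P_s v‖²`, and both `e` and `‖P_s v‖` decrease. The first relation on `[0, t/2]` gives `t e(t/2) ≤
‖u‖²`, the second on `[t/2, t]` gives `t ‖P_t v‖² ≤ e(t/2)`. -/
theorem norm_laplacian_le {u v : Lp ℝ 2 μ} (h : E.HasLaplacian u v) {t : ℝ} (ht : 0 < t) :
    ‖P t v‖ ≤ t⁻¹ * ‖u‖ := by
  -- `e s = ℰ(P_s u, P_s u)`
  let e : ℝ → ℝ := fun s => -inner ℝ (P (2 * s) u) v
  have hsplit : ∀ w w' : Lp ℝ 2 μ, ∀ s, 0 ≤ s →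
      inner ℝ (P (2 * s) w) w' = inner ℝ (P s w) (P s w') := by
    intro w w' s hs
    rw [two_mul, hP.add _ _ hs hs, hP.inner_symm hs]
  have hmono : ∀ r s, 0 ≤ r → r ≤ s → ‖P s v‖ ≤ ‖P r v‖ := by
    intro r s hr hrs
    have : P s v = P (s - r) (P r v) := by
      rw [← hP.add _ _ (by linarith) hr]; congr 2; ring
    rw [this]
    exact hP.norm_apply_le (by linarith) _
  have he : ∀ s, 0 < s → HasDerivAt e (-2 * ‖P s v‖ ^ 2) s := by
    intro s hs
    have h1 : HasDerivAt (fun s => P (2 * s) u) ((2 : ℝ) • P (2 * s) v) s := by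
      have := (hP.hasDerivAt h (t := 2 * s) (by linarith)).scomp s
        ((hasDerivAt_id s).const_mul 2)
      simpa [Function.comp_def] using this
    have h2 := (h1.inner ℝ (hasDerivAt_const s v)).neg
    rw [inner_zero_right, zero_add, real_inner_smul_left, hsplit _ _ _ hs.le,
      real_inner_self_eq_norm_sq] at h2
    rw [show -2 * ‖P s v‖ ^ 2 = -(2 * ‖P s v‖ ^ 2) by ring]
    exact h2
  have he0 : ∀ s, 0 ≤ s → 0 ≤ e s := by
    intro s hs
    have := (hP.laplacian_comm h hs).inner_nonpos
    rw [real_inner_comm, ← hsplit _ _ _ hs] at this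
    simp only [e]
    linarith
  have heanti : ∀ r s, 0 < r → r ≤ s → e s ≤ e r := by
    intro r s hr hrs
    refine antitoneOn_of_hasDerivWithinAt_nonpos (convex_Ici r)
      (f' := fun s => -2 * ‖P s v‖ ^ 2)
      (fun x hx => (he x (lt_of_lt_of_le hr hx)).continuousAt.continuousWithinAt)
      (fun x hx => ?_) (fun x hx => ?_) (Set.mem_Ici.2 le_rfl) (Set.mem_Ici.2 hrs) hrs
    · rw [interior_Ici] at hx
      exact (he x (lt_trans hr hx)).hasDerivWithinAt
    · nlinarith [sq_nonneg ‖P x v‖]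
  have h1 : 2 * (t / 2) * e (t / 2) ≤ ‖u‖ ^ 2 := by
    have hc : ContinuousOn (fun s => ‖P s u‖ ^ 2 + 2 * s * e (t / 2)) (Set.Icc 0 (t / 2)) :=
      (((hP.continuousOn u).mono fun s hs => hs.1).norm.pow 2).add (by fun_prop)
    have := antitoneOn_of_hasDerivWithinAt_nonpos (convex_Icc 0 (t / 2)) hc
      (f' := fun s => 2 * inner ℝ (P s u) (P s v) + 2 * e (t / 2))
      (fun x hx => ?_) (fun x hx => ?_) (Set.left_mem_Icc.2 (by positivity))
      (Set.right_mem_Icc.2 (by positivity)) (by positivity : 0 ≤ t / 2)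
    · simp only [hP.zero] at this
      nlinarith [sq_nonneg ‖P (t / 2) u‖]
    · rw [interior_Icc] at hx
      refine HasDerivAt.hasDerivWithinAt ?_
      have := (hP.hasDerivAt h hx.1).norm_sq.add
        (((hasDerivAt_id x).const_mul 2).mul_const (e (t / 2)))
      simp only [mul_one] at this
      exact this
    · rw [interior_Icc] at hx
      have := heanti x (t / 2) hx.1 hx.2.le
      rw [← hsplit _ _ _ hx.1.le]
      simp only [e] at this ⊢
      linarith
  have h2 : 2 * (t / 2) * ‖P t v‖ ^ 2 ≤ e (t / 2) := by
    have hc : ContinuousOn (fun s => e s + 2 * s * ‖P t v‖ ^ 2) (Set.Icc (t / 2) t) :=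
      ContinuousOn.add (fun x hx => (he x (by linarith [hx.1])).continuousAt.continuousWithinAt)
        (by fun_prop)
    have := antitoneOn_of_hasDerivWithinAt_nonpos (convex_Icc (t / 2) t) hc
      (f' := fun s => -2 * ‖P s v‖ ^ 2 + 2 * ‖P t v‖ ^ 2)
      (fun x hx => ?_) (fun x hx => ?_) (Set.left_mem_Icc.2 (by linarith))
      (Set.right_mem_Icc.2 (by linarith)) (by linarith : t / 2 ≤ t)
    · simp only at this
      linarith [he0 t ht.le]
    · rw [interior_Icc] at hx
      refine HasDerivAt.hasDerivWithinAt ?_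
      have := (he x (by linarith [hx.1])).add
        (((hasDerivAt_id x).const_mul 2).mul_const (‖P t v‖ ^ 2))
      simp only [mul_one] at this
      exact this
    · rw [interior_Icc] at hx
      have := hmono x t (by linarith [hx.1]) hx.2.le
      have := pow_le_pow_left₀ (norm_nonneg _) this 2
      linarith
  have h3 : (t * ‖P t v‖) ^ 2 ≤ ‖u‖ ^ 2 := by
    have := mul_le_mul_of_nonneg_left h2 ht.le
    nlinarith
  have h4 := (sq_le_sq₀ (by positivity) (norm_nonneg _)).1 h3
  rw [inv_mul_eq_div, le_div_iff₀ ht]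
  linarith

theorem laplacian_closed {f g : ℕ → Lp ℝ 2 μ} {u v : Lp ℝ 2 μ}
    (hfg : ∀ n, E.HasLaplacian (f n) (g n)) (hf : Tendsto f atTop (𝓝 u))
    (hg : Tendsto g atTop (𝓝 v)) : E.HasLaplacian u v := by
  refine hP.laplacian_of_integral_eq fun t ht => ?_
  have h1 : Tendsto (fun n => ∫ s in (0 : ℝ)..t, P (max s 0) (g n)) atTop
      (𝓝 (∫ s in (0 : ℝ)..t, P (max s 0) v)) := by
    rw [tendsto_iff_norm_sub_tendsto_zero]
    have h0 : Tendsto (fun n => ‖g n - v‖ * |t - 0|) atTop (𝓝 0) := by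
      simpa using (tendsto_iff_norm_sub_tendsto_zero.1 hg).mul_const |t - 0|
    refine squeeze_zero (fun n => norm_nonneg _) (fun n => ?_) h0
    rw [← intervalIntegral.integral_sub ((hP.continuous_ext _).intervalIntegrable _ _)
      ((hP.continuous_ext _).intervalIntegrable _ _)]
    refine intervalIntegral.norm_integral_le_of_norm_le_const fun s _ => ?_
    rw [← map_sub]
    exact hP.norm_apply_le (le_max_right _ _) _
  have h2 : Tendsto (fun n => P t (f n) - f n) atTop (𝓝 (P t u - u)) :=
    (((P t).continuous.tendsto u).comp hf).sub hf
  exact tendsto_nhds_unique h1 (h2.congr fun n => (hP.integral_eq_sub (hfg n) ht).symm)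

/-- For `f n → u` in the domain of `Δ`, `norm_laplacian_le` makes `P_t (Δ f n)` a Cauchy sequence,
and closedness of `Δ` identifies its limit. -/
theorem exists_laplacian {t : ℝ} (ht : 0 < t) (u : Lp ℝ 2 μ) :
    ∃ v, E.HasLaplacian (P t u) v ∧ ‖v‖ ≤ t⁻¹ * ‖u‖ := by
  obtain ⟨f, g, hfg, hf⟩ := hP.exists_laplacian_approx u
  have hcau : CauchySeq fun n => P t (g n) := by
    rw [cauchySeq_iff_tendsto_dist_atTop_0]
    have h0 : Tendsto (fun n : ℕ × ℕ => t⁻¹ * dist (f n.1) (f n.2)) atTop (𝓝 0) := by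
      simpa using (cauchySeq_iff_tendsto_dist_atTop_0.1 hf.cauchySeq).const_mul t⁻¹
    refine squeeze_zero (fun n => dist_nonneg) (fun n => ?_) h0
    rw [dist_eq_norm, dist_eq_norm, ← map_sub]
    exact hP.norm_laplacian_le ((hfg n.1).sub (hfg n.2)) ht
  obtain ⟨v, hv⟩ := cauchySeq_tendsto_of_complete hcau
  refine ⟨v, hP.laplacian_closed (fun n => hP.laplacian_comm (hfg n) ht.le)
    (((P t).continuous.tendsto u).comp hf) hv, ?_⟩
  exact le_of_tendsto_of_tendsto' hv.norm (hf.norm.const_mul _)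
    fun n => hP.norm_laplacian_le (hfg n) ht

theorem mem_dom {t : ℝ} (ht : 0 < t) (u : Lp ℝ 2 μ) : P t u ∈ E.dom :=
  (hP.exists_laplacian ht u).choose_spec.1.1

theorem hasDerivAt_of_laplacian {u : Lp ℝ 2 μ} {t : ℝ} (ht : 0 < t) {v : Lp ℝ 2 μ}
    (hv : E.HasLaplacian (P t u) v) : HasDerivAt (fun s => P s u) v t := by
  obtain ⟨w, hw, -⟩ := hP.exists_laplacian (half_pos ht) u
  have h1 := hP.laplacian_comm hw (half_pos ht).le
  rw [← hP.add _ _ (half_pos ht).le (half_pos ht).le, add_halves] at h1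
  rw [hP.laplacian_unique hv h1]
  have h2 : HasDerivAt (fun s => P (s - t / 2) (P (t / 2) u)) (P (t / 2) w) t :=
    HasDerivAt.comp_sub_const t (t / 2)
      (by have := hP.hasDerivAt hw (half_pos ht); rwa [sub_half])
  refine h2.congr_of_eventuallyEq ?_
  filter_upwards [Ioi_mem_nhds (half_lt_self ht)] with s (hs : t / 2 < s)
  rw [← hP.add _ _ (by linarith) (half_pos ht).le]
  congr 2; ring

end IsHeatSemigroup

end DirichletForm

/-! ## The form and its semigroup -/

namespace DirichletForm

variable {X : Type*} [MeasurableSpace X] {μ : Measure X} {E : DirichletForm μ}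

theorem form_sq_le (u v : E.dom) : E.form u v ^ 2 ≤ E.form u u * E.form v v := by
  have key : ∀ r : ℝ, 0 ≤ E.form v v * (r * r) + 2 * E.form u v * r + E.form u u := fun r => by
    have h := E.nonneg (u + r • v)
    simp only [map_add, map_smul, LinearMap.add_apply, LinearMap.smul_apply, smul_eq_mul] at h
    rw [E.symm v u] at h
    linarith
  have := discrim_le_zero key
  rw [discrim] at this
  nlinarith

theorem form_sub_self (u v : E.dom) :
    E.form (u - v) (u - v) = E.form u u - 2 * E.form u v + E.form v v := by
  simp only [map_sub, LinearMap.sub_apply]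
  rw [E.symm v u]
  ring

theorem HasLaplacian.form_eq {u v : Lp ℝ 2 μ} (h : E.HasLaplacian u v) (hu : u ∈ E.dom)
    (φ : E.dom) : E.form ⟨u, hu⟩ φ = -inner ℝ v (φ : Lp ℝ 2 μ) :=
  h.choose_spec φ

namespace IsHeatSemigroup

variable {P : ℝ → Lp ℝ 2 μ →L[ℝ] Lp ℝ 2 μ} (hP : E.IsHeatSemigroup P)
include hP

/-- `P_t` as a map from `L²` to `Dom ℰ`, for `t > 0`. -/
def toDom {t : ℝ} (ht : 0 < t) : Lp ℝ 2 μ →ₗ[ℝ] E.dom :=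
  (P t).toLinearMap.codRestrict E.dom (hP.mem_dom ht)

@[simp] theorem coe_toDom {t : ℝ} (ht : 0 < t) (u : Lp ℝ 2 μ) :
    (hP.toDom ht u : Lp ℝ 2 μ) = P t u := rfl

theorem form_toDom {s : ℝ} (hs : 0 < s) {u w : Lp ℝ 2 μ} (hw : E.HasLaplacian (P s u) w)
    (φ : E.dom) : E.form (hP.toDom hs u) φ = -inner ℝ w (φ : Lp ℝ 2 μ) :=
  hw.form_eq _ φ

theorem laplacian_add {s r : ℝ} (hs : 0 < s) (hr : 0 ≤ r) {u w : Lp ℝ 2 μ}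
    (hw : E.HasLaplacian (P s u) w) : E.HasLaplacian (P (s + r) u) (P r w) := by
  have := hP.laplacian_comm hw hr
  rwa [← hP.add _ _ hr hs.le, add_comm] at this

/-- Only `s + r` enters the right-hand side, so time can be moved freely between the two arguments.
-/
theorem form_toDom_toDom {s r : ℝ} (hs : 0 < s) (hr : 0 < r) {u w : Lp ℝ 2 μ}
    (hw : E.HasLaplacian (P (s + r) u) w) (u' : Lp ℝ 2 μ) :
    E.form (hP.toDom hs u) (hP.toDom hr u') = -inner ℝ w u' := by
  obtain ⟨v, hv, -⟩ := hP.exists_laplacian hs u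
  rw [hP.form_toDom hs hv, hP.coe_toDom, ← hP.inner_symm hr.le,
    hP.laplacian_unique hw (hP.laplacian_add hs hr.le hv)]

theorem form_toDom_eq_half {s : ℝ} (hs : 0 < s) (u : Lp ℝ 2 μ) (v : E.dom) :
    E.form (hP.toDom hs u) v =
      E.form (hP.toDom (half_pos hs) u) (hP.toDom (half_pos hs) (v : Lp ℝ 2 μ)) := by
  obtain ⟨w, hw, -⟩ := hP.exists_laplacian hs u
  rw [hP.form_toDom hs hw, hP.form_toDom_toDom _ _ (by rwa [add_halves])]

/-- The derivative of `⟨b, P_s a⟩` is `⟨b, P_s b⟩ = ‖P_{s/2} b‖²`. Since `-⟨b, P_s a⟩` is the energy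
of `P_{s/2} a`, this is the source of `energy_anti`. -/
theorem inner_comm_le {a b : Lp ℝ 2 μ} (h : E.HasLaplacian a b) {t : ℝ} (ht : 0 ≤ t) :
    inner ℝ b a ≤ inner ℝ (P t b) a := by
  have hmono : MonotoneOn (fun s => inner ℝ b (P s a) : ℝ → ℝ) (Set.Ici 0) := by
    refine monotoneOn_of_hasDerivWithinAt_nonneg (convex_Ici 0)
      (continuousOn_const.inner (𝕜 := ℝ) (hP.continuousOn a))
      (f' := fun s => inner ℝ b (P s b)) (fun s hs => ?_) (fun s hs => ?_)
    · rw [interior_Ici] at hs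
      have := (hasDerivAt_const s b).inner ℝ (hP.hasDerivAt h hs)
      rw [inner_zero_left, add_zero] at this
      exact this.hasDerivWithinAt
    · rw [interior_Ici] at hs
      have hs : 0 < s := hs
      have : P s b = P (s / 2) (P (s / 2) b) := by
        rw [← hP.add _ _ (half_pos hs).le (half_pos hs).le, add_halves]
      rw [this, ← hP.inner_symm (half_pos hs).le]
      exact real_inner_self_nonneg
  have := hmono (Set.mem_Ici.2 le_rfl) (Set.mem_Ici.2 ht) ht
  simp only [hP.zero] at this
  rwa [hP.inner_symm ht]

theorem energy_anti {r s : ℝ} (hr : 0 < r) (hrs : r ≤ s) (u : Lp ℝ 2 μ) :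
    E.form (hP.toDom (hr.trans_le hrs) u) (hP.toDom (hr.trans_le hrs) u) ≤
      E.form (hP.toDom hr u) (hP.toDom hr u) := by
  obtain ⟨w, hw, -⟩ := hP.exists_laplacian hr u
  have h1 : E.HasLaplacian (P (s + s) u) (P (s - r) (P s w)) := by
    have := hP.laplacian_add hr (by linarith : 0 ≤ s + (s - r)) hw
    rw [← hP.add _ _ (by linarith) (by linarith)]
    convert this using 3 <;> ring
  rw [hP.form_toDom_toDom _ _ h1, hP.form_toDom hr hw, hP.coe_toDom]
  have h2 := hP.inner_comm_le hw (by linarith : 0 ≤ 2 * (s - r))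
  have h3 : inner ℝ (P (s - r) (P s w)) u = inner ℝ (P (2 * (s - r)) w) (P r u) := by
    rw [← hP.inner_symm hr.le, ← hP.add _ _ (by linarith) (by linarith),
      ← hP.add _ _ (by linarith) (by linarith)]
    congr 3; ring
  rw [h3]
  linarith

/-- Cauchy–Schwarz applied to `ℰ(P_s a, P_s a) = ℰ(P_{2s} a, a)`, where the energy of `P_{2s} a` is
in turn at most that of `P_s a`. -/
theorem energy_le {s : ℝ} (hs : 0 < s) (a : E.dom) :
    E.form (hP.toDom hs (a : Lp ℝ 2 μ)) (hP.toDom hs (a : Lp ℝ 2 μ)) ≤ E.form a a := by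
  have hs2 : 0 < 2 * s := by linarith
  have h1 := hP.form_toDom_eq_half hs2 (a : Lp ℝ 2 μ) a
  have h2 := E.form_sq_le (hP.toDom hs2 (a : Lp ℝ 2 μ)) a
  have h3 := hP.energy_anti hs (by linarith : s ≤ 2 * s) (a : Lp ℝ 2 μ)
  have he : 2 * s / 2 = s := by ring
  simp only [he] at h1
  rw [h1] at h2
  have h4 := E.nonneg a
  have h5 := E.nonneg (hP.toDom hs (a : Lp ℝ 2 μ))
  by_contra! hlt
  nlinarith

theorem hasDerivAt_inner {s : ℝ} (hs : 0 < s) (u : Lp ℝ 2 μ) (v : E.dom) :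
    HasDerivAt (fun s => inner ℝ (P s u) (v : Lp ℝ 2 μ) : ℝ → ℝ)
      (-E.form (hP.toDom hs u) v) s := by
  obtain ⟨w, hw, -⟩ := hP.exists_laplacian hs u
  have := (hP.hasDerivAt_of_laplacian hs hw).inner ℝ (hasDerivAt_const s (v : Lp ℝ 2 μ))
  rw [inner_zero_right, zero_add] at this
  rwa [hP.form_toDom hs hw, neg_neg]

theorem hasDerivAt_inner_self {s : ℝ} (hs : 0 < s) (u : Lp ℝ 2 μ) :
    HasDerivAt (fun s => inner ℝ (P s u) u : ℝ → ℝ)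
      (-E.form (hP.toDom (half_pos hs) u) (hP.toDom (half_pos hs) u)) s := by
  obtain ⟨w, hw, -⟩ := hP.exists_laplacian hs u
  have := (hP.hasDerivAt_of_laplacian hs hw).inner ℝ (hasDerivAt_const s u)
  rw [inner_zero_right, zero_add] at this
  rwa [hP.form_toDom_toDom (half_pos hs) (half_pos hs) (by rwa [add_halves]), neg_neg]

theorem continuousOn_inner (u v : Lp ℝ 2 μ) :
    ContinuousOn (fun s => inner ℝ (P s u) v : ℝ → ℝ) (Set.Ici 0) :=
  (hP.continuousOn u).inner (𝕜 := ℝ) continuousOn_const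

/-- The derivative of `⟨P_s u, u⟩` is minus the energy of `P_{s/2} u`, which on `[0, t]` is smallest
at the end. -/
theorem mul_energy_le {t : ℝ} (ht : 0 < t) (u : Lp ℝ 2 μ) :
    t * E.form (hP.toDom (half_pos ht) u) (hP.toDom (half_pos ht) u) ≤
      inner ℝ (u - P t u) u := by
  set K := E.form (hP.toDom (half_pos ht) u) (hP.toDom (half_pos ht) u) with hK
  have := antitoneOn_of_deriv_nonpos (convex_Icc 0 t)
    (f := fun s => inner ℝ (P s u) u + s * K)
    (((hP.continuousOn_inner u u).mono fun s hs => hs.1).add (by fun_prop))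
    (fun s hs => ?_) (fun s hs => ?_) (Set.left_mem_Icc.2 ht.le) (Set.right_mem_Icc.2 ht.le) ht.le
  · simp only [hP.zero] at this
    rw [inner_sub_left]
    linarith
  · rw [interior_Icc] at hs
    exact ((hP.hasDerivAt_inner_self hs.1 u).add
      ((hasDerivAt_id s).mul_const K)).differentiableAt.differentiableWithinAt
  · rw [interior_Icc] at hs
    have h1 := (hP.hasDerivAt_inner_self hs.1 u).add ((hasDerivAt_id s).mul_const K)
    have h2 := h1.deriv
    have h3 := hP.energy_anti (half_pos hs.1) (by linarith [hs.2] : s / 2 ≤ t / 2) u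
    change deriv ((fun s => inner ℝ (P s u) u) + fun y => id y * K) s ≤ 0
    rw [h2]
    linarith

theorem inner_sub_le {t : ℝ} (ht : 0 < t) (u : E.dom) :
    inner ℝ ((u : Lp ℝ 2 μ) - P t u) (u : Lp ℝ 2 μ) ≤ t * E.form u u := by
  set K := E.form u u with hK
  have := monotoneOn_of_deriv_nonneg (convex_Icc 0 t)
    (f := fun s => inner ℝ (P s (u : Lp ℝ 2 μ)) (u : Lp ℝ 2 μ) + s * K)
    (((hP.continuousOn_inner _ _).mono fun s hs => hs.1).add (by fun_prop))
    (fun s hs => ?_) (fun s hs => ?_) (Set.left_mem_Icc.2 ht.le) (Set.right_mem_Icc.2 ht.le) ht.le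
  · simp only [hP.zero] at this
    rw [inner_sub_left]
    linarith
  · rw [interior_Icc] at hs
    exact ((hP.hasDerivAt_inner_self hs.1 _).add
      ((hasDerivAt_id s).mul_const K)).differentiableAt.differentiableWithinAt
  · rw [interior_Icc] at hs
    have h1 := (hP.hasDerivAt_inner_self hs.1 (u : Lp ℝ 2 μ)).add ((hasDerivAt_id s).mul_const K)
    have h2 := h1.deriv
    have h3 := hP.energy_le (half_pos hs.1) u
    change 0 ≤ deriv ((fun s => inner ℝ (P s (u : Lp ℝ 2 μ)) (u : Lp ℝ 2 μ)) + fun y => id y * K) s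
    rw [h2]
    linarith

theorem energy_smoothing {t : ℝ} (ht : 0 < t) (u : Lp ℝ 2 μ) :
    E.form (hP.toDom ht u) (hP.toDom ht u) ≤ t⁻¹ * ‖u‖ ^ 2 := by
  obtain ⟨w, hw, hn⟩ := hP.exists_laplacian ht u
  rw [hP.form_toDom ht hw, hP.coe_toDom]
  calc -inner ℝ w (P t u) ≤ |inner ℝ w (P t u)| := neg_le_abs _
    _ ≤ ‖w‖ * ‖P t u‖ := abs_real_inner_le_norm _ _
    _ ≤ (t⁻¹ * ‖u‖) * ‖u‖ := by gcongr; exact hP.norm_apply_le ht.le _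
    _ = t⁻¹ * ‖u‖ ^ 2 := by ring

/-- A family `P_s u` with bounded energy converges in the form norm. -/
theorem exists_dom_of_energy_bounded {u : Lp ℝ 2 μ} {K : ℝ}
    (hK : ∀ s (hs : 0 < s), E.form (hP.toDom hs u) (hP.toDom hs u) ≤ K) :
    ∃ hu : u ∈ E.dom, ∀ ε > 0, ∃ δ, ∃ hδ : 0 < δ,
      E.form (⟨u, hu⟩ : E.dom) ⟨u, hu⟩ - ε ≤ E.form (hP.toDom hδ u) (hP.toDom hδ u) := by
  let t : ℕ → ℝ := fun n => 1 / ((n : ℝ) + 1)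
  have ht : ∀ n, 0 < t n := fun n => Nat.one_div_pos_of_nat
  have htanti : Antitone t := fun m n h => Nat.one_div_le_one_div h
  have ht0 : Tendsto t atTop (𝓝 0) := tendsto_one_div_add_atTop_nhds_zero_nat
  let U : ℕ → E.dom := fun n => hP.toDom (ht n) u
  let e : ℕ → ℝ := fun n => E.form (U n) (U n)
  have he : Monotone e := fun m n h => hP.energy_anti (ht n) (htanti h) u
  have hbdd : BddAbove (Set.range e) := ⟨K, by rintro _ ⟨n, rfl⟩; exact hK _ _⟩
  have hlim := tendsto_atTop_ciSup he hbdd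
  set ℓ := ⨆ n, e n with hℓ
  have hUlim : Tendsto (fun n => (U n : Lp ℝ 2 μ)) atTop (𝓝 u) :=
    (hP.tendsto_zero u).comp (tendsto_nhdsWithin_iff.2 ⟨ht0, Eventually.of_forall ht⟩)
  have hmid : ∀ N m n, N ≤ m → N ≤ n → E.form (U m - U n) (U m - U n) ≤ 2 * (ℓ - e N) := by
    intro N m n hm hn
    rw [E.form_sub_self]
    have hpos : 0 < (t m + t n) / 2 := by linarith [ht m, ht n]
    obtain ⟨w, hw, -⟩ := hP.exists_laplacian (add_pos (ht m) (ht n)) u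
    -- The mixed term is the energy at the mean of the two times. That mean is at most `t N`, so the
    -- mixed term is at least `e N`, which yields the Cauchy property.
    have h1 : E.form (U m) (U n) = E.form (hP.toDom hpos u) (hP.toDom hpos u) := by
      rw [hP.form_toDom_toDom _ _ hw, hP.form_toDom_toDom _ _ (by rwa [add_halves])]
    have h2 := hP.energy_anti hpos (by linarith [htanti hm, htanti hn] : (t m + t n) / 2 ≤ t N) u
    have h3 := le_ciSup hbdd m
    have h4 := le_ciSup hbdd n
    change e m - 2 * E.form (U m) (U n) + e n ≤ _
    rw [h1]
    change e N ≤ _ at h2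
    linarith
  obtain ⟨v, hv⟩ := E.closed U fun ε hε => by
    have h1 : ∀ᶠ N in atTop, ℓ - ε / 4 < e N := hlim.eventually (lt_mem_nhds (by linarith))
    obtain ⟨N₁, hN₁⟩ := h1.exists
    obtain ⟨N₂, hN₂⟩ := Metric.cauchySeq_iff.1 hUlim.cauchySeq (√(ε / 2)) (by positivity)
    refine ⟨max N₁ N₂, fun m hm n hn => ?_⟩
    have h3 := hmid N₁ m n ((le_max_left _ _).trans hm) ((le_max_left _ _).trans hn)
    have h4 := hN₂ m ((le_max_right _ _).trans hm) n ((le_max_right _ _).trans hn)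
    rw [dist_eq_norm] at h4
    have h5 : ‖(U m : Lp ℝ 2 μ) - U n‖ ^ 2 < ε / 2 := by
      rw [← Real.sq_sqrt (by positivity : 0 ≤ ε / 2)]
      exact pow_lt_pow_left₀ h4 (norm_nonneg _) two_ne_zero
    rw [Submodule.coe_sub]
    linarith
  have hv2 : Tendsto (fun n => ‖((U n - v : E.dom) : Lp ℝ 2 μ)‖ ^ 2) atTop (𝓝 0) :=
    squeeze_zero (fun n => sq_nonneg _) (fun n => by linarith [E.nonneg (U n - v)]) hv
  have hv3 : Tendsto (fun n => E.form (U n - v) (U n - v)) atTop (𝓝 0) :=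
    squeeze_zero (fun n => E.nonneg _) (fun n => by
      linarith [sq_nonneg ‖((U n - v : E.dom) : Lp ℝ 2 μ)‖]) hv
  have huv : u = v := by
    refine tendsto_nhds_unique hUlim ?_
    rw [tendsto_iff_norm_sub_tendsto_zero]
    have := hv2.sqrt
    simpa [Real.sqrt_sq (norm_nonneg _)] using this
  refine ⟨huv ▸ v.2, fun ε hε => ?_⟩
  have hvu : (⟨u, huv ▸ v.2⟩ : E.dom) = v := Subtype.ext huv
  rw [hvu]
  have hcross : ∀ n, E.form v v ≤ E.form (U n) (U n) + 2 * √(E.form v v) *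
      √(E.form (U n - v) (U n - v)) := by
    intro n
    have h1 := E.form_sq_le v (U n - v)
    have h2 : E.form (U n) (U n) = E.form v v + 2 * E.form v (U n - v) +
        E.form (U n - v) (U n - v) := by
      rw [E.form_sub_self, map_sub, E.symm v (U n)]; ring
    have h3 : |E.form v (U n - v)| ≤ √(E.form v v) * √(E.form (U n - v) (U n - v)) := by
      rw [← Real.sqrt_mul (E.nonneg _)]
      exact Real.abs_le_sqrt h1
    have := (abs_le.1 h3).1
    have := E.nonneg (U n - v)
    linarith
  have hlim2 : Tendsto (fun n => 2 * √(E.form v v) * √(E.form (U n - v) (U n - v))) atTop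
      (𝓝 0) := by
    simpa using hv3.sqrt.const_mul (2 * √(E.form v v))
  obtain ⟨n, hn⟩ := (hlim2.eventually (gt_mem_nhds hε)).exists
  exact ⟨t n, ht n, by linarith [hcross n]⟩

/-- `ℰ(P_s a - a)` equals the energy at time `s`, minus twice the energy at time `s/2`, plus the
energy of `a`; all of these approach the energy of `a`. -/
theorem tendsto_form {a b : E.dom} : ∀ ε > 0, ∃ δ > 0, ∀ s (hs : 0 < s), s < δ →
    |E.form (hP.toDom hs (a : Lp ℝ 2 μ)) b - E.form a b| < ε := by
  intro ε hε
  obtain ⟨hu, ha⟩ := hP.exists_dom_of_energy_bounded (u := a) fun s hs => hP.energy_le hs a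
  set B := E.form b b with hB
  have hB0 : 0 ≤ B := E.nonneg b
  obtain ⟨δ, hδ, hle⟩ := ha (ε ^ 2 / (4 * (B + 1))) (by positivity)
  refine ⟨δ, hδ, fun s hs hsδ => ?_⟩
  have h1 : E.form (hP.toDom hs (a : Lp ℝ 2 μ) - a) (hP.toDom hs (a : Lp ℝ 2 μ) - a) ≤
      2 * (ε ^ 2 / (4 * (B + 1))) := by
    rw [E.form_sub_self, hP.form_toDom_eq_half hs _ a]
    have h2 := hP.energy_le hs a
    have h3 := hP.energy_anti (half_pos hs) (by linarith : s / 2 ≤ δ) (a : Lp ℝ 2 μ)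
    change E.form a a - _ ≤ _ at hle
    linarith
  have h2 := E.form_sq_le (hP.toDom hs (a : Lp ℝ 2 μ) - a) b
  have h3 : E.form (hP.toDom hs (a : Lp ℝ 2 μ)) b - E.form a b =
      E.form (hP.toDom hs (a : Lp ℝ 2 μ) - a) b := by
    rw [map_sub, LinearMap.sub_apply]
  rw [h3]
  refine abs_lt_of_sq_lt_sq (h2.trans_lt ?_) hε.le
  calc _ ≤ 2 * (ε ^ 2 / (4 * (B + 1))) * B := by gcongr
    _ = ε ^ 2 * (B / (2 * (B + 1))) := by field_simp; ring
    _ < ε ^ 2 * 1 := by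
        gcongr
        rw [div_lt_one (by positivity)]; linarith
    _ = ε ^ 2 := mul_one _

/-- The bridge from `P_t` to `ℰ`: pointwise inequalities for the semigroup become inequalities for
the form, and then for `Γ`, after division by `t`. -/
theorem tendsto_approx_form (a b : E.dom) :
    Tendsto (fun t : ℝ => t⁻¹ * inner ℝ ((a : Lp ℝ 2 μ) - P t a) (b : Lp ℝ 2 μ)) (𝓝[>] 0)
      (𝓝 (E.form a b)) := by
  have h1 : HasDerivWithinAt (fun s => inner ℝ (P s (a : Lp ℝ 2 μ)) (b : Lp ℝ 2 μ) : ℝ → ℝ)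
      (-E.form a b) (Set.Ici 0) 0 := by
    refine hasDerivWithinAt_Ici_of_tendsto_deriv (s := Set.Ioi 0) (fun s hs =>
      (hP.hasDerivAt_inner hs _ b).differentiableAt.differentiableWithinAt)
      (((hP.continuousOn_inner _ _) 0 (Set.mem_Ici.2 le_rfl)).mono Set.Ioi_subset_Ici_self)
      self_mem_nhdsWithin ?_
    rw [Metric.tendsto_nhdsWithin_nhds]
    intro ε hε
    obtain ⟨δ, hδ, h⟩ := hP.tendsto_form (a := a) (b := b) ε hε
    refine ⟨δ, hδ, fun {s} hs hsδ => ?_⟩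
    have hs : 0 < s := hs
    rw [(hP.hasDerivAt_inner hs _ b).deriv, Real.dist_eq, ← abs_neg]
    convert h s hs (by rwa [Real.dist_eq, sub_zero, abs_of_pos hs] at hsδ) using 2
    ring
  have h2 := (hasDerivWithinAt_iff_tendsto_slope' (by simp)).1 (h1.mono Set.Ioi_subset_Ici_self)
  refine (by simpa using h2.neg : Tendsto _ _ (𝓝 (E.form a b))).congr fun t => ?_
  simp only [slope, vsub_eq_sub, smul_eq_mul, sub_zero, hP.zero, inner_sub_left]
  ring

/-- The criterion by which compositions and products are shown to stay in `Dom ℰ`: `mul_energy_le`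
converts the hypothesis into bounded energy of `P_s u`. -/
theorem mem_dom_of_inner_sub_le {u : Lp ℝ 2 μ} {K : ℝ}
    (h : ∀ t, 0 < t → inner ℝ (u - P t u) u ≤ t * K) : u ∈ E.dom := by
  refine (hP.exists_dom_of_energy_bounded (K := K) fun s hs => ?_).1
  have h1 := hP.mul_energy_le (t := 2 * s) (by linarith) u
  have he : 2 * s / 2 = s := by ring
  simp only [he] at h1
  exact le_of_mul_le_mul_left (h1.trans (h _ (by linarith))) (by linarith)

end IsHeatSemigroup

end DirichletForm

/-! ## Bounded elements of `L²` -/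

section BoundedElements

variable {X : Type*} [MeasurableSpace X] {μ : Measure X}

open Classical in
/-- The class in `L²(X, μ)` of a square integrable function (and `0` for other functions). -/
def classOf (μ : Measure X) (f : X → ℝ) : Lp ℝ 2 μ :=
  if h : MemLp f 2 μ then h.toLp f else 0

theorem classOf_ae' {f : X → ℝ} (h : MemLp f 2 μ) : classOf μ f =ᵐ[μ] f := by
  rw [classOf, dif_pos h]
  exact h.coeFn_toLp

theorem inner_eq_integral (u v : Lp ℝ 2 μ) : inner ℝ u v = ∫ x, u x * v x ∂μ := by
  rw [L2.inner_def]
  refine integral_congr_ae (Eventually.of_forall fun x => ?_)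
  simp [mul_comm]

theorem integrable_mul (u v : Lp ℝ 2 μ) : Integrable (fun x => u x * v x) μ :=
  (Lp.memLp u).integrable_mul (Lp.memLp v)

theorem integrable_bdd_mul {h F : X → ℝ} (hF : Integrable F μ) (hm : AEStronglyMeasurable h μ)
    {K : ℝ} (hK : ∀ᵐ x ∂μ, |h x| ≤ K) : Integrable (fun x => h x * F x) μ :=
  hF.bdd_mul hm hK

theorem memLp_top_of_abs_le {u : Lp ℝ 2 μ} {K : ℝ} (h : ∀ᵐ x ∂μ, |u x| ≤ K) : MemLp u ∞ μ :=
  memLp_top_of_bound (Lp.aestronglyMeasurable u) K h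

variable [IsProbabilityMeasure μ]

theorem classOf_ae {f : X → ℝ} (hm : AEStronglyMeasurable f μ) {K : ℝ}
    (h : ∀ᵐ x ∂μ, |f x| ≤ K) : classOf μ f =ᵐ[μ] f :=
  classOf_ae' (MemLp.of_bound hm K h)

theorem classOf_comp_ae {φ : ℝ → ℝ} (hφ : Continuous φ) {u : Lp ℝ 2 μ} {K : ℝ}
    (h : ∀ᵐ x ∂μ, |u x| ≤ K) :
    ∃ K', (∀ᵐ x ∂μ, |φ (u x)| ≤ K') ∧ classOf μ (fun x => φ (u x)) =ᵐ[μ] fun x => φ (u x) := by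
  obtain ⟨C, hC⟩ := (isCompact_Icc (a := -K) (b := K)).exists_bound_of_continuousOn hφ.continuousOn
  have hb : ∀ᵐ x ∂μ, |φ (u x)| ≤ C := by
    filter_upwards [h] with x hx using hC _ (abs_le.1 hx)
  exact ⟨C, hb, classOf_ae (hφ.comp_aestronglyMeasurable (Lp.aestronglyMeasurable u)) hb⟩

/-- The constant function `1` as an element of `L²`. -/
def oneLp (μ : Measure X) : Lp ℝ 2 μ := classOf μ fun _ => 1

theorem oneLp_ae : ∀ᵐ x ∂μ, oneLp μ x = 1 :=
  classOf_ae (aestronglyMeasurable_const) (K := 1) (Eventually.of_forall fun _ => by simp)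

theorem inner_oneLp (u : Lp ℝ 2 μ) : inner ℝ u (oneLp μ) = ∫ x, u x ∂μ := by
  rw [inner_eq_integral]
  refine integral_congr_ae ?_
  filter_upwards [oneLp_ae (μ := μ)] with x hx
  rw [hx, mul_one]

theorem norm_le_of_abs_le_one {u : Lp ℝ 2 μ} (h : ∀ᵐ x ∂μ, |u x| ≤ 1) : ‖u‖ ≤ 1 := by
  have : ‖u‖ ≤ ‖oneLp μ‖ := by
    refine Lp.norm_le_norm_of_ae_le ?_
    filter_upwards [h, oneLp_ae (μ := μ)] with x h1 h2
    rw [h2]; simpa using h1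
  refine this.trans ?_
  have h2 : ‖oneLp μ‖ ^ 2 = 1 := by
    rw [← real_inner_self_eq_norm_sq, inner_oneLp, integral_congr_ae (oneLp_ae (μ := μ))]
    simp
  nlinarith [norm_nonneg (oneLp μ)]

theorem integrable_coe (u : Lp ℝ 2 μ) : Integrable u μ :=
  (Lp.memLp u).integrable (by norm_num)

end BoundedElements

/-! ### The Markov property of the semigroup and calculus on bounded elements of `Dom ℰ`. -/

namespace DirichletForm

variable {X : Type*} [MeasurableSpace X] {μ : Measure X} [IsProbabilityMeasure μ]
  {E : DirichletForm μ}

omit [IsProbabilityMeasure μ] in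
-- For `0 < ε ≤ 1` the point `v + ε (a - v)` has the same truncation `v`, so the Markov property
-- says that `v` minimises the energy on this segment. The first-order term gives `ℰ(a - v, v) ≥ 0`.
theorem inner_sub_truncation_nonneg (a v : E.dom)
    (hv : ∀ᵐ x ∂μ, (v : Lp ℝ 2 μ) x = min (max ((a : Lp ℝ 2 μ) x) 0) 1) :
    0 ≤ E.form (a - v) a := by
  have key : ∀ ε : ℝ, 0 < ε → ε ≤ 1 → 0 ≤ 2 * E.form (a - v) v + ε * E.form (a - v) (a - v) := by
    intro ε h0 h1
    obtain ⟨v', hv', hle⟩ := E.markov (v + ε • (a - v))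
    have : v' = v := by
      refine Subtype.ext (Lp.ext ?_)
      filter_upwards [hv, hv', Lp.coeFn_add (v : Lp ℝ 2 μ) (ε • ((a : Lp ℝ 2 μ) - (v : Lp ℝ 2 μ))),
        Lp.coeFn_smul ε ((a : Lp ℝ 2 μ) - (v : Lp ℝ 2 μ)), Lp.coeFn_sub (a : Lp ℝ 2 μ) (v : Lp ℝ 2 μ)]
        with x h2 h3 h4 h5 h6
      rw [h3]
      change min (max (((v : Lp ℝ 2 μ) + ε • ((a : Lp ℝ 2 μ) - v) : Lp ℝ 2 μ) x) 0) 1 = _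
      rw [h4, Pi.add_apply, h5, Pi.smul_apply, h6, Pi.sub_apply, smul_eq_mul]
      generalize (a : Lp ℝ 2 μ) x = α at *
      generalize (v : Lp ℝ 2 μ) x = β at *
      rcases le_total α 0 with h | h
      · rw [max_eq_right h, min_eq_left zero_le_one] at h2
        subst h2
        rw [max_eq_right (by nlinarith), min_eq_left zero_le_one]
      · rw [max_eq_left h] at h2
        rcases le_total α 1 with h' | h'
        · rw [min_eq_left h'] at h2
          subst h2
          simp [h, h']
        · rw [min_eq_right h'] at h2
          subst h2
          rw [max_eq_left (by nlinarith), min_eq_right (by nlinarith)]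
    rw [this] at hle
    simp only [map_add, map_smul, LinearMap.add_apply, LinearMap.smul_apply, smul_eq_mul] at hle
    rw [E.symm v (a - v)] at hle
    have : 0 ≤ ε * (2 * E.form (a - v) v + ε * E.form (a - v) (a - v)) := by linarith
    exact nonneg_of_mul_nonneg_right this h0
  have h1 : 0 ≤ 2 * E.form (a - v) v := by
    refine ge_of_tendsto (x := 𝓝[>] (0 : ℝ))
      (f := fun ε => 2 * E.form (a - v) v + ε * E.form (a - v) (a - v)) ?_ ?_
    · have : Continuous fun ε : ℝ => 2 * E.form (a - v) v + ε * E.form (a - v) (a - v) := by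
        fun_prop
      simpa using (this.tendsto 0).mono_left nhdsWithin_le_nhds
    · filter_upwards [Ioc_mem_nhdsGT (zero_lt_one (α := ℝ))] with ε hε using key ε hε.1 hε.2
  have h2 := E.nonneg (a - v)
  have h3 : E.form (a - v) a = E.form (a - v) v + E.form (a - v) (a - v) := by
    rw [← map_add]; congr 1; abel
  linarith

/-- The convex set of functions with values in `[0, 1]`. -/
def unitSet (μ : Measure X) : Set (Lp ℝ 2 μ) := {u | ∀ᵐ x ∂μ, 0 ≤ u x ∧ u x ≤ 1}

omit [IsProbabilityMeasure μ] in
-- Truncation picks pointwise the nearest point of `[0, 1]`, hence is the metric projection in `L²`.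
theorem infDist_unitSet (a v : Lp ℝ 2 μ) (hv : ∀ᵐ x ∂μ, v x = min (max (a x) 0) 1) :
    Metric.infDist a (unitSet μ) = ‖a - v‖ := by
  have hmem : v ∈ unitSet μ := by
    filter_upwards [hv] with x hx
    rw [hx]
    exact ⟨le_min (le_max_right _ _) zero_le_one, min_le_right _ _⟩
  refine le_antisymm ((Metric.infDist_le_dist_of_mem hmem).trans (dist_eq_norm _ _).le) ?_
  refine (Metric.le_infDist ⟨v, hmem⟩).2 fun c hc => ?_
  rw [dist_eq_norm]
  refine Lp.norm_le_norm_of_ae_le ?_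
  filter_upwards [hv, hc, Lp.coeFn_sub a v, Lp.coeFn_sub a c] with x h1 h2 h3 h4
  rw [h3, h4, Pi.sub_apply, Pi.sub_apply, h1, Real.norm_eq_abs, Real.norm_eq_abs]
  rcases le_total (a x) 0 with h | h
  · rw [max_eq_right h, min_eq_left zero_le_one, abs_of_nonpos (by linarith),
      abs_of_nonpos (by linarith)]
    linarith
  · rw [max_eq_left h]
    rcases le_total (a x) 1 with h' | h'
    · rw [min_eq_left h']; simp
    · rw [min_eq_right h', abs_of_nonneg (by linarith), abs_of_nonneg (by linarith)]
      linarith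

namespace IsHeatSemigroup

variable {P : ℝ → Lp ℝ 2 μ →L[ℝ] Lp ℝ 2 μ} (hP : E.IsHeatSemigroup P)
include hP

omit [IsProbabilityMeasure μ] in
/-- The heat semigroup leaves the set of functions with values in `[0, 1]` invariant. -/
theorem mem_unitSet {f : Lp ℝ 2 μ} (hf : f ∈ unitSet μ) {t : ℝ} (ht : 0 ≤ t) :
    P t f ∈ unitSet μ := by
  rcases ht.eq_or_lt with rfl | ht
  · rwa [hP.zero]
  let ψ : ℝ → ℝ := fun s => Metric.infDist (P s f) (unitSet μ) ^ 2
  have hψ : ContinuousOn ψ (Set.Ici 0) :=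
    ((Metric.continuous_infDist_pt _).comp_continuousOn (hP.continuousOn f)).pow 2
  have hψ0 : ψ 0 = 0 := by
    simp only [ψ, hP.zero]
    rw [Metric.infDist_zero_of_mem hf]; simp
  -- For general `f` derivatives are available only at positive times, so the comparison starts at
  -- `ε`, and `ε → 0` is taken at the end.
  have hmono : ∀ ε, 0 < ε → ε ≤ t → ψ t ≤ ψ ε := by
    intro ε hε hεt
    refine image_le_of_liminf_slope_right_le_deriv_boundary (f := ψ) (a := ε) (b := t)
      (B := fun _ => ψ ε) (B' := fun _ => 0) (hψ.mono fun s hs => hε.le.trans hs.1) le_rfl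
      continuousOn_const (fun s _ => hasDerivWithinAt_const _ _ _) (fun s hs r hr => ?_)
      (Set.right_mem_Icc.2 hεt)
    have hs0 : 0 < s := hε.trans_le hs.1
    obtain ⟨v, hv, -⟩ := E.markov (hP.toDom hs0 f)
    obtain ⟨w, hw, -⟩ := hP.exists_laplacian hs0 f
    -- Freezing the projection `v` of `P_s f` bounds the squared distance at later times `z` by
    -- `‖P_z f - v‖²`, with equality at `z = s`. The derivative of this bound at `s` is `2 ⟨P_s f -
    -- v, Δ P_s f⟩ ≤ 0`.
    have h1 := (((hP.hasDerivAt_of_laplacian hs0 hw).sub_const (v : Lp ℝ 2 μ)).norm_sq)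
    have h2 : inner ℝ (P s f - v) w ≤ 0 := by
      have h3 := inner_sub_truncation_nonneg (hP.toDom hs0 f) v hv
      rw [E.symm, hP.form_toDom hs0 hw, Submodule.coe_sub, hP.coe_toDom, real_inner_comm] at h3
      linarith
    have h3 := (hasDerivWithinAt_iff_tendsto_slope' (by simp)).1
      (h1.hasDerivWithinAt (s := Set.Ioi s))
    have h4 := h3.eventually (gt_mem_nhds (by linarith : 2 * inner ℝ (P s f - v) w < r))
    refine Eventually.frequently ?_
    filter_upwards [h4, self_mem_nhdsWithin] with z hz (hsz : s < z)
    refine lt_of_le_of_lt ?_ hz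
    simp only [slope, vsub_eq_sub, smul_eq_mul]
    have h5 : ψ s = ‖P s f - v‖ ^ 2 := by
      exact congrArg (· ^ 2) (infDist_unitSet _ _ hv)
    have h6 : ψ z ≤ ‖P z f - v‖ ^ 2 := by
      refine pow_le_pow_left₀ Metric.infDist_nonneg ?_ 2
      rw [← dist_eq_norm]
      refine Metric.infDist_le_dist_of_mem ?_
      filter_upwards [hv] with x hx
      rw [hx]
      exact ⟨le_min (le_max_right _ _) zero_le_one, min_le_right _ _⟩
    rw [h5]
    exact mul_le_mul_of_nonneg_left (by linarith) (inv_nonneg.2 (by linarith))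
  have hle : ψ t ≤ 0 := by
    have hlim : Tendsto ψ (𝓝[>] 0) (𝓝 0) := by
      have := (hψ 0 (Set.mem_Ici.2 le_rfl)).mono Set.Ioi_subset_Ici_self
      rwa [ContinuousWithinAt, hψ0] at this
    refine ge_of_tendsto hlim ?_
    filter_upwards [Ioc_mem_nhdsGT ht] with ε hε using hmono ε hε.1 hε.2
  obtain ⟨v, hv, -⟩ := E.markov (hP.toDom ht f)
  have h1 : ψ t = ‖P t f - v‖ ^ 2 := by
    exact congrArg (· ^ 2) (infDist_unitSet _ _ hv)
  rw [h1] at hle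
  have h2 : P t f = v := by
    rw [← sub_eq_zero, ← norm_eq_zero]
    nlinarith [norm_nonneg (P t f - v)]
  rw [h2]
  filter_upwards [hv] with x hx
  rw [hx]
  exact ⟨le_min (le_max_right _ _) zero_le_one, min_le_right _ _⟩

/-- By symmetry `∫_A P_t u dμ = ⟨u, P_t 1_A⟩`, and `P_t 1_A` takes values in `[0, 1]`; this covers
unbounded `u` directly. -/
theorem nonneg_of_nonneg {u : Lp ℝ 2 μ} (hu : ∀ᵐ x ∂μ, 0 ≤ u x) {t : ℝ} (ht : 0 ≤ t) :
    ∀ᵐ x ∂μ, 0 ≤ P t u x := by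
  refine ae_nonneg_of_forall_setIntegral_nonneg (integrable_coe _) fun A hA _ => ?_
  let χ : Lp ℝ 2 μ := classOf μ (A.indicator 1)
  have hχ : χ =ᵐ[μ] A.indicator 1 :=
    classOf_ae (aestronglyMeasurable_one.indicator hA) (K := 1) (Eventually.of_forall fun x => by
      by_cases h : x ∈ A <;> simp [h])
  have h1 : ∫ x in A, P t u x ∂μ = inner ℝ u (P t χ) := by
    rw [← hP.inner_symm ht, inner_eq_integral, ← integral_indicator hA]
    refine integral_congr_ae ?_
    filter_upwards [hχ] with x hx
    rw [hx]
    by_cases h : x ∈ A <;> simp [h]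
  rw [h1, inner_eq_integral]
  have h2 : χ ∈ unitSet μ := by
    filter_upwards [hχ] with x hx
    rw [hx]
    by_cases h : x ∈ A <;> simp [h]
  refine integral_nonneg_of_ae ?_
  filter_upwards [hu, hP.mem_unitSet h2 ht] with x h3 h4 using mul_nonneg h3 h4.1

theorem mono_of_le {u v : Lp ℝ 2 μ} (huv : ∀ᵐ x ∂μ, u x ≤ v x) {t : ℝ} (ht : 0 ≤ t) :
    ∀ᵐ x ∂μ, P t u x ≤ P t v x := by
  have h := hP.nonneg_of_nonneg (u := v - u) (by
    filter_upwards [huv, Lp.coeFn_sub v u] with x h1 h2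
    rw [h2, Pi.sub_apply]; linarith) ht
  rw [map_sub] at h
  filter_upwards [h, Lp.coeFn_sub (P t v) (P t u)] with x h1 h2
  rw [h2, Pi.sub_apply] at h1; linarith

theorem abs_le_of_abs_le {u v : Lp ℝ 2 μ} (huv : ∀ᵐ x ∂μ, |u x| ≤ v x) {t : ℝ} (ht : 0 ≤ t) :
    ∀ᵐ x ∂μ, |P t u x| ≤ P t v x := by
  have h1 := hP.mono_of_le (u := u) (v := v) (huv.mono fun x hx => (abs_le.1 hx).2) ht
  have h2 := hP.mono_of_le (u := -u) (v := v) (by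
    filter_upwards [huv, Lp.coeFn_neg u] with x h1 h2
    rw [h2, Pi.neg_apply]; linarith [(abs_le.1 h1).1]) ht
  rw [map_neg] at h2
  filter_upwards [h1, h2, Lp.coeFn_neg (P t u)] with x h1 h2 h3
  rw [h3, Pi.neg_apply] at h2
  exact abs_le.2 ⟨by linarith, h1⟩

variable (hone : E.HasLaplacian (oneLp μ) 0)
include hone

omit [IsProbabilityMeasure μ] in
theorem apply_one {t : ℝ} (ht : 0 ≤ t) : P t (oneLp μ) = oneLp μ := by
  have := hP.integral_eq_sub hone ht
  simp only [map_zero, intervalIntegral.integral_zero] at this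
  exact (sub_eq_zero.1 this.symm)

theorem abs_apply_le {u : Lp ℝ 2 μ} {K : ℝ} (hu : ∀ᵐ x ∂μ, |u x| ≤ K) {t : ℝ} (ht : 0 ≤ t) :
    ∀ᵐ x ∂μ, |P t u x| ≤ K := by
  have h := hP.abs_le_of_abs_le (u := u) (v := K • oneLp μ) (by
    filter_upwards [hu, Lp.coeFn_smul K (oneLp μ), oneLp_ae (μ := μ)] with x h1 h2 h3
    rw [h2, Pi.smul_apply, h3]; simpa using h1) ht
  rw [map_smul, hP.apply_one hone ht] at h
  filter_upwards [h, Lp.coeFn_smul K (oneLp μ), oneLp_ae (μ := μ)] with x h1 h2 h3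
  rw [h2, Pi.smul_apply, h3] at h1; simpa using h1

theorem integral_apply {t : ℝ} (ht : 0 ≤ t) (u : Lp ℝ 2 μ) :
    ∫ x, P t u x ∂μ = ∫ x, u x ∂μ := by
  rw [← inner_oneLp, hP.inner_symm ht, hP.apply_one hone ht, inner_oneLp]

/-- Jensen's inequality for the heat semigroup and the square. -/
theorem sq_le {u u2 : Lp ℝ 2 μ} (hu2 : ∀ᵐ x ∂μ, u2 x = u x ^ 2) {t : ℝ} (ht : 0 ≤ t) :
    ∀ᵐ x ∂μ, P t u x ^ 2 ≤ P t u2 x := by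
  -- Positivity of `P_t (c - u)²` for every constant `c`. Countably many `c` share one null set, and
  -- density then allows the choice `c = P_t u x`.
  have h : ∀ᵐ x ∂μ, ∀ c : ℚ, 0 ≤ (c : ℝ) ^ 2 - 2 * c * P t u x + P t u2 x := by
    rw [ae_all_iff]
    intro c
    have h1 := hP.nonneg_of_nonneg (u := ((c : ℝ) ^ 2) • oneLp μ - (2 * (c : ℝ)) • u + u2) (by
      filter_upwards [hu2, oneLp_ae (μ := μ), Lp.coeFn_smul ((c : ℝ) ^ 2) (oneLp μ),
        Lp.coeFn_smul (2 * (c : ℝ)) u, Lp.coeFn_sub (((c : ℝ) ^ 2) • oneLp μ) ((2 * (c : ℝ)) • u),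
        Lp.coeFn_add (((c : ℝ) ^ 2) • oneLp μ - (2 * (c : ℝ)) • u) u2] with x h1 h2 h3 h4 h5 h6
      rw [h6, Pi.add_apply, h5, Pi.sub_apply, h4, h3, Pi.smul_apply, Pi.smul_apply, h1, h2]
      simp only [smul_eq_mul]
      nlinarith [sq_nonneg ((c : ℝ) - u x)]) ht
    rw [map_add, map_sub, map_smul, map_smul, hP.apply_one hone ht] at h1
    filter_upwards [h1, oneLp_ae (μ := μ), Lp.coeFn_smul ((c : ℝ) ^ 2) (oneLp μ),
        Lp.coeFn_smul (2 * (c : ℝ)) (P t u),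
        Lp.coeFn_sub (((c : ℝ) ^ 2) • oneLp μ) ((2 * (c : ℝ)) • P t u),
        Lp.coeFn_add (((c : ℝ) ^ 2) • oneLp μ - (2 * (c : ℝ)) • P t u) (P t u2)]
        with x h1 h2 h3 h4 h5 h6
    rw [h6, Pi.add_apply, h5, Pi.sub_apply, h4, h3, Pi.smul_apply, Pi.smul_apply, h2] at h1
    simpa using h1
  filter_upwards [h] with x hx
  have key : ∀ r : ℝ, 0 ≤ r ^ 2 - 2 * r * P t u x + P t u2 x := fun r =>
    Rat.denseRange_cast.induction_on r (isClosed_le continuous_const (by fun_prop)) hx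
  nlinarith [key (P t u x)]

/-- Contractions operate pointwise on `u² - 2 u P_t u + P_t u²`. -/
theorem approx_contraction {φ : ℝ → ℝ} {L : ℝ} (hφc : Continuous φ)
    (hφ : ∀ a b, |φ a - φ b| ≤ L * |a - b|) {u v u2 v2 : Lp ℝ 2 μ}
    (hv : ∀ᵐ x ∂μ, v x = φ (u x)) (hu2 : ∀ᵐ x ∂μ, u2 x = u x * u x)
    (hv2 : ∀ᵐ x ∂μ, v2 x = v x * v x) {t : ℝ} (ht : 0 ≤ t) :
    ∀ᵐ x ∂μ, v2 x - 2 * v x * P t v x + P t v2 x ≤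
      L ^ 2 * (u2 x - 2 * u x * P t u x + P t u2 x) := by
  -- `P_t` is applied to `(φ c - v)² ≤ L² (c - u)²` with `c` constant; afterwards `c = u x` is
  -- reached by density of the rationals.
  have h : ∀ᵐ x ∂μ, ∀ c : ℚ, φ c ^ 2 - 2 * φ c * P t v x + P t v2 x ≤
      L ^ 2 * ((c : ℝ) ^ 2 - 2 * c * P t u x + P t u2 x) := by
    rw [ae_all_iff]
    intro c
    have hlin : ∀ (d : ℝ) (w w2 : Lp ℝ 2 μ), ∀ᵐ x ∂μ,
        ((d ^ 2) • oneLp μ - (2 * d) • w + w2 : Lp ℝ 2 μ) x = d ^ 2 - 2 * d * w x + w2 x := by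
      intro d w w2
      filter_upwards [oneLp_ae (μ := μ), Lp.coeFn_smul (d ^ 2) (oneLp μ),
        Lp.coeFn_smul (2 * d) w, Lp.coeFn_sub ((d ^ 2) • oneLp μ) ((2 * d) • w),
        Lp.coeFn_add ((d ^ 2) • oneLp μ - (2 * d) • w) w2] with x h2 h3 h4 h5 h6
      rw [h6, Pi.add_apply, h5, Pi.sub_apply, h4, h3, Pi.smul_apply, Pi.smul_apply, h2]
      simp
    have hPlin : ∀ (d : ℝ) (w w2 : Lp ℝ 2 μ), P t ((d ^ 2) • oneLp μ - (2 * d) • w + w2) =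
        (d ^ 2) • oneLp μ - (2 * d) • P t w + P t w2 := by
      intro d w w2
      rw [map_add, map_sub, map_smul, map_smul, hP.apply_one hone ht]
    have h1 := hP.mono_of_le (u := (φ c ^ 2) • oneLp μ - (2 * φ c) • v + v2)
      (v := (L ^ 2) • (((c : ℝ) ^ 2) • oneLp μ - (2 * (c : ℝ)) • u + u2)) (by
        filter_upwards [hlin (φ c) v v2, hlin c u u2, hv, hu2, hv2,
          Lp.coeFn_smul (L ^ 2) (((c : ℝ) ^ 2) • oneLp μ - (2 * (c : ℝ)) • u + u2)]
          with x h1 h2 h3 h4 h5 h6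
        rw [h6, Pi.smul_apply, h1, h2, h5, h4, h3, smul_eq_mul]
        have h7 := pow_le_pow_left₀ (abs_nonneg _) (hφ c (u x)) 2
        rw [mul_pow, sq_abs, sq_abs] at h7
        linarith) ht
    rw [map_smul, hPlin, hPlin] at h1
    filter_upwards [h1, hlin (φ c) (P t v) (P t v2), hlin c (P t u) (P t u2),
      Lp.coeFn_smul (L ^ 2) (((c : ℝ) ^ 2) • oneLp μ - (2 * (c : ℝ)) • P t u + P t u2)]
      with x h1 h2 h3 h4
    rwa [h4, Pi.smul_apply, h2, h3, smul_eq_mul] at h1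
  filter_upwards [h, hv, hu2, hv2] with x hx h1 h2 h3
  have key : ∀ r : ℝ, φ r ^ 2 - 2 * φ r * P t v x + P t v2 x ≤
      L ^ 2 * (r ^ 2 - 2 * r * P t u x + P t u2 x) := fun r =>
    Rat.denseRange_cast.induction_on r (isClosed_le (by fun_prop) (by fun_prop)) hx
  have := key (u x)
  rw [h3, h2, h1]
  rw [h1] at *
  linarith

omit [IsProbabilityMeasure μ] hP hone in
-- After division by `t` the right-hand side tends to `2 ℰ(u, uh) - ℰ(u², h) = 2 ∫ h Γ(u) dμ`: the
-- integrand is a semigroup approximation of the carré du champ.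
theorem integral_approx {u u2 h hu : Lp ℝ 2 μ} (hu2 : ∀ᵐ x ∂μ, u2 x = u x * u x)
    (hhu : ∀ᵐ x ∂μ, hu x = u x * h x) (t : ℝ) :
    Integrable (fun x => h x * (u2 x - 2 * u x * P t u x + P t u2 x)) μ ∧
    ∫ x, h x * (u2 x - 2 * u x * P t u x + P t u2 x) ∂μ =
      2 * inner ℝ (u - P t u) hu - inner ℝ (u2 - P t u2) h := by
  have hae : (fun x => h x * (u2 x - 2 * u x * P t u x + P t u2 x)) =ᵐ[μ]
      fun x => 2 * ((u - P t u : Lp ℝ 2 μ) x * hu x) - (u2 - P t u2 : Lp ℝ 2 μ) x * h x := by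
    filter_upwards [hu2, hhu, Lp.coeFn_sub u (P t u), Lp.coeFn_sub u2 (P t u2)] with x h1 h2 h3 h4
    rw [h3, h4, Pi.sub_apply, Pi.sub_apply, h2, h1]
    ring
  have hi1 := (integrable_mul (u - P t u) hu).const_mul 2
  have hi2 := integrable_mul (u2 - P t u2) h
  refine ⟨(hi1.sub hi2).congr hae.symm, ?_⟩
  rw [integral_congr_ae hae, integral_sub hi1 hi2, integral_const_mul, inner_eq_integral,
    inner_eq_integral]

theorem approx_contraction_integral {φ : ℝ → ℝ} {L : ℝ} (hφc : Continuous φ)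
    (hφ : ∀ a b, |φ a - φ b| ≤ L * |a - b|) {u v u2 v2 h hu hv : Lp ℝ 2 μ}
    (hvu : ∀ᵐ x ∂μ, v x = φ (u x)) (hu2 : ∀ᵐ x ∂μ, u2 x = u x * u x)
    (hv2 : ∀ᵐ x ∂μ, v2 x = v x * v x) (h0 : ∀ᵐ x ∂μ, 0 ≤ h x)
    (hhu : ∀ᵐ x ∂μ, hu x = u x * h x) (hhv : ∀ᵐ x ∂μ, hv x = v x * h x)
    {t : ℝ} (ht : 0 ≤ t) :
    2 * inner ℝ (v - P t v) hv - inner ℝ (v2 - P t v2) h ≤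
      L ^ 2 * (2 * inner ℝ (u - P t u) hu - inner ℝ (u2 - P t u2) h) := by
  obtain ⟨i1, e1⟩ := integral_approx (P := P) hu2 hhu t
  obtain ⟨i2, e2⟩ := integral_approx (P := P) hv2 hhv t
  rw [← e1, ← e2, ← integral_const_mul]
  refine integral_mono_ae i2 (i1.const_mul _) ?_
  filter_upwards [hP.approx_contraction hone hφc hφ hvu hu2 hv2 ht, h0] with x h1 h2
  have := mul_le_mul_of_nonneg_left h1 h2
  linarith

/-- Lipschitz functions operate on bounded elements of `Dom ℰ`. -/
theorem comp_mem_dom {φ : ℝ → ℝ} {L : ℝ} (hφc : Continuous φ)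
    (hφ : ∀ a b, |φ a - φ b| ≤ L * |a - b|) {u v : Lp ℝ 2 μ} (hu : u ∈ E.dom) {K : ℝ}
    (hK : ∀ᵐ x ∂μ, |u x| ≤ K) (hv : ∀ᵐ x ∂μ, v x = φ (u x)) : v ∈ E.dom := by
  refine hP.mem_dom_of_inner_sub_le (K := L ^ 2 * E.form ⟨u, hu⟩ ⟨u, hu⟩) fun t ht => ?_
  obtain ⟨K', hK', -⟩ := classOf_comp_ae hφc hK
  have hvK : ∀ᵐ x ∂μ, |v x| ≤ K' := by
    filter_upwards [hv, hK'] with x h1 h2 using by rwa [h1]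
  obtain ⟨-, -, hu2⟩ := classOf_comp_ae (μ := μ) (φ := fun r => r * r) (by fun_prop) hK
  obtain ⟨-, -, hv2⟩ := classOf_comp_ae (μ := μ) (φ := fun r => r * r) (by fun_prop) hvK
  have h1 := hP.approx_contraction_integral hone hφc hφ hv hu2 hv2 (h := oneLp μ)
    (by filter_upwards [oneLp_ae (μ := μ)] with x hx using by rw [hx]; exact zero_le_one)
    (hu := u) (hv := v)
    (by filter_upwards [oneLp_ae (μ := μ)] with x hx using by rw [hx, mul_one])
    (by filter_upwards [oneLp_ae (μ := μ)] with x hx using by rw [hx, mul_one]) ht.le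
  -- With `h = 1` the terms in `u²` and `v²` vanish, since `P_t` is symmetric and fixes constants.
  have h2 : ∀ w : Lp ℝ 2 μ, inner ℝ (w - P t w) (oneLp μ) = 0 := fun w => by
    rw [inner_sub_left, hP.inner_symm ht.le, hP.apply_one hone ht.le, sub_self]
  rw [h2, h2] at h1
  have h3 := hP.inner_sub_le ht (⟨u, hu⟩ : E.dom)
  have h4 := mul_le_mul_of_nonneg_left h3 (sq_nonneg L)
  change L ^ 2 * inner ℝ (u - P t u) u ≤ _ at h4
  linarith

/-- The square is not Lipschitz on `ℝ`; composed with the clamp to `[-K, K]` it has Lipschitz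
constant `2 K` and the same values on the range of `u`. -/
theorem sq_mem_dom {u v : Lp ℝ 2 μ} (hu : u ∈ E.dom) {K : ℝ}
    (hK : ∀ᵐ x ∂μ, |u x| ≤ K) (hv : ∀ᵐ x ∂μ, v x = u x * u x) : v ∈ E.dom := by
  have hK0 : 0 ≤ K := by
    obtain ⟨x, hx⟩ := hK.exists
    exact (abs_nonneg _).trans hx
  let c : ℝ → ℝ := fun r => max (-K) (min r K)
  have hc1 : ∀ r, |c r| ≤ K := fun r =>
    abs_le.2 ⟨le_max_left _ _, max_le (by linarith) (min_le_right _ _)⟩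
  have hc2 : ∀ a b, |c a - c b| ≤ |a - b| := fun a b => by
    refine (abs_max_sub_max_le_max _ _ _ _).trans ?_
    rw [sub_self, abs_zero]
    refine max_le (abs_nonneg _) ((abs_min_sub_min_le_max _ _ _ _).trans ?_)
    rw [sub_self, abs_zero]
    exact max_le le_rfl (abs_nonneg _)
  refine hP.comp_mem_dom hone (φ := fun r => c r * c r) (L := 2 * K) (by fun_prop)
    (fun a b => ?_) hu hK ?_
  · have : c a * c a - c b * c b = (c a + c b) * (c a - c b) := by ring
    rw [this, abs_mul]
    exact mul_le_mul ((abs_add_le _ _).trans (by linarith [hc1 a, hc1 b])) (hc2 a b)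
      (abs_nonneg _) (by linarith)
  · filter_upwards [hK, hv] with x h1 h2
    have : c (u x) = u x := by
      simp only [c]
      rw [min_eq_left (abs_le.1 h1).2, max_eq_right (abs_le.1 h1).1]
    rw [h2, this]

/-- The bounded elements of `Dom ℰ` form an algebra. -/
theorem mul_mem_dom {u v w : Lp ℝ 2 μ} (hu : u ∈ E.dom) (hv : v ∈ E.dom) {K K' : ℝ}
    (hK : ∀ᵐ x ∂μ, |u x| ≤ K) (hK' : ∀ᵐ x ∂μ, |v x| ≤ K') (hw : ∀ᵐ x ∂μ, w x = u x * v x) :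
    w ∈ E.dom := by
  have hb1 : ∀ᵐ x ∂μ, |(u + v) x| ≤ K + K' := by
    filter_upwards [hK, hK', Lp.coeFn_add u v] with x h1 h2 h3
    rw [h3, Pi.add_apply]; exact (abs_add_le _ _).trans (add_le_add h1 h2)
  have hb2 : ∀ᵐ x ∂μ, |(u - v) x| ≤ K + K' := by
    filter_upwards [hK, hK', Lp.coeFn_sub u v] with x h1 h2 h3
    rw [h3, Pi.sub_apply]; exact (abs_sub _ _).trans (add_le_add h1 h2)
  obtain ⟨-, -, hs⟩ := classOf_comp_ae (μ := μ) (φ := fun r => r * r) (by fun_prop) hb1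
  obtain ⟨-, -, hd⟩ := classOf_comp_ae (μ := μ) (φ := fun r => r * r) (by fun_prop) hb2
  have h1 := hP.sq_mem_dom hone (E.dom.add_mem hu hv) hb1 hs
  have h2 := hP.sq_mem_dom hone (E.dom.sub_mem hu hv) hb2 hd
  have h3 : w = (4⁻¹ : ℝ) • (classOf μ (fun x => (u + v) x * (u + v) x) -
      classOf μ (fun x => (u - v) x * (u - v) x)) := by
    refine Lp.ext ?_
    filter_upwards [hw, hs, hd, Lp.coeFn_add u v, Lp.coeFn_sub u v,
      Lp.coeFn_smul (4⁻¹ : ℝ) (classOf μ (fun x => (u + v) x * (u + v) x) -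
        classOf μ (fun x => (u - v) x * (u - v) x)),
      Lp.coeFn_sub (classOf μ (fun x => (u + v) x * (u + v) x))
        (classOf μ (fun x => (u - v) x * (u - v) x))] with x h1 h2 h3 h4 h5 h6 h7
    rw [h6, Pi.smul_apply, h7, Pi.sub_apply, h2, h3, h4, h5, h1]
    simp only [Pi.add_apply, Pi.sub_apply, smul_eq_mul]
    ring
  rw [h3]
  exact E.dom.smul_mem _ (E.dom.sub_mem h1 h2)

omit hone in
/-- An integrable function is nonnegative if its integrals against the bounded nonnegative
elements of `Dom ℰ` are nonnegative. -/
theorem ae_nonneg_of_dom {F : X → ℝ} (hF : Integrable F μ)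
    (H : ∀ h : E.dom, (∀ᵐ x ∂μ, 0 ≤ (h : Lp ℝ 2 μ) x ∧ (h : Lp ℝ 2 μ) x ≤ 1) →
      0 ≤ ∫ x, (h : Lp ℝ 2 μ) x * F x ∂μ) : ∀ᵐ x ∂μ, 0 ≤ F x := by
  refine ae_nonneg_of_forall_setIntegral_nonneg hF fun A hA _ => ?_
  let χ : Lp ℝ 2 μ := classOf μ (A.indicator 1)
  have hχ : χ =ᵐ[μ] A.indicator 1 :=
    classOf_ae (aestronglyMeasurable_one.indicator hA) (K := 1) (Eventually.of_forall fun x => by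
      by_cases h : x ∈ A <;> simp [h])
  have h2 : χ ∈ unitSet μ := by
    filter_upwards [hχ] with x hx
    rw [hx]
    by_cases h : x ∈ A <;> simp [h]
  have hpos : ∀ n : ℕ, (0 : ℝ) < 1 / ((n : ℝ) + 1) := fun n => Nat.one_div_pos_of_nat
  -- The indicator need not lie in `Dom ℰ`, but its images under `P` at small positive times do;
  -- they keep values in `[0, 1]`, and a subsequence converges almost everywhere.
  have hlim : Tendsto (fun n : ℕ => P (1 / ((n : ℝ) + 1)) χ) atTop (𝓝 χ) :=
    (hP.tendsto_zero χ).comp (tendsto_nhdsWithin_iff.2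
      ⟨tendsto_one_div_add_atTop_nhds_zero_nat, Eventually.of_forall hpos⟩)
  obtain ⟨ns, -, hns⟩ := (tendstoInMeasure_of_tendsto_Lp hlim).exists_seq_tendsto_ae
  have hunit : ∀ n, ∀ᵐ x ∂μ, 0 ≤ P (1 / ((ns n : ℝ) + 1)) χ x ∧ P (1 / ((ns n : ℝ) + 1)) χ x ≤ 1 :=
    fun n => hP.mem_unitSet h2 (hpos _).le
  have h3 : Tendsto (fun n => ∫ x, P (1 / ((ns n : ℝ) + 1)) χ x * F x ∂μ) atTop
      (𝓝 (∫ x, χ x * F x ∂μ)) := by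
    refine tendsto_integral_of_dominated_convergence (fun x => |F x|)
      (fun n => (Lp.aestronglyMeasurable _).mul hF.1) hF.abs (fun n => ?_) ?_
    · filter_upwards [hunit n] with x hx
      rw [Real.norm_eq_abs, abs_mul, abs_of_nonneg hx.1]
      exact mul_le_of_le_one_left (abs_nonneg _) hx.2
    · filter_upwards [hns] with x hx using hx.mul_const _
  have h4 : ∫ x in A, F x ∂μ = ∫ x, χ x * F x ∂μ := by
    rw [← integral_indicator hA]
    refine integral_congr_ae ?_
    filter_upwards [hχ] with x hx
    rw [hx]
    by_cases h : x ∈ A <;> simp [h]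
  rw [h4]
  exact ge_of_tendsto' h3 fun n => H (hP.toDom (hpos (ns n)) χ) (hunit n)

end IsHeatSemigroup

end DirichletForm

/-! ### Multiplication by bounded functions in `L²`. -/

section BoundedElements

variable {X : Type*} [MeasurableSpace X] {μ : Measure X}

theorem classOf_mul_ae {b : X → ℝ} (hm : AEStronglyMeasurable b μ) {K : ℝ}
    (hb : ∀ᵐ x ∂μ, |b x| ≤ K) (u : Lp ℝ 2 μ) :
    classOf μ (fun x => b x * u x) =ᵐ[μ] fun x => b x * u x := by
  refine classOf_ae' (((Lp.memLp u).const_mul K).mono (hm.mul (Lp.aestronglyMeasurable u)) ?_)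
  filter_upwards [hb] with x hx
  rw [norm_mul, norm_mul]
  gcongr
  exact hx.trans (le_abs_self _)

theorem tendsto_of_abs_sub_le {ι : Type*} {l : Filter ι} {u p : ι → Lp ℝ 2 μ} {v q : Lp ℝ 2 μ}
    {K : ℝ} (hu : Tendsto u l (𝓝 v))
    (h : ∀ i, ∀ᵐ x ∂μ, |p i x - q x| ≤ K * |u i x - v x|) : Tendsto p l (𝓝 q) := by
  rw [tendsto_iff_norm_sub_tendsto_zero] at hu ⊢
  refine squeeze_zero (fun i => norm_nonneg _) (fun i => ?_) (by simpa using hu.const_mul K)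
  refine Lp.norm_le_mul_norm_of_ae_le_mul ?_
  filter_upwards [h i, Lp.coeFn_sub (p i) q, Lp.coeFn_sub (u i) v] with x h1 h2 h3
  rw [h2, h3]
  exact h1

theorem tendsto_classOf_mul {ι : Type*} {l : Filter ι} {b : X → ℝ}
    (hm : AEStronglyMeasurable b μ) {K : ℝ} (hb : ∀ᵐ x ∂μ, |b x| ≤ K) {u : ι → Lp ℝ 2 μ}
    {v : Lp ℝ 2 μ} (hu : Tendsto u l (𝓝 v)) :
    Tendsto (fun i => classOf μ fun x => b x * u i x) l (𝓝 (classOf μ fun x => b x * v x)) := by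
  refine tendsto_of_abs_sub_le (K := K) hu fun i => ?_
  filter_upwards [classOf_mul_ae hm hb (u i), classOf_mul_ae hm hb v, hb] with x h1 h2 h3
  rw [h1, h2, ← mul_sub, abs_mul]
  gcongr

end BoundedElements

namespace DirichletForm

variable {X : Type*} [MeasurableSpace X] {μ : Measure X} {E : DirichletForm μ}

/-! ## Pointwise properties of the carré du champ -/

namespace CarreDuChamp

variable (Γ : CarreDuChamp E)

theorem grad_ae (u : E.dom) : ∀ᵐ x ∂μ, Γ.grad u x = √(Γ.toFun u u x) := sqrtLp_apply _

theorem grad_nonneg (u : E.dom) : ∀ᵐ x ∂μ, 0 ≤ Γ.grad u x := by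
  filter_upwards [Γ.grad_ae u] with x hx using by rw [hx]; exact Real.sqrt_nonneg _

theorem grad_sq (u : E.dom) : ∀ᵐ x ∂μ, Γ.grad u x ^ 2 = Γ.toFun u u x := by
  filter_upwards [Γ.grad_ae u, Γ.nonneg u] with x hx h0 using by rw [hx, Real.sq_sqrt h0]

theorem toFun_add_smul (u v : E.dom) (r : ℝ) : ∀ᵐ x ∂μ,
    Γ.toFun (u + r • v) (u + r • v) x =
      Γ.toFun u u x + 2 * r * Γ.toFun u v x + r ^ 2 * Γ.toFun v v x := by
  have he : Γ.toFun (u + r • v) (u + r • v) =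
      (Γ.toFun u u + (2 * r) • Γ.toFun u v) + (r ^ 2) • Γ.toFun v v := by
    simp only [map_add, map_smul, LinearMap.add_apply, LinearMap.smul_apply]
    rw [Γ.symm v u]
    module
  rw [he]
  filter_upwards [Lp.coeFn_add (Γ.toFun u u + (2 * r) • Γ.toFun u v) ((r ^ 2) • Γ.toFun v v),
    Lp.coeFn_add (Γ.toFun u u) ((2 * r) • Γ.toFun u v),
    Lp.coeFn_smul (2 * r) (Γ.toFun u v), Lp.coeFn_smul (r ^ 2) (Γ.toFun v v)] with x h1 h2 h3 h4
  rw [h1, Pi.add_apply, h2, Pi.add_apply, h3, h4]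
  simp

theorem toFun_sq_le (u v : E.dom) : ∀ᵐ x ∂μ,
    Γ.toFun u v x ^ 2 ≤ Γ.toFun u u x * Γ.toFun v v x := by
  have h : ∀ᵐ x ∂μ, ∀ q : ℚ, 0 ≤ Γ.toFun u u x + 2 * (q : ℝ) * Γ.toFun u v x +
      (q : ℝ) ^ 2 * Γ.toFun v v x := by
    rw [ae_all_iff]
    intro q
    filter_upwards [Γ.nonneg (u + (q : ℝ) • v), Γ.toFun_add_smul u v q] with x h0 h1
    rwa [h1] at h0
  filter_upwards [h] with x hx
  have key : ∀ r : ℝ, 0 ≤ Γ.toFun v v x * (r * r) + 2 * Γ.toFun u v x * r + Γ.toFun u u x :=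
    fun r => Rat.denseRange_cast.induction_on r (isClosed_le continuous_const (by fun_prop))
      fun q => by linarith [hx q]
  have := discrim_le_zero key
  rw [discrim] at this
  nlinarith

theorem abs_toFun_le (u v : E.dom) : ∀ᵐ x ∂μ, |Γ.toFun u v x| ≤ Γ.grad u x * Γ.grad v x := by
  filter_upwards [Γ.toFun_sq_le u v, Γ.grad_ae u, Γ.grad_ae v, Γ.nonneg u] with x h1 h2 h3 h4
  rw [h2, h3, ← Real.sqrt_mul h4]
  exact Real.abs_le_sqrt h1

theorem grad_le_add (u v : E.dom) : ∀ᵐ x ∂μ, Γ.grad u x ≤ Γ.grad v x + Γ.grad (u - v) x := by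
  have he : u = v + (1 : ℝ) • (u - v) := by rw [one_smul]; abel
  filter_upwards [Γ.toFun_add_smul v (u - v) 1, Γ.abs_toFun_le v (u - v), Γ.grad_sq u,
    Γ.grad_sq v, Γ.grad_sq (u - v), Γ.grad_nonneg v, Γ.grad_nonneg (u - v)] with
    x h1 h2 h3 h4 h5 h6 h7
  rw [← he] at h1
  refine abs_le_of_sq_le_sq' ?_ (add_nonneg h6 h7) |>.2
  rw [h3, h1, ← h4, ← h5]
  nlinarith [(abs_le.1 h2).2]

theorem norm_grad_sq (u : E.dom) : ‖Γ.grad u‖ ^ 2 = ∫ x, Γ.toFun u u x ∂μ := by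
  rw [← real_inner_self_eq_norm_sq, inner_eq_integral]
  refine integral_congr_ae ?_
  filter_upwards [Γ.grad_sq u] with x hx
  rw [← hx, sq]

theorem exists_norm_grad_le : ∃ K : ℝ, 0 ≤ K ∧ ∀ u, ‖Γ.grad u‖ ^ 2 ≤ K * E.normSq u := by
  obtain ⟨K, hK⟩ := Γ.continuous
  refine ⟨max K 0, le_max_right _ _, fun u => ?_⟩
  have hn : 0 ≤ E.normSq u := add_nonneg (E.nonneg u) (sq_nonneg _)
  rw [norm_grad_sq]
  calc ∫ x, Γ.toFun u u x ∂μ ≤ ‖∫ x, Γ.toFun u u x ∂μ‖ := le_abs_self _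
    _ ≤ ∫ x, ‖Γ.toFun u u x‖ ∂μ := norm_integral_le_integral_norm _
    _ = ‖Γ.toFun u u‖ := (L1.norm_eq_integral_norm _).symm
    _ ≤ K * (√(E.normSq u) * √(E.normSq u)) := hK u u
    _ = K * E.normSq u := by rw [Real.mul_self_sqrt hn]
    _ ≤ max K 0 * E.normSq u := mul_le_mul_of_nonneg_right (le_max_left _ _) hn

end CarreDuChamp

variable [IsProbabilityMeasure μ]

theorem integral_le_norm (u : Lp ℝ 2 μ) : ∫ x, u x ∂μ ≤ ‖u‖ := by
  rw [← inner_oneLp]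
  refine (real_inner_le_norm _ _).trans (mul_le_of_le_one_right (norm_nonneg _) ?_)
  refine norm_le_of_abs_le_one ?_
  filter_upwards [oneLp_ae (μ := μ)] with x hx using by rw [hx]; simp

namespace IsHeatSemigroup

variable {P : ℝ → Lp ℝ 2 μ →L[ℝ] Lp ℝ 2 μ} (hP : E.IsHeatSemigroup P)
  (hone : E.HasLaplacian (oneLp μ) 0) (Γ : CarreDuChamp E)
include hP hone

omit [IsProbabilityMeasure μ] hP hone in
/-- `∫ h Γ(u) dμ = ℰ(u h, u) - ½ ℰ(h, u²)`. -/
theorem form_carre {u h uh u2 : E.dom} {K K' : ℝ} (hK : ∀ᵐ x ∂μ, |(u : Lp ℝ 2 μ) x| ≤ K)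
    (hK' : ∀ᵐ x ∂μ, |(h : Lp ℝ 2 μ) x| ≤ K')
    (huh : ∀ᵐ x ∂μ, (uh : Lp ℝ 2 μ) x = (u : Lp ℝ 2 μ) x * (h : Lp ℝ 2 μ) x)
    (hu2 : ∀ᵐ x ∂μ, (u2 : Lp ℝ 2 μ) x = (u : Lp ℝ 2 μ) x * (u : Lp ℝ 2 μ) x) :
    2 * E.form u uh - E.form u2 h = 2 * ∫ x, (h : Lp ℝ 2 μ) x * Γ.toFun u u x ∂μ := by
  rw [← Γ.identity u u h u2 uh uh (memLp_top_of_abs_le hK) (memLp_top_of_abs_le hK)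
    (memLp_top_of_abs_le hK') hu2 huh huh, E.symm uh u, E.symm u2 h]
  ring

theorem exists_mul {u v : E.dom} {K K' : ℝ} (hK : ∀ᵐ x ∂μ, |(u : Lp ℝ 2 μ) x| ≤ K)
    (hK' : ∀ᵐ x ∂μ, |(v : Lp ℝ 2 μ) x| ≤ K') :
    ∃ w : E.dom, ∀ᵐ x ∂μ, (w : Lp ℝ 2 μ) x = (u : Lp ℝ 2 μ) x * (v : Lp ℝ 2 μ) x := by
  have h := classOf_mul_ae (Lp.aestronglyMeasurable (u : Lp ℝ 2 μ)) hK (v : Lp ℝ 2 μ)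
  exact ⟨⟨_, hP.mul_mem_dom hone u.2 v.2 hK hK' h⟩, h⟩

theorem exists_comp {φ : ℝ → ℝ} {L : ℝ} (hφc : Continuous φ)
    (hφ : ∀ a b, |φ a - φ b| ≤ L * |a - b|) {u : E.dom} {K : ℝ}
    (hK : ∀ᵐ x ∂μ, |(u : Lp ℝ 2 μ) x| ≤ K) :
    ∃ v : E.dom, ∀ᵐ x ∂μ, (v : Lp ℝ 2 μ) x = φ ((u : Lp ℝ 2 μ) x) := by
  obtain ⟨-, -, h⟩ := classOf_comp_ae hφc hK
  exact ⟨⟨_, hP.comp_mem_dom hone hφc hφ u.2 hK h⟩, h⟩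

/-- The carré du champ of a Lipschitz function of `u`. -/
theorem carre_contraction {φ : ℝ → ℝ} {L : ℝ} (hφc : Continuous φ)
    (hφ : ∀ a b, |φ a - φ b| ≤ L * |a - b|) {u v : E.dom} {K : ℝ}
    (hK : ∀ᵐ x ∂μ, |(u : Lp ℝ 2 μ) x| ≤ K)
    (hv : ∀ᵐ x ∂μ, (v : Lp ℝ 2 μ) x = φ ((u : Lp ℝ 2 μ) x)) :
    ∀ᵐ x ∂μ, Γ.toFun v v x ≤ L ^ 2 * Γ.toFun u u x := by
  obtain ⟨K', hK', -⟩ := classOf_comp_ae hφc hK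
  have hvK : ∀ᵐ x ∂μ, |(v : Lp ℝ 2 μ) x| ≤ K' := by
    filter_upwards [hv, hK'] with x h1 h2 using by rwa [h1]
  have hiu := L1.integrable_coeFn (Γ.toFun u u)
  have hiv := L1.integrable_coeFn (Γ.toFun v v)
  obtain ⟨u2, hu2⟩ := hP.exists_mul hone hK hK
  obtain ⟨v2, hv2⟩ := hP.exists_mul hone hvK hvK
  have := hP.ae_nonneg_of_dom (F := fun x => L ^ 2 * Γ.toFun u u x - Γ.toFun v v x)
    ((hiu.const_mul _).sub hiv) fun h hh => ?_
  · filter_upwards [this] with x hx using sub_nonneg.1 hx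
  have hhK : ∀ᵐ x ∂μ, |(h : Lp ℝ 2 μ) x| ≤ 1 := by
    filter_upwards [hh] with x hx using abs_le.2 ⟨by linarith [hx.1], hx.2⟩
  obtain ⟨uh, huh⟩ := hP.exists_mul hone hK hhK
  obtain ⟨vh, hvh⟩ := hP.exists_mul hone hvK hhK
  have hm := Lp.aestronglyMeasurable (h : Lp ℝ 2 μ)
  have e1 : ∫ x, (h : Lp ℝ 2 μ) x * (L ^ 2 * Γ.toFun u u x - Γ.toFun v v x) ∂μ =
      L ^ 2 * ∫ x, (h : Lp ℝ 2 μ) x * Γ.toFun u u x ∂μ -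
        ∫ x, (h : Lp ℝ 2 μ) x * Γ.toFun v v x ∂μ := by
    rw [← integral_const_mul, ← integral_sub ((integrable_bdd_mul hiu hm hhK).const_mul _)
      (integrable_bdd_mul hiv hm hhK)]
    refine integral_congr_ae (Eventually.of_forall fun x => ?_)
    simp only
    ring
  have lim : ∀ w wh w2 : E.dom, Tendsto (fun t : ℝ => t⁻¹ *
      (2 * inner ℝ ((w : Lp ℝ 2 μ) - P t w) (wh : Lp ℝ 2 μ) -
        inner ℝ ((w2 : Lp ℝ 2 μ) - P t w2) (h : Lp ℝ 2 μ))) (𝓝[>] 0)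
      (𝓝 (2 * E.form w wh - E.form w2 h)) := fun w wh w2 => by
    refine (((hP.tendsto_approx_form w wh).const_mul 2).sub
      (hP.tendsto_approx_form w2 h)).congr fun t => ?_
    ring
  -- The semigroup inequality, integrated against `h` and divided by `t`, in the limit `t → 0`.
  have hle : 2 * E.form v vh - E.form v2 h ≤ L ^ 2 * (2 * E.form u uh - E.form u2 h) := by
    refine le_of_tendsto_of_tendsto (lim v vh v2) ((lim u uh u2).const_mul (L ^ 2)) ?_
    filter_upwards [self_mem_nhdsWithin] with t (ht : 0 < t)
    have := hP.approx_contraction_integral hone hφc hφ hv hu2 hv2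
      (hh.mono fun x hx => hx.1) huh hvh ht.le
    have := mul_le_mul_of_nonneg_left this (inv_nonneg.2 ht.le)
    linarith
  rw [form_carre Γ hvK hhK hvh hv2, form_carre Γ hK hhK huh hu2] at hle
  rw [e1]
  linarith

theorem grad_contraction {φ : ℝ → ℝ} (hφc : Continuous φ)
    (hφ : ∀ a b, |φ a - φ b| ≤ |a - b|) {u v : E.dom} {K : ℝ}
    (hK : ∀ᵐ x ∂μ, |(u : Lp ℝ 2 μ) x| ≤ K)
    (hv : ∀ᵐ x ∂μ, (v : Lp ℝ 2 μ) x = φ ((u : Lp ℝ 2 μ) x)) :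
    ∀ᵐ x ∂μ, Γ.grad v x ≤ Γ.grad u x := by
  filter_upwards [hP.carre_contraction hone Γ (L := 1) hφc (by simpa using hφ) hK hv,
    Γ.grad_ae u, Γ.grad_ae v] with x h1 h2 h3
  rw [h2, h3]
  exact Real.sqrt_le_sqrt (by simpa using h1)

omit hP [IsProbabilityMeasure μ] in
theorem form_one (u : E.dom) : E.form u ⟨oneLp μ, hone.1⟩ = 0 := by
  rw [E.symm, hone.form_eq]
  simp

/-- The defining identity of `Γ` with `h = 1`: the constant lies in `Dom ℰ` and is `ℰ`-orthogonal to
everything, so only `2 ℰ(u, v)` survives. -/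
theorem form_eq_integral {u v : E.dom} {K K' : ℝ} (hK : ∀ᵐ x ∂μ, |(u : Lp ℝ 2 μ) x| ≤ K)
    (hK' : ∀ᵐ x ∂μ, |(v : Lp ℝ 2 μ) x| ≤ K') : E.form u v = ∫ x, Γ.toFun u v x ∂μ := by
  obtain ⟨uv, huv⟩ := hP.exists_mul hone hK hK'
  have h1 : ∀ᵐ x ∂μ, |oneLp μ x| ≤ 1 := by
    filter_upwards [oneLp_ae (μ := μ)] with x hx using by rw [hx]; simp
  have h := Γ.identity u v ⟨oneLp μ, hone.1⟩ uv u v (memLp_top_of_abs_le hK)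
    (memLp_top_of_abs_le hK') (memLp_top_of_abs_le h1) huv
    (by filter_upwards [oneLp_ae (μ := μ)] with x hx using by simp [hx])
    (by filter_upwards [oneLp_ae (μ := μ)] with x hx using by simp [hx])
  rw [E.symm ⟨oneLp μ, hone.1⟩, form_one hone, E.symm v u] at h
  have h2 : ∫ x, oneLp μ x * Γ.toFun u v x ∂μ = ∫ x, Γ.toFun u v x ∂μ := by
    refine integral_congr_ae ?_
    filter_upwards [oneLp_ae (μ := μ)] with x hx using by simp [hx]
  change _ = 2 * ∫ x, oneLp μ x * Γ.toFun u v x ∂μ at h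
  rw [h2] at h
  linarith

/-! ## Gradient estimates for the heat semigroup -/

/-- Jensen's inequality for the heat semigroup in weak form. -/
theorem integral_mul_sq_le {h k : Lp ℝ 2 μ} (hh : ∀ᵐ x ∂μ, 0 ≤ h x ∧ h x ≤ 1)
    (hk : ∀ᵐ x ∂μ, 0 ≤ k x) {s : ℝ} (hs : 0 ≤ s) :
    ∫ x, h x * P s k x ^ 2 ∂μ ≤ ∫ x, P s h x * k x ^ 2 ∂μ := by
  -- The square of `k` is merely integrable, so `P s` cannot be applied to it; the truncations `κ n`
  -- are bounded and converge to `k` in `L²`.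
  let κ : ℕ → Lp ℝ 2 μ := fun n => classOf μ fun x => min (k x) n
  have hPh := hP.mem_unitSet hh hs
  have hmk : ∀ n : ℕ, AEStronglyMeasurable (fun x => min (k x) n) μ := fun n =>
    (continuous_id.min continuous_const).comp_aestronglyMeasurable (Lp.aestronglyMeasurable k)
  have hb : ∀ n : ℕ, ∀ᵐ x ∂μ, |min (k x) n| ≤ n := fun n => by
    filter_upwards [hk] with x hx
    rw [abs_of_nonneg (le_min hx n.cast_nonneg)]
    exact min_le_right _ _
  have hκ : ∀ n, κ n =ᵐ[μ] fun x => min (k x) n := fun n => classOf_ae (hmk n) (hb n)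
  have hk2 : Integrable (fun x => k x ^ 2) μ := (Lp.memLp k).integrable_sq
  have hlim : Tendsto κ atTop (𝓝 k) := by
    rw [tendsto_iff_norm_sub_tendsto_zero]
    have h1 : Tendsto (fun n => ∫ x, (κ n - k : Lp ℝ 2 μ) x ^ 2 ∂μ) atTop (𝓝 (∫ _, 0 ∂μ)) := by
      refine tendsto_integral_of_dominated_convergence (fun x => k x ^ 2)
        (fun n => (Lp.aestronglyMeasurable _).pow 2) hk2 (fun n => ?_) ?_
      · filter_upwards [hκ n, Lp.coeFn_sub (κ n) k, hk] with x h1 h2 h3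
        rw [h2, Pi.sub_apply, h1, Real.norm_eq_abs, abs_pow]
        refine pow_le_pow_left₀ (abs_nonneg _) ?_ 2
        rw [abs_le]
        have := le_min h3 (Nat.cast_nonneg (α := ℝ) n)
        have := min_le_left (k x) (n : ℝ)
        constructor <;> linarith
      · have h2 : ∀ᵐ x ∂μ, ∀ n, (κ n - k : Lp ℝ 2 μ) x = min (k x) n - k x := by
          rw [ae_all_iff]
          intro n
          filter_upwards [hκ n, Lp.coeFn_sub (κ n) k] with x h1 h2
          rw [h2, Pi.sub_apply, h1]
        filter_upwards [h2] with x hx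
        obtain ⟨N, hN⟩ := exists_nat_ge (k x)
        refine tendsto_const_nhds.congr' ?_
        filter_upwards [eventually_ge_atTop N] with n hn
        rw [hx n, min_eq_left (hN.trans (Nat.cast_le.2 hn))]
        simp
    have h2 : ∀ n, ‖κ n - k‖ = √(∫ x, (κ n - k : Lp ℝ 2 μ) x ^ 2 ∂μ) := fun n => by
      rw [← Real.sqrt_sq (norm_nonneg (κ n - k)), ← real_inner_self_eq_norm_sq, inner_eq_integral]
      simp only [sq]
    simp only [h2]
    simpa using h1.sqrt
  have hhK : ∀ᵐ x ∂μ, |h x| ≤ 1 := by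
    filter_upwards [hh] with x hx using abs_le.2 ⟨by linarith [hx.1], hx.2⟩
  have hm := Lp.aestronglyMeasurable h
  have hPlim : Tendsto (fun n => P s (κ n)) atTop (𝓝 (P s k)) :=
    ((P s).continuous.tendsto k).comp hlim
  have e1 : ∀ w : Lp ℝ 2 μ, ∫ x, h x * w x ^ 2 ∂μ =
      inner ℝ (classOf μ fun x => h x * w x) w := fun w => by
    rw [inner_eq_integral]
    refine integral_congr_ae ?_
    filter_upwards [classOf_mul_ae hm hhK w] with x hx
    rw [hx]; ring
  rw [e1]
  refine le_of_tendsto' (Tendsto.inner (𝕜 := ℝ) (tendsto_classOf_mul hm hhK hPlim) hPlim)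
    fun n => ?_
  rw [← e1]
  obtain ⟨-, -, h2⟩ := classOf_comp_ae (φ := fun r => r ^ 2) (by fun_prop) (u := κ n) (K := n) (by
    filter_upwards [hb n, hκ n] with x h1 h2 using by rwa [h2])
  calc ∫ x, h x * P s (κ n) x ^ 2 ∂μ
      ≤ ∫ x, h x * P s (classOf μ fun x => κ n x ^ 2) x ∂μ := by
        refine integral_mono_ae ?_ (integrable_mul _ _) ?_
        · exact integrable_bdd_mul (Lp.memLp _).integrable_sq hm hhK
        · filter_upwards [hP.sq_le hone h2 hs, hh] with x h3 h4
          exact mul_le_mul_of_nonneg_left h3 h4.1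
    _ = ∫ x, P s h x * (classOf μ fun x => κ n x ^ 2) x ∂μ := by
        rw [← inner_eq_integral, ← hP.inner_symm hs, inner_eq_integral]
    _ ≤ ∫ x, P s h x * k x ^ 2 ∂μ := by
        refine integral_mono_ae (integrable_mul _ _) ?_ ?_
        · refine integrable_bdd_mul (K := 1) hk2 (Lp.aestronglyMeasurable _) ?_
          filter_upwards [hPh] with x hx using abs_le.2 ⟨by linarith [hx.1], hx.2⟩
        · filter_upwards [h2, hκ n, hPh, hk] with x h3 h4 h5 h6
          rw [h3, h4]
          exact mul_le_mul_of_nonneg_left (pow_le_pow_left₀ (le_min h6 n.cast_nonneg)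
            (min_le_left _ _) 2) h5.1

variable {Γ} {C₁ : ℝ} (hC₁ : 0 ≤ C₁) (hBE : WeakBakryEmery Γ P C₁ 0)
include hC₁ hBE

omit [IsProbabilityMeasure μ] hone hC₁ in
theorem grad_le {s : ℝ} (hs : 0 < s) (w : E.dom) :
    ∀ᵐ x ∂μ, Γ.grad (hP.toDom hs (w : Lp ℝ 2 μ)) x ≤ C₁ * P s (Γ.grad w) x := by
  have := hBE s hs.le w (hP.toDom hs (w : Lp ℝ 2 μ)) rfl
  simpa using this

omit hC₁ in
-- Squaring the Bakry–Émery bound and using Jensen's inequality moves the semigroup from the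
-- gradient onto the weight `h`. This comparison drives the interpolation argument.
theorem integral_mul_carre_le {h : Lp ℝ 2 μ} (hh : ∀ᵐ x ∂μ, 0 ≤ h x ∧ h x ≤ 1)
    {s : ℝ} (hs : 0 < s) (w w' : E.dom) (hw' : (w' : Lp ℝ 2 μ) = P s w) :
    ∫ x, h x * Γ.toFun w' w' x ∂μ ≤ C₁ ^ 2 * ∫ x, P s h x * Γ.toFun w w x ∂μ := by
  have hw' : w' = hP.toDom hs (w : Lp ℝ 2 μ) := Subtype.ext hw'
  subst hw'
  have h1 := hP.integral_mul_sq_le hone hh (Γ.grad_nonneg w) hs.le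
  have h2 : ∫ x, P s h x * Γ.grad w x ^ 2 ∂μ = ∫ x, P s h x * Γ.toFun w w x ∂μ := by
    refine integral_congr_ae ?_
    filter_upwards [Γ.grad_sq w] with x hx
    rw [hx]
  rw [h2] at h1
  refine le_trans ?_ (mul_le_mul_of_nonneg_left h1 (sq_nonneg C₁))
  rw [← integral_const_mul]
  have hhK : ∀ᵐ x ∂μ, |h x| ≤ 1 := by
    filter_upwards [hh] with x hx using abs_le.2 ⟨by linarith [hx.1], hx.2⟩
  refine integral_mono_ae
    (integrable_bdd_mul (L1.integrable_coeFn _) (Lp.aestronglyMeasurable h) hhK)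
    ((integrable_bdd_mul (Lp.memLp _).integrable_sq (Lp.aestronglyMeasurable h) hhK).const_mul _) ?_
  filter_upwards [hP.grad_le hBE hs w, Γ.grad_sq (hP.toDom hs (w : Lp ℝ 2 μ)),
    Γ.grad_nonneg (hP.toDom hs (w : Lp ℝ 2 μ)), hh] with x h3 h4 h5 h6
  rw [← h4]
  have := mul_le_mul_of_nonneg_left (pow_le_pow_left₀ h5 h3 2) h6.1
  rw [mul_pow] at this
  linarith

omit hC₁ hBE in
/-- The interpolation `s ↦ ∫ P_s h (P_{t-s} g)² dμ` has derivative `2 ∫ P_s h Γ(P_{t-s} g) dμ`. -/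
theorem hasDerivAt_interpolation {h g : Lp ℝ 2 μ} (hh : ∀ᵐ x ∂μ, 0 ≤ h x ∧ h x ≤ 1)
    (hg : ∀ᵐ x ∂μ, |g x| ≤ 1) {s t : ℝ} (hs : 0 < s) (hst : 0 < t - s) :
    HasDerivAt (fun r => inner ℝ (P r h) (classOf μ fun x => P (t - r) g x * P (t - r) g x) : ℝ → ℝ)
      (2 * ∫ x, P s h x * Γ.toFun (hP.toDom hst g) (hP.toDom hst g) x ∂μ) s := by
  have hw : ∀ r, r ≤ t → ∀ᵐ x ∂μ, |P (t - r) g x| ≤ 1 := fun r hr =>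
    hP.abs_apply_le hone hg (sub_nonneg.2 hr)
  have ha : ∀ᵐ x ∂μ, |P s h x| ≤ 1 := by
    filter_upwards [hP.mem_unitSet hh hs.le] with x hx using abs_le.2 ⟨by linarith [hx.1], hx.2⟩
  have hw2 : ∀ r, r ≤ t → classOf μ (fun x => P (t - r) g x * P (t - r) g x) =ᵐ[μ]
      fun x => P (t - r) g x * P (t - r) g x :=
    fun r hr => classOf_mul_ae (Lp.aestronglyMeasurable _) (hw r hr) _
  have hm := Lp.aestronglyMeasurable (P s h)
  obtain ⟨a', ha', -⟩ := hP.exists_laplacian hs h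
  obtain ⟨w', hw', -⟩ := hP.exists_laplacian hst g
  have hda := hP.hasDerivAt_of_laplacian hs ha'
  have hdw : HasDerivAt (fun r => P (t - r) g) (-w') s :=
    HasDerivAt.comp_const_sub t s (hP.hasDerivAt_of_laplacian hst hw')
  obtain ⟨w2, hw2d⟩ := hP.exists_mul hone (u := hP.toDom hst g) (v := hP.toDom hst g)
    (hw s (by linarith)) (hw s (by linarith))
  obtain ⟨aw, hawd⟩ := hP.exists_mul hone (u := hP.toDom hst g) (v := hP.toDom hs h)
    (hw s (by linarith)) ha
  have haw : (aw : Lp ℝ 2 μ) = classOf μ fun x => P s h x * P (t - s) g x := by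
    refine Lp.ext ?_
    filter_upwards [hawd, classOf_mul_ae hm ha (P (t - s) g)] with x h1 h2
    rw [h1, h2, mul_comm]; rfl
  have hw2e : (w2 : Lp ℝ 2 μ) = classOf μ fun x => P (t - s) g x * P (t - s) g x := by
    refine Lp.ext ?_
    filter_upwards [hw2d, hw2 s (by linarith)] with x h1 h2
    rw [h1, h2]; rfl
  have hcarre := form_carre Γ (hw s (by linarith)) ha hawd hw2d
  rw [hP.coe_toDom] at hcarre
  rw [← hcarre, hasDerivAt_iff_tendsto_slope,
    hP.form_toDom hst hw', E.symm, hP.form_toDom hs ha']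
  have hnear : ∀ᶠ r in 𝓝[≠] s, r ≤ t :=
    nhdsWithin_le_nhds (Iic_mem_nhds (by linarith))
  have hcw : Tendsto (fun r => P (t - r) g) (𝓝[≠] s) (𝓝 (P (t - s) g)) :=
    hdw.continuousAt.tendsto.mono_left nhdsWithin_le_nhds
  have hlim1 : Tendsto (fun r => classOf μ fun x => P (t - r) g x * P (t - r) g x) (𝓝[≠] s)
      (𝓝 (w2 : Lp ℝ 2 μ)) := by
    rw [hw2e]
    -- Replacing `r` by `min r t` keeps the time nonnegative for every index, so the bound `|P (t -
    -- r) g| ≤ 1` holds throughout.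
    have hq : Tendsto (fun r => P (t - min r t) g) (𝓝[≠] s) (𝓝 (P (t - s) g)) := by
      refine hcw.congr' ?_
      filter_upwards [hnear] with r hr
      rw [min_eq_left hr]
    refine (tendsto_of_abs_sub_le (K := 2) (q := classOf μ fun x => P (t - s) g x * P (t - s) g x)
      (p := fun r => classOf μ fun x => P (t - min r t) g x * P (t - min r t) g x)
      hq fun r => ?_).congr' ?_
    · filter_upwards [hw2 (min r t) (min_le_right _ _), hw2 s (by linarith),
        hw (min r t) (min_le_right _ _), hw s (by linarith)] with x h1 h2 h3 h4
      rw [h1, h2]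
      have : P (t - min r t) g x * P (t - min r t) g x - P (t - s) g x * P (t - s) g x =
        (P (t - min r t) g x + P (t - s) g x) * (P (t - min r t) g x - P (t - s) g x) := by ring
      rw [this, abs_mul]
      gcongr
      exact (abs_add_le _ _).trans (by linarith)
    · filter_upwards [hnear] with r hr
      rw [min_eq_left hr]
  have hlim2 : Tendsto (fun r => classOf μ fun x => P s h x * P (t - r) g x) (𝓝[≠] s)
      (𝓝 (aw : Lp ℝ 2 μ)) := by
    rw [haw]
    exact tendsto_classOf_mul hm ha hcw
  have hmain := ((hasDerivAt_iff_tendsto_slope.1 hda).inner (𝕜 := ℝ) hlim1).add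
    ((hlim2.add_const (aw : Lp ℝ 2 μ)).inner (𝕜 := ℝ) (hasDerivAt_iff_tendsto_slope.1 hdw))
  have hval : inner ℝ a' (w2 : Lp ℝ 2 μ) + inner ℝ ((aw : Lp ℝ 2 μ) + aw) (-w') =
      2 * -inner ℝ w' (aw : Lp ℝ 2 μ) - -inner ℝ a' (w2 : Lp ℝ 2 μ) := by
    rw [inner_neg_right, inner_add_left, real_inner_comm w']
    ring
  rw [hval] at hmain
  refine hmain.congr' ?_
  filter_upwards [hnear] with r hr
  simp only [slope, vsub_eq_sub, real_inner_smul_left, real_inner_smul_right, smul_eq_mul]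
  rw [← mul_add]
  congr 1
  -- The factorisation `w_r² - w_s² = (w_r + w_s)(w_r - w_s)`, with `P s h` absorbed into the first
  -- factor, avoids differentiating the square as an `L²` map.
  have h1 : inner ℝ ((classOf μ fun x => P s h x * P (t - r) g x) + (aw : Lp ℝ 2 μ))
      (P (t - r) g - P (t - s) g) =
      inner ℝ (P s h) ((classOf μ fun x => P (t - r) g x * P (t - r) g x) -
        classOf μ fun x => P (t - s) g x * P (t - s) g x) := by
    rw [haw, inner_eq_integral, inner_eq_integral]
    refine integral_congr_ae ?_
    filter_upwards [hw2 r hr, hw2 s (by linarith), classOf_mul_ae hm ha (P (t - r) g),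
      classOf_mul_ae hm ha (P (t - s) g), Lp.coeFn_sub (P (t - r) g) (P (t - s) g),
      Lp.coeFn_sub (classOf μ fun x => P (t - r) g x * P (t - r) g x)
        (classOf μ fun x => P (t - s) g x * P (t - s) g x),
      Lp.coeFn_add (classOf μ fun x => P s h x * P (t - r) g x)
        (classOf μ fun x => P s h x * P (t - s) g x)] with x h1 h2 h3 h4 h5 h6 h7
    rw [h5, h6, h7, Pi.sub_apply, Pi.sub_apply, Pi.add_apply, h1, h2, h3, h4]
    ring
  rw [h1, inner_sub_left, inner_sub_right]
  ring

omit hC₁ in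
/-- The reverse Poincaré inequality: `Γ(P_t g) ≤ C₁² / (2 t)` for `|g| ≤ 1`. -/
theorem carre_le_of_abs_le_one {g : Lp ℝ 2 μ} (hg : ∀ᵐ x ∂μ, |g x| ≤ 1) {t : ℝ} (ht : 0 < t) :
    ∀ᵐ x ∂μ, 2 * t * Γ.toFun (hP.toDom ht g) (hP.toDom ht g) x ≤ C₁ ^ 2 := by
  set G := Γ.toFun (hP.toDom ht g) (hP.toDom ht g) with hG
  have hGi := L1.integrable_coeFn G
  have := hP.ae_nonneg_of_dom (F := fun x => C₁ ^ 2 - 2 * t * G x)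
    ((integrable_const _).sub (hGi.const_mul _)) fun h' hh => ?_
  · filter_upwards [this] with x hx using sub_nonneg.1 hx
  set h : Lp ℝ 2 μ := h'.1 with hh'
  have hhK : ∀ᵐ x ∂μ, |h x| ≤ 1 := by
    filter_upwards [hh] with x hx using abs_le.2 ⟨by linarith [hx.1], hx.2⟩
  have hm := Lp.aestronglyMeasurable h
  have e1 : ∫ x, h x * (C₁ ^ 2 - 2 * t * G x) ∂μ =
      C₁ ^ 2 * ∫ x, h x ∂μ - 2 * t * ∫ x, h x * G x ∂μ := by
    rw [← integral_const_mul, ← integral_const_mul, ← integral_sub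
      ((integrable_coe h).const_mul _) ((integrable_bdd_mul hGi hm hhK).const_mul _)]
    refine integral_congr_ae (Eventually.of_forall fun x => ?_)
    simp only
    ring
  rw [e1, sub_nonneg]
  set I := ∫ x, h x * G x ∂μ with hI
  have hw : ∀ r, r ≤ t → ∀ᵐ x ∂μ, |P (t - r) g x| ≤ 1 := fun r hr =>
    hP.abs_apply_le hone hg (sub_nonneg.2 hr)
  let ψ : ℝ → ℝ := fun r => inner ℝ (P r h) (classOf μ fun x => P (t - r) g x * P (t - r) g x)
  have hψ : ∀ r, 0 ≤ r → r ≤ t → 0 ≤ ψ r ∧ ψ r ≤ ∫ x, h x ∂μ := by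
    intro r h0 h1
    have h2 := classOf_mul_ae (Lp.aestronglyMeasurable _) (hw r h1) (P (t - r) g)
    have h3 := hP.mem_unitSet hh h0
    simp only [ψ]
    rw [inner_eq_integral]
    constructor
    · refine integral_nonneg_of_ae ?_
      filter_upwards [h2, h3] with x h4 h5
      rw [h4]
      exact mul_nonneg h5.1 (mul_self_nonneg _)
    · rw [← hP.integral_apply hone h0]
      refine integral_mono_ae (integrable_mul _ _) (integrable_coe _) ?_
      filter_upwards [h2, h3, hw r h1] with x h4 h5 h6
      rw [h4]
      refine mul_le_of_le_one_right h5.1 ?_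
      rw [← abs_mul_abs_self]
      exact mul_le_one₀ h6 (abs_nonneg _) h6
  -- The derivative of `ψ` is `2 ∫ P_r h Γ(P_{t-r} g) dμ`, and `integral_mul_carre_le` bounds `2 I`
  -- by `C₁²` times it, because `P_r P_{t-r} g = P_t g`.
  have hder : ∀ r (h0 : 0 < r) (h1 : 0 < t - r), ∃ d, HasDerivAt ψ d r ∧ 2 * I ≤ C₁ ^ 2 * d := by
    intro r h0 h1
    refine ⟨_, hP.hasDerivAt_interpolation hone (Γ := Γ) hh hg h0 h1, ?_⟩
    have := hP.integral_mul_carre_le hone hBE hh h0 (hP.toDom h1 g) (hP.toDom ht g) (by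
      rw [hP.coe_toDom, hP.coe_toDom, ← hP.add _ _ h0.le h1.le]
      congr 2; ring)
    linarith
  -- Integration over `[ε, t - ε]`, where `ψ` is differentiable, combined with `0 ≤ ψ ≤ ∫ h dμ` at
  -- the ends.
  have key : ∀ ε, 0 < ε → ε < t / 2 → 2 * (t - 2 * ε) * I ≤ C₁ ^ 2 * ∫ x, h x ∂μ := by
    intro ε h0 h1
    have hle : ε ≤ t - ε := by linarith
    have hd : ∀ r ∈ Set.Icc ε (t - ε), ∃ d, HasDerivAt ψ d r ∧ 2 * I ≤ C₁ ^ 2 * d := fun r hr =>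
      hder r (h0.trans_le hr.1) (by linarith [hr.2])
    have hd' : ∀ r ∈ Set.Icc ε (t - ε), ∃ d, HasDerivAt (fun r => C₁ ^ 2 * ψ r - r * (2 * I)) d r ∧
        0 ≤ d := fun r hr => by
      obtain ⟨d, hd1, hd2⟩ := hd r hr
      refine ⟨C₁ ^ 2 * d - 1 * (2 * I), ?_, by linarith⟩
      exact (hd1.const_mul _).sub ((hasDerivAt_id r).mul_const _)
    have hmono := monotoneOn_of_deriv_nonneg (convex_Icc ε (t - ε))
      (f := fun r => C₁ ^ 2 * ψ r - r * (2 * I))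
      (fun r hr => (hd' r hr).choose_spec.1.continuousAt.continuousWithinAt)
      (fun r hr =>
        (hd' r (interior_subset hr)).choose_spec.1.differentiableAt.differentiableWithinAt)
      (fun r hr => by
        rw [(hd' r (interior_subset hr)).choose_spec.1.deriv]
        exact (hd' r (interior_subset hr)).choose_spec.2)
      (Set.left_mem_Icc.2 hle) (Set.right_mem_Icc.2 hle) hle
    simp only at hmono
    have h3 := mul_nonneg (sq_nonneg C₁) (hψ ε h0.le (by linarith)).1
    have h4 := mul_le_mul_of_nonneg_left (hψ (t - ε) (by linarith) (by linarith)).2 (sq_nonneg C₁)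
    linarith
  refine le_of_tendsto (x := 𝓝[>] (0 : ℝ)) (f := fun ε => 2 * (t - 2 * ε) * I) ?_ ?_
  · have : Continuous fun ε : ℝ => 2 * (t - 2 * ε) * I := by fun_prop
    simpa using (this.tendsto 0).mono_left nhdsWithin_le_nhds
  · filter_upwards [Ioo_mem_nhdsGT (half_pos ht)] with ε hε using key ε hε.1 hε.2

/-- The pseudo-Poincaré inequality `‖v - P_t v‖₁ ≤ C₁ √(2 t) ∫ √Γ(v) dμ`. -/
theorem integral_abs_sub_le {v : E.dom} {K : ℝ} (hK : ∀ᵐ x ∂μ, |(v : Lp ℝ 2 μ) x| ≤ K)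
    {t : ℝ} (ht : 0 < t) :
    ∫ x, |((v : Lp ℝ 2 μ) - P t v : Lp ℝ 2 μ) x| ∂μ ≤ C₁ * √(2 * t) * ∫ x, Γ.grad v x ∂μ := by
  set f : Lp ℝ 2 μ := (v : Lp ℝ 2 μ) - P t v with hf
  set I := ∫ x, Γ.grad v x ∂μ with hI
  -- Duality: with `σ` the sign of `f`, the `L¹` norm of `v - P_t v` becomes the total decrease of
  -- `s ↦ ⟨P_s σ, v⟩` on `[0, t]`.
  let σ : X → ℝ := fun x => if 0 ≤ f x then 1 else -1
  have hσm : Measurable σ :=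
    Measurable.ite (measurableSet_le measurable_const (Lp.stronglyMeasurable f).measurable)
      measurable_const measurable_const
  have hσ1 : ∀ x, |σ x| ≤ 1 := fun x => by
    simp only [σ]; split_ifs <;> simp
  have hg := classOf_ae hσm.aestronglyMeasurable (μ := μ) (Eventually.of_forall hσ1)
  set g := classOf μ σ with hgdef
  have hg1 : ∀ᵐ x ∂μ, |g x| ≤ 1 := by
    filter_upwards [hg] with x hx using by rw [hx]; exact hσ1 x
  have e1 : ∫ x, |f x| ∂μ = inner ℝ g (v : Lp ℝ 2 μ) - inner ℝ (P t g) (v : Lp ℝ 2 μ) := by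
    rw [hP.inner_symm ht.le, ← inner_sub_right, inner_eq_integral]
    refine integral_congr_ae ?_
    filter_upwards [hg] with x hx
    rw [hx]
    simp only [σ]
    split_ifs with h
    · rw [abs_of_nonneg h, one_mul]
    · rw [abs_of_neg (not_le.1 h), neg_one_mul]
  -- Cauchy–Schwarz for `Γ` together with the reverse Poincaré bound on `P_s g`.
  have hE : ∀ s (hs : 0 < s), √(2 * s) * E.form (hP.toDom hs g) v ≤ C₁ * I := by
    intro s hs
    rw [hP.form_eq_integral hone Γ (hP.abs_apply_le hone hg1 hs.le) hK, ← integral_const_mul,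
      hI, ← integral_const_mul]
    refine integral_mono_ae ((L1.integrable_coeFn _).const_mul _)
      ((integrable_coe _).const_mul _) ?_
    filter_upwards [hP.carre_le_of_abs_le_one hone hBE hg1 hs,
      Γ.abs_toFun_le (hP.toDom hs g) v, Γ.grad_ae (hP.toDom hs g), Γ.grad_nonneg v]
      with x h1 h2 h3 h4
    have h5 : √(2 * s) * Γ.grad (hP.toDom hs g) x ≤ C₁ := by
      rw [h3, ← Real.sqrt_mul (by positivity)]
      exact Real.sqrt_le_iff.2 ⟨hC₁, h1⟩
    calc √(2 * s) * Γ.toFun (hP.toDom hs g) v x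
        ≤ √(2 * s) * (Γ.grad (hP.toDom hs g) x * Γ.grad v x) := by
          gcongr
          exact (le_abs_self _).trans h2
      _ = √(2 * s) * Γ.grad (hP.toDom hs g) x * Γ.grad v x := by ring
      _ ≤ C₁ * Γ.grad v x := by gcongr
  -- The decrease rate is at most `C₁ I / √(2s)`, which is the derivative of `√(2s) C₁ I`. The
  -- singularity at 0 is harmless because `√(2s)` is continuous there.
  have hder : ∀ s, 0 < s → ∃ d, HasDerivAt (fun s => inner ℝ (P s g) (v : Lp ℝ 2 μ) +
      √(2 * s) * (C₁ * I)) d s ∧ 0 ≤ d := by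
    intro s hs
    have h1 : HasDerivAt (fun s : ℝ => √(2 * s)) (2 * 1 / (2 * √(2 * s))) s :=
      ((hasDerivAt_id s).const_mul 2).sqrt (by simp; linarith)
    refine ⟨_, (hP.hasDerivAt_inner hs g v).add (h1.mul_const (C₁ * I)), ?_⟩
    have h2 : 0 < √(2 * s) := Real.sqrt_pos.2 (by linarith)
    have h3 := hE s hs
    have h4 : 2 * 1 / (2 * √(2 * s)) * (C₁ * I) = (C₁ * I) / √(2 * s) := by field_simp
    rw [h4]
    have h5 : E.form (hP.toDom hs g) v ≤ C₁ * I / √(2 * s) := by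
      rw [le_div_iff₀ h2]; linarith
    linarith
  have hmono := monotoneOn_of_deriv_nonneg (convex_Icc 0 t)
    (f := fun s => inner ℝ (P s g) (v : Lp ℝ 2 μ) + √(2 * s) * (C₁ * I))
    (((hP.continuousOn_inner _ _).mono fun s hs => hs.1).add (by fun_prop))
    (fun s hs => by
      rw [interior_Icc] at hs
      exact (hder s hs.1).choose_spec.1.differentiableAt.differentiableWithinAt)
    (fun s hs => by
      rw [interior_Icc] at hs
      rw [(hder s hs.1).choose_spec.1.deriv]
      exact (hder s hs.1).choose_spec.2)
    (Set.left_mem_Icc.2 ht.le) (Set.right_mem_Icc.2 ht.le) ht.le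
  simp only [hP.zero, mul_zero, Real.sqrt_zero, zero_mul, add_zero] at hmono
  rw [e1]
  linarith

end IsHeatSemigroup

end DirichletForm

namespace DirichletForm

variable {X : Type*} [TopologicalSpace X] [CompactSpace X] [MeasurableSpace X] [BorelSpace X]
  {μ : Measure X} [IsProbabilityMeasure μ] {E : DirichletForm μ}

/-! ## Consequences of regularity and locality -/

omit [BorelSpace X] [IsProbabilityMeasure μ] in
theorem isCompact_aeSupport (u : Lp ℝ 2 μ) : IsCompact (aeSupport u) := by
  refine IsClosed.isCompact (isOpen_compl_iff.1 (isOpen_iff_mem_nhds.2 fun x hx => ?_))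
  simp only [aeSupport, Set.mem_compl_iff, Set.mem_ofPred_eq, not_forall, not_not] at hx
  obtain ⟨U, hU, h⟩ := hx
  obtain ⟨V, hVU, hV, hxV⟩ := mem_nhds_iff.1 hU
  refine mem_nhds_iff.2 ⟨V, fun y hy => ?_, hV, hxV⟩
  simp only [aeSupport, Set.mem_compl_iff, Set.mem_ofPred_eq, not_forall, not_not]
  exact ⟨V, hV.mem_nhds hy, h.mono fun z hz hzV => hz (hVU hzV)⟩

omit [BorelSpace X] in
-- By compactness and regularity the domain contains a function within `1/2` of 1; its double is at
-- least 1, so the unit contraction turns it into the constant 1. Strict locality with the whole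
-- space as neighbourhood gives `ℰ(·, 1) = 0`.
theorem hasLaplacian_one (hreg : E.IsRegular) (hloc : E.IsStrictlyLocal) :
    E.HasLaplacian (oneLp μ) 0 := by
  obtain ⟨g, -, -, ⟨v, hv⟩, hg⟩ := hreg.dense_unif (fun _ => 1) continuous_const
    (HasCompactSupport.of_compactSpace _) (1 / 2) (by norm_num)
  obtain ⟨w, hw, -⟩ := E.markov ((2 : ℝ) • v)
  have h1 : (w : Lp ℝ 2 μ) = oneLp μ := by
    refine Lp.ext ?_
    filter_upwards [hv, hw, Lp.coeFn_smul (2 : ℝ) (v : Lp ℝ 2 μ), oneLp_ae (μ := μ)]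
      with x h1 h2 h3 h4
    rw [h2, h4]
    change min (max (((2 : ℝ) • (v : Lp ℝ 2 μ) : Lp ℝ 2 μ) x) 0) 1 = 1
    rw [h3, Pi.smul_apply, h1, smul_eq_mul]
    have := abs_lt.1 (hg x)
    rw [max_eq_left (by linarith), min_eq_right (by linarith)]
  refine ⟨h1 ▸ w.2, fun φ => ?_⟩
  rw [E.symm, inner_zero_left, neg_zero]
  refine hloc _ _ (isCompact_aeSupport _) (isCompact_aeSupport _)
    ⟨Set.univ, isOpen_univ, Set.subset_univ _, 1, ?_⟩
  filter_upwards [oneLp_ae (μ := μ)] with x hx _ using hx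

omit [BorelSpace X] [IsProbabilityMeasure μ] in
-- The gap `b < a` puts the support of `h` inside the open set `{g < a}`, on which `v` is constant.
theorem form_eq_zero_of_local (hloc : E.IsStrictlyLocal) {g : X → ℝ} (hg : Continuous g)
    {a b c : ℝ} (hba : b < a) {h v : E.dom}
    (hh : ∀ᵐ x ∂μ, b < g x → (h : Lp ℝ 2 μ) x = 0)
    (hv : ∀ᵐ x ∂μ, g x < a → (v : Lp ℝ 2 μ) x = c) : E.form h v = 0 := by
  refine hloc _ _ (isCompact_aeSupport _) (isCompact_aeSupport _)
    ⟨{x | g x < a}, isOpen_lt hg continuous_const, fun x hx => ?_, c, hv⟩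
  by_contra hcon
  exact hx {x | b < g x} ((isOpen_lt continuous_const hg).mem_nhds
    (hba.trans_le (not_lt.1 hcon))) hh

namespace IsHeatSemigroup

variable {P : ℝ → Lp ℝ 2 μ →L[ℝ] Lp ℝ 2 μ} (hP : E.IsHeatSemigroup P)
  (hone : E.HasLaplacian (oneLp μ) 0) (hloc : E.IsStrictlyLocal) (Γ : CarreDuChamp E)
include hP hone hloc

omit [BorelSpace X] in
/-- `Γ(v)` vanishes on `{g < a}` if `v` is constant there, `g` continuous in `Dom ℰ`. -/
theorem carre_eq_zero {g : X → ℝ} (hg : Continuous g) {u v : E.dom}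
    (hu : ∀ᵐ x ∂μ, (u : Lp ℝ 2 μ) x = g x) {K : ℝ} (hK : ∀ᵐ x ∂μ, |(v : Lp ℝ 2 μ) x| ≤ K)
    {a c : ℝ} (hv : ∀ᵐ x ∂μ, g x < a → (v : Lp ℝ 2 μ) x = c) :
    ∀ᵐ x ∂μ, g x < a → Γ.toFun v v x = 0 := by
  obtain ⟨C, hC⟩ := (isCompact_univ (X := X)).exists_bound_of_continuousOn hg.continuousOn
  have huC : ∀ᵐ x ∂μ, |(u : Lp ℝ 2 μ) x| ≤ C := by
    filter_upwards [hu] with x hx using by rw [hx]; exact hC x trivial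
  have key : ∀ n : ℕ, ∀ᵐ x ∂μ, g x < a - 1 / ((n : ℝ) + 1) → Γ.toFun v v x = 0 := by
    intro n
    have hδ : (0 : ℝ) < 1 / ((n : ℝ) + 1) := Nat.one_div_pos_of_nat
    -- The test function `(b - g)⁺` is positive exactly on `{g < b}` and leaves the gap required by
    -- locality. It yields `Γ(v) = 0` on `{g < b}`, and `b` increases to `a` with `n`.
    set b := a - 1 / ((n : ℝ) + 1) with hb
    have hφc : Continuous fun r : ℝ => max (b - r) 0 := by fun_prop
    obtain ⟨h, hh⟩ := hP.exists_comp hone (φ := fun r => max (b - r) 0) (L := 1) hφc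
      (fun x y => by
        refine (abs_max_sub_max_le_max _ _ _ _).trans ?_
        rw [sub_self, abs_zero, one_mul, max_eq_left (abs_nonneg _), abs_sub_comm]
        exact le_of_eq (by congr 1; ring)) huC
    obtain ⟨C', hC', -⟩ := classOf_comp_ae hφc huC
    have hhC : ∀ᵐ x ∂μ, |(h : Lp ℝ 2 μ) x| ≤ C' := by
      filter_upwards [hh, hC'] with x h1 h2 using by rwa [h1]
    have hhg : ∀ᵐ x ∂μ, (h : Lp ℝ 2 μ) x = max (b - g x) 0 := by
      filter_upwards [hh, hu] with x h1 h2 using by rw [h1, h2]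
    obtain ⟨vh, hvh⟩ := hP.exists_mul hone hK hhC
    obtain ⟨v2, hv2⟩ := hP.exists_mul hone hK hK
    have h0 : ∀ᵐ x ∂μ, b < g x → (h : Lp ℝ 2 μ) x = 0 := by
      filter_upwards [hhg] with x h1 h2
      rw [h1, max_eq_right (by linarith)]
    have e1 := form_carre Γ hK hhC hvh hv2
    rw [E.symm v vh, E.symm v2 h,
      form_eq_zero_of_local hloc hg (by linarith : b < a) (h := vh) (v := v) (by
        filter_upwards [h0, hvh] with x h1 h2 h3
        rw [h2, h1 h3, mul_zero]) hv,
      form_eq_zero_of_local hloc hg (by linarith : b < a) (h := h) (v := v2) (c := c * c) h0 (by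
        filter_upwards [hv, hv2] with x h1 h2 h3
        rw [h2, h1 h3])] at e1
    have e2 : ∫ x, (h : Lp ℝ 2 μ) x * Γ.toFun v v x ∂μ = 0 := by linarith
    rw [integral_eq_zero_iff_of_nonneg_ae] at e2
    · filter_upwards [e2, hhg] with x h1 h2 h3
      rw [Pi.zero_apply, h2, max_eq_left (by linarith)] at h1
      exact (mul_eq_zero.1 h1).resolve_left (by linarith)
    · filter_upwards [hhg, Γ.nonneg v] with x h1 h2
      rw [Pi.zero_apply, h1]
      exact mul_nonneg (le_max_right _ _) h2
    · exact integrable_bdd_mul (L1.integrable_coeFn _) (Lp.aestronglyMeasurable _) hhC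
  filter_upwards [ae_all_iff.2 key] with x hx hxa
  obtain ⟨n, hn⟩ := exists_nat_one_div_lt (sub_pos.2 hxa)
  exact hx n (by linarith)

omit [BorelSpace X] in
theorem carre_eq_zero' {g : X → ℝ} (hg : Continuous g) {u v : E.dom}
    (hu : ∀ᵐ x ∂μ, (u : Lp ℝ 2 μ) x = g x) {K : ℝ} (hK : ∀ᵐ x ∂μ, |(v : Lp ℝ 2 μ) x| ≤ K)
    {a c : ℝ} (hv : ∀ᵐ x ∂μ, a < g x → (v : Lp ℝ 2 μ) x = c) :
    ∀ᵐ x ∂μ, a < g x → Γ.toFun v v x = 0 := by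
  have := hP.carre_eq_zero hone hloc Γ (g := fun x => -g x) hg.neg (u := -u) (v := v) (by
    filter_upwards [hu, Lp.coeFn_neg (u : Lp ℝ 2 μ)] with x h1 h2
    rw [Submodule.coe_neg, h2, Pi.neg_apply, h1]) hK (a := -a) (c := c) (by
    filter_upwards [hv] with x h1 h2 using h1 (by linarith))
  filter_upwards [this] with x h1 h2 using h1 (by linarith)

omit [BorelSpace X] in
/-- The truncation of `u` to the band `{b ≤ u ≤ 2 b}`. -/
theorem exists_band {g : X → ℝ} (hg : Continuous g) {u : E.dom}
    (hu : ∀ᵐ x ∂μ, (u : Lp ℝ 2 μ) x = g x) {b : ℝ} (hb : 0 < b) :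
    ∃ v : E.dom, (∀ᵐ x ∂μ, (v : Lp ℝ 2 μ) x = min (max (g x - b) 0) b) ∧
      ∀ᵐ x ∂μ, Γ.grad v x ≤ if b ≤ g x ∧ g x ≤ 2 * b then Γ.grad u x else 0 := by
  obtain ⟨C, hC⟩ := (isCompact_univ (X := X)).exists_bound_of_continuousOn hg.continuousOn
  have huC : ∀ᵐ x ∂μ, |(u : Lp ℝ 2 μ) x| ≤ C := by
    filter_upwards [hu] with x hx using by rw [hx]; exact hC x trivial
  have hφc : Continuous fun r : ℝ => min (max (r - b) 0) b := by fun_prop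
  have hφ : ∀ x y : ℝ, |min (max (x - b) 0) b - min (max (y - b) 0) b| ≤ |x - y| := fun x y => by
    refine (abs_min_sub_min_le_max _ _ _ _).trans ?_
    rw [sub_self, abs_zero, max_eq_left (abs_nonneg _)]
    refine (abs_max_sub_max_le_max _ _ _ _).trans ?_
    rw [sub_self, abs_zero, max_eq_left (abs_nonneg _)]
    exact le_of_eq (by congr 1; ring)
  obtain ⟨v, hv⟩ := hP.exists_comp hone (L := 1) hφc (by simpa using hφ) huC
  have hvg : ∀ᵐ x ∂μ, (v : Lp ℝ 2 μ) x = min (max (g x - b) 0) b := by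
    filter_upwards [hv, hu] with x h1 h2 using by rw [h1, h2]
  have hvb : ∀ᵐ x ∂μ, |(v : Lp ℝ 2 μ) x| ≤ b := by
    filter_upwards [hvg] with x hx
    rw [hx, abs_of_nonneg (le_min (le_max_right _ _) hb.le)]
    exact min_le_right _ _
  refine ⟨v, hvg, ?_⟩
  -- The truncation is constant below `b` and above `2b`, so locality kills `Γ(v)` there; inside the
  -- band the contraction property suffices.
  have h1 := hP.carre_eq_zero hone hloc Γ hg hu hvb (a := b) (c := 0) (by
    filter_upwards [hvg] with x h1 h2
    rw [h1, max_eq_right (by linarith), min_eq_left hb.le])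
  have h2 := hP.carre_eq_zero' hone hloc Γ hg hu hvb (a := 2 * b) (c := b) (by
    filter_upwards [hvg] with x h1 h2
    rw [h1, max_eq_left (by linarith), min_eq_right (by linarith)])
  filter_upwards [h1, h2, hP.grad_contraction hone Γ hφc hφ huC hv, Γ.grad_ae v]
    with x h1 h2 h3 h4
  split_ifs with h
  · exact h3
  · rw [not_and_or, not_le, not_le] at h
    rw [h4]
    rcases h with h | h
    · rw [h1 h]; simp
    · rw [h2 h]; simp

end IsHeatSemigroup

end DirichletForm

/-! ## Dyadic decompositions -/

/-- Consecutive closed bands share an endpoint, so a point lies in at most two of them. -/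
theorem sum_ite_dyadic_le {a r c : ℝ} (ha : 0 < a) (hc : 0 ≤ c) (N : ℕ) :
    ∑ k ∈ Finset.range N, (if a * 2 ^ k ≤ r ∧ r ≤ 2 * (a * 2 ^ k) then c else 0) ≤ 2 * c := by
  rw [← Finset.sum_filter, Finset.sum_const, nsmul_eq_mul]
  refine mul_le_mul_of_nonneg_right ?_ hc
  set S := (Finset.range N).filter fun k => a * 2 ^ k ≤ r ∧ r ≤ 2 * (a * 2 ^ k) with hS
  rcases S.eq_empty_or_nonempty with h | h
  · rw [h]; simp
  · have hmin := Finset.min'_mem S h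
    set k₀ := S.min' h with hk₀
    have hsub : S ⊆ {k₀, k₀ + 1} := by
      intro k hk
      have h1 : k₀ ≤ k := Finset.min'_le S k hk
      have h2 : a * 2 ^ k ≤ 2 * (a * 2 ^ k₀) :=
        (Finset.mem_filter.1 hk).2.1.trans (Finset.mem_filter.1 hmin).2.2
      have h3 : (2 : ℝ) ^ k ≤ 2 ^ (k₀ + 1) := by
        rw [pow_succ]
        exact le_of_mul_le_mul_left (by linarith) ha
      have h4 : k ≤ k₀ + 1 := (pow_le_pow_iff_right₀ (by norm_num)).1 h3
      simp only [Finset.mem_insert, Finset.mem_singleton]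
      omega
    have := (Finset.card_le_card hsub).trans Finset.card_le_two
    exact_mod_cast this

/-- Up to `2a` the linear term suffices; above it `r` lies in `[2a 2^k, 4a 2^k)` for some `k`, and
the upper bound on `r` forces `k < N`. -/
theorem rpow_le_dyadic {a r p : ℝ} (ha : 0 < a) (hr : 0 ≤ r) (hp : 1 < p) {N : ℕ}
    (hN : r < a * 2 ^ (N + 1)) :
    r ^ p ≤ (2 * a) ^ (p - 1) * r +
      ∑ k ∈ Finset.range N, (4 * (a * 2 ^ k)) ^ p * (if 2 * (a * 2 ^ k) ≤ r then 1 else 0) := by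
  have hnn : ∀ k : ℕ, 0 ≤ (4 * (a * 2 ^ k)) ^ p * (if 2 * (a * 2 ^ k) ≤ r then (1 : ℝ) else 0) :=
    fun k => mul_nonneg (by positivity) (by split_ifs <;> simp)
  rcases le_or_gt r (2 * a) with h | h
  · have h1 : r ^ p ≤ (2 * a) ^ (p - 1) * r := by
      rcases hr.eq_or_lt with rfl | hr
      · rw [Real.zero_rpow (by linarith)]; simp
      · have : r ^ p = r ^ (p - 1) * r := by
          rw [← Real.rpow_add_one hr.ne']; congr 1; ring
        rw [this]
        gcongr
    linarith [Finset.sum_nonneg fun k (_ : k ∈ Finset.range N) => hnn k]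
  · have hex : ∃ k : ℕ, r < 2 * (a * 2 ^ (k + 1)) := by
      refine ⟨N, hN.trans_le ?_⟩
      linarith [show 0 < a * 2 ^ (N + 1) by positivity]
    classical
    set k := Nat.find hex with hk
    have h1 : r < 2 * (a * 2 ^ (k + 1)) := Nat.find_spec hex
    have h2 : 2 * (a * 2 ^ k) ≤ r := by
      rcases Nat.eq_zero_or_pos k with h0 | h0
      · rw [h0]; simpa using h.le
      · have := Nat.find_min hex (m := k - 1) (by omega)
        rw [Nat.sub_add_cancel h0] at this
        exact not_lt.1 this
    have hkN : k < N := by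
      have h3 : a * 2 ^ (k + 1) < a * 2 ^ (N + 1) := by
        rw [pow_succ]; linarith
      have h4 := (pow_lt_pow_iff_right₀ (by norm_num : (1 : ℝ) < 2)).1
        (lt_of_mul_lt_mul_left h3 ha.le)
      omega
    have h5 := Finset.single_le_sum (f := fun k : ℕ =>
      (4 * (a * 2 ^ k)) ^ p * (if 2 * (a * 2 ^ k) ≤ r then (1 : ℝ) else 0))
      (fun k _ => hnn k) (Finset.mem_range.2 hkN)
    simp only [if_pos h2, mul_one] at h5
    have h6 : r ^ p ≤ (4 * (a * 2 ^ k)) ^ p := by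
      refine Real.rpow_le_rpow hr ?_ (by linarith)
      rw [pow_succ] at h1; linarith
    have h7 : 0 ≤ (2 * a) ^ (p - 1) * r := by positivity
    linarith

/-- A function exceeding the level `b` is controlled by its `p`-th power. -/
theorem band_le_rpow {b r p : ℝ} (hb : 0 < b) (hr : 0 ≤ r) (hp : 1 < p) :
    min (max (r - b) 0) b ≤ b ^ (1 - p) * r ^ p := by
  rcases le_or_gt r b with h | h
  · rw [max_eq_right (by linarith), min_eq_left hb.le]
    positivity
  · have hr0 : 0 < r := hb.trans h
    refine (min_le_left _ _).trans ?_
    rw [max_eq_left (by linarith)]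
    have h1 : b ^ (p - 1) ≤ r ^ (p - 1) := Real.rpow_le_rpow hb.le h.le (by linarith)
    have h2 : r ^ p = r ^ (p - 1) * r := by
      rw [← Real.rpow_add_one hr0.ne']; congr 1; ring
    have h3 : b ^ (1 - p) * b ^ (p - 1) = 1 := by
      rw [← Real.rpow_add hb]; simp
    calc r - b ≤ b ^ (1 - p) * b ^ (p - 1) * r := by rw [h3]; linarith
      _ ≤ b ^ (1 - p) * r ^ p := by
        rw [h2, mul_assoc]
        gcongr

/-! ### Ultracontractivity and the Sobolev inequality for continuous functions. -/

namespace DirichletForm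

/-- The `L¹`-`L^∞` bound `P_t v ≤ M t^{-Q/2} ∫ v dμ` for `v ≥ 0`, `0 < t ≤ 1`. -/
def Ultracontractive {X : Type*} [MeasurableSpace X] {μ : Measure X}
    (P : ℝ → Lp ℝ 2 μ →L[ℝ] Lp ℝ 2 μ) (M Q : ℝ) : Prop :=
  ∀ t, 0 < t → t ≤ 1 → ∀ v : Lp ℝ 2 μ, (∀ᵐ x ∂μ, 0 ≤ v x) →
    ∀ᵐ x ∂μ, P t v x ≤ M * t ^ (-(Q / 2)) * ∫ y, v y ∂μ

theorem exists_ultracontractive {X : Type*} [MeasurableSpace X] {μ : Measure X}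
    [IsProbabilityMeasure μ] {P : ℝ → Lp ℝ 2 μ →L[ℝ] Lp ℝ 2 μ} {p : ℝ → X → X → ℝ}
    (hp : IsHeatKernel P p) {Q : ℝ}
    (hbound : ∃ M : ℝ, ∀ t : ℝ, 0 < t → t ≤ 1 → ∀ x y : X, t ^ (Q / 2) * p t x y ≤ M) :
    ∃ M : ℝ, 1 ≤ M ∧ Ultracontractive P M Q := by
  obtain ⟨M, hM⟩ := hbound
  -- A constant at least 1 ensures later that `2 M ≥ 1`, hence `B^(1/p) ≤ a`.
  refine ⟨max M 1, le_max_right _ _, fun t ht ht1 v hv => ?_⟩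
  filter_upwards [hp.integrable t ht v, hp.eq_integral t ht v] with x h1 h2
  rw [h2, ← integral_const_mul]
  refine integral_mono_ae h1 ((integrable_coe v).const_mul _) ?_
  filter_upwards [hv] with y hy
  refine mul_le_mul_of_nonneg_right ?_ hy
  rw [Real.rpow_neg ht.le, ← div_eq_mul_inv, le_div_iff₀ (by positivity), mul_comm]
  exact (hM t ht ht1 x y).trans (le_max_left _ _)

theorem integrable_ite {X : Type*} [MeasurableSpace X] {μ : Measure X} {q : X → Prop}
    [DecidablePred q] (hq : MeasurableSet {x | q x}) {F : X → ℝ} (hF : Integrable F μ) :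
    Integrable (fun x => if q x then F x else 0) μ := by
  refine (hF.indicator hq).congr (Eventually.of_forall fun x => ?_)
  by_cases h : q x <;> simp [h]

namespace IsHeatSemigroup

variable {X : Type*} [TopologicalSpace X] [CompactSpace X] [MeasurableSpace X] [BorelSpace X]
  {μ : Measure X} [IsProbabilityMeasure μ] {E : DirichletForm μ}
  {P : ℝ → Lp ℝ 2 μ →L[ℝ] Lp ℝ 2 μ} (hP : E.IsHeatSemigroup P)
  (hone : E.HasLaplacian (oneLp μ) 0) (hloc : E.IsStrictlyLocal) {Γ : CarreDuChamp E}
  {C₁ : ℝ} (hC₁ : 0 ≤ C₁) (hBE : WeakBakryEmery Γ P C₁ 0)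
  {M Q : ℝ} (hM : 1 ≤ M) (hQ : 1 < Q) (hU : Ultracontractive P M Q)
include hP hone hloc hC₁ hBE hM hQ hU

/-- The level set estimate behind the Sobolev inequality. -/
theorem level_set_le {p : ℝ} (hp : p = Q / (Q - 1)) {g : X → ℝ} (hg : Continuous g)
    (hg0 : ∀ x, 0 ≤ g x) {u : E.dom} (hu : ∀ᵐ x ∂μ, (u : Lp ℝ 2 μ) x = g x)
    {B a : ℝ} (hB : B = ∫ x, g x ^ p ∂μ) (ha : 0 < a) (haB : a ^ p = 2 * M * B) (k : ℕ) :
    (a * 2 ^ k) ^ p * ∫ x, (if 2 * (a * 2 ^ k) ≤ g x then (1 : ℝ) else 0) ∂μ ≤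
      2 * √2 * C₁ * a ^ (p - 1) *
        ∫ x, (if a * 2 ^ k ≤ g x ∧ g x ≤ 2 * (a * 2 ^ k) then Γ.grad u x else 0) ∂μ := by
  have hQ1 : 0 < Q - 1 := by linarith
  have hp1 : 1 < p := by rw [hp, lt_div_iff₀ hQ1]; linarith
  have hpQ : (p - 1) * Q = p := by rw [hp]; field_simp; ring
  set b := a * 2 ^ k with hbdef
  have hb : 0 < b := by positivity
  obtain ⟨v, hv, hvΓ⟩ := hP.exists_band hone hloc Γ hg hu hb
  have hv0 : ∀ᵐ x ∂μ, 0 ≤ (v : Lp ℝ 2 μ) x := by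
    filter_upwards [hv] with x hx using by rw [hx]; exact le_min (le_max_right _ _) hb.le
  have hvb : ∀ᵐ x ∂μ, |(v : Lp ℝ 2 μ) x| ≤ b := by
    filter_upwards [hv, hv0] with x hx h0
    rw [abs_of_nonneg h0, hx]
    exact min_le_right _ _
  -- The diffusion time is `δ²`. The relation `(p - 1) Q = p` makes `δ^(-Q) = 2^(kp)`, and `k ≥ 0`
  -- makes the time at most 1.
  set δ : ℝ := (2 : ℝ) ^ (-((k : ℝ) * (p - 1))) with hδ
  have hδ0 : 0 < δ := by positivity
  have hδ1 : δ ≤ 1 := Real.rpow_le_one_of_one_le_of_nonpos (by norm_num)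
    (neg_nonpos.2 (mul_nonneg k.cast_nonneg (by linarith)))
  have htime : (δ ^ 2) ^ (-(Q / 2)) = ((2 : ℝ) ^ k) ^ p := by
    rw [hδ, ← Real.rpow_natCast, ← Real.rpow_natCast, ← Real.rpow_mul (by positivity),
      ← Real.rpow_mul (by positivity), ← Real.rpow_mul (by positivity)]
    congr 1
    push_cast
    linear_combination (k : ℝ) * hpQ
  have hint : ∫ x, (v : Lp ℝ 2 μ) x ∂μ ≤ b ^ (1 - p) * B := by
    rw [hB, ← integral_const_mul]
    have hgc : Continuous fun x => g x ^ p :=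
      hg.rpow_const fun x => Or.inr (by linarith)
    refine integral_mono_ae (integrable_coe _) ((hgc.integrable_of_hasCompactSupport
      (HasCompactSupport.of_compactSpace _)).const_mul _) ?_
    filter_upwards [hv] with x hx
    rw [hx]
    exact band_le_rpow hb (hg0 x) hp1
  -- Ultracontractivity gives `M 2^(kp) b^(1-p) B = b M B / a^p`, and `a^p = 2MB` was chosen to make
  -- this `b / 2`.
  have hPv : ∀ᵐ x ∂μ, P (δ ^ 2) (v : Lp ℝ 2 μ) x ≤ b / 2 := by
    filter_upwards [hU (δ ^ 2) (by positivity) (pow_le_one₀ hδ0.le hδ1) v hv0] with x hx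
    refine hx.trans ?_
    rw [htime]
    have h1 : b ^ p = a ^ p * ((2 : ℝ) ^ k) ^ p := Real.mul_rpow ha.le (by positivity)
    have h2 : b ^ (1 - p) = b / b ^ p := by rw [Real.rpow_sub hb, Real.rpow_one]
    have hap : 0 < a ^ p := by positivity
    calc M * ((2 : ℝ) ^ k) ^ p * ∫ y, (v : Lp ℝ 2 μ) y ∂μ
        ≤ M * ((2 : ℝ) ^ k) ^ p * (b ^ (1 - p) * B) := by gcongr
      _ = b * (2 * M * B) / (2 * a ^ p) := by rw [h2, h1]; field_simp
      _ = b / 2 := by rw [← haB]; field_simp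
  have hpp := hP.integral_abs_sub_le hone hC₁ hBE hvb (t := δ ^ 2) (by positivity)
  rw [Real.sqrt_mul (by norm_num), Real.sqrt_sq hδ0.le] at hpp
  have hlow : b / 2 * ∫ x, (if 2 * b ≤ g x then (1 : ℝ) else 0) ∂μ ≤
      ∫ x, |((v : Lp ℝ 2 μ) - P (δ ^ 2) v : Lp ℝ 2 μ) x| ∂μ := by
    rw [← integral_const_mul]
    refine integral_mono_of_nonneg (Eventually.of_forall fun x => ?_) (integrable_coe _).abs ?_
    · exact mul_nonneg (by positivity) (by split_ifs <;> simp)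
    · filter_upwards [hv, hPv, Lp.coeFn_sub (v : Lp ℝ 2 μ) (P (δ ^ 2) v)] with x h1 h2 h3
      split_ifs with h
      · rw [h3, Pi.sub_apply, h1, max_eq_left (by linarith), min_eq_right (by linarith)]
        exact le_trans (by linarith) (le_abs_self _)
      · rw [mul_zero]; exact abs_nonneg _
  have hI : ∫ x, Γ.grad v x ∂μ ≤ ∫ x, (if b ≤ g x ∧ g x ≤ 2 * b then Γ.grad u x else 0) ∂μ := by
    refine integral_mono_ae (integrable_coe _) ?_ hvΓ
    exact integrable_ite (q := fun x => b ≤ g x ∧ g x ≤ 2 * b)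
      ((measurableSet_le measurable_const hg.measurable).inter
        (measurableSet_le hg.measurable measurable_const)) (integrable_coe _)
  set m := ∫ x, (if 2 * b ≤ g x then (1 : ℝ) else 0) ∂μ
  set I := ∫ x, (if b ≤ g x ∧ g x ≤ 2 * b then Γ.grad u x else 0) ∂μ
  have h1 : b ^ p = b ^ (p - 1) * b := by
    rw [← Real.rpow_add_one hb.ne']; congr 1; ring
  -- The scale `k` cancels: this is why the level estimates can be summed with one common constant.
  have h2 : b ^ (p - 1) * δ = a ^ (p - 1) := by
    rw [hbdef, Real.mul_rpow ha.le (by positivity), hδ, Real.rpow_neg (by norm_num),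
      Real.rpow_mul (by norm_num), Real.rpow_natCast]
    field_simp
  have h3 : b / 2 * m ≤ C₁ * (√2 * δ) * I :=
    hlow.trans (hpp.trans (mul_le_mul_of_nonneg_left hI (by positivity)))
  calc b ^ p * m = 2 * b ^ (p - 1) * (b / 2 * m) := by rw [h1]; ring
    _ ≤ 2 * b ^ (p - 1) * (C₁ * (√2 * δ) * I) := by gcongr
    _ = 2 * √2 * C₁ * (b ^ (p - 1) * δ) * I := by ring
    _ = 2 * √2 * C₁ * a ^ (p - 1) * I := by rw [h2]

/-- The Sobolev inequality for nonnegative continuous functions in `Dom ℰ`. -/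
theorem sobolev_of_nonneg {p : ℝ} (hp : p = Q / (Q - 1)) {g : X → ℝ} (hg : Continuous g)
    (hg0 : ∀ x, 0 ≤ g x) {u : E.dom} (hu : ∀ᵐ x ∂μ, (u : Lp ℝ 2 μ) x = g x) :
    (∫ x, g x ^ p ∂μ) ^ p⁻¹ ≤ 2 * M * (4 ^ p * (4 * √2 * C₁) + 2 ^ (p - 1)) *
      (∫ x, Γ.grad u x ∂μ + ∫ x, g x ∂μ) := by
  have hQ1 : 0 < Q - 1 := by linarith
  have hp1 : 1 < p := by rw [hp, lt_div_iff₀ hQ1]; linarith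
  have hp0 : 0 < p := by linarith
  set B := ∫ x, g x ^ p ∂μ with hB
  set I := ∫ x, Γ.grad u x ∂μ with hI
  set J := ∫ x, g x ∂μ with hJ
  have hI0 : 0 ≤ I := integral_nonneg_of_ae (Γ.grad_nonneg u)
  have hJ0 : 0 ≤ J := integral_nonneg hg0
  have hB0 : 0 ≤ B := integral_nonneg fun x => Real.rpow_nonneg (hg0 x) _
  rcases hB0.eq_or_lt with h0 | hBpos
  · rw [← h0, Real.zero_rpow (inv_ne_zero hp0.ne')]
    positivity
  set a := (2 * M * B) ^ p⁻¹ with hadef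
  have h2MB : 0 < 2 * M * B := by positivity
  have ha : 0 < a := by positivity
  have hap : a ^ p = 2 * M * B := by
    rw [hadef, ← Real.rpow_mul h2MB.le, inv_mul_cancel₀ hp0.ne', Real.rpow_one]
  obtain ⟨C, hC⟩ := (isCompact_univ (X := X)).exists_bound_of_continuousOn hg.continuousOn
  obtain ⟨N, hN⟩ : ∃ N : ℕ, C < a * 2 ^ (N + 1) := by
    obtain ⟨N, hN⟩ := pow_unbounded_of_one_lt (C / a) (by norm_num : (1 : ℝ) < 2)
    refine ⟨N, ?_⟩
    rw [div_lt_iff₀ ha] at hN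
    rw [pow_succ]
    linarith [show 0 < (2 : ℝ) ^ N * a by positivity]
  have hgN : ∀ x, g x < a * 2 ^ (N + 1) := fun x =>
    ((le_abs_self _).trans (hC x trivial)).trans_lt hN
  have hgi : Integrable g μ :=
    hg.integrable_of_hasCompactSupport (HasCompactSupport.of_compactSpace _)
  have hχi : ∀ b : ℝ, Integrable (fun x => if b ≤ g x then (1 : ℝ) else 0) μ := fun b =>
    (integrable_const (1 : ℝ)).indicator (measurableSet_le measurable_const hg.measurable)
  have hΓi : ∀ b : ℝ, Integrable (fun x => if b ≤ g x ∧ g x ≤ 2 * b then Γ.grad u x else 0) μ :=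
    fun b => integrable_ite (q := fun x => b ≤ g x ∧ g x ≤ 2 * b)
      ((measurableSet_le measurable_const hg.measurable).inter
        (measurableSet_le hg.measurable measurable_const)) (integrable_coe _)
  have hsum : ∑ k ∈ Finset.range N, ∫ x, (if a * 2 ^ k ≤ g x ∧ g x ≤ 2 * (a * 2 ^ k) then
      Γ.grad u x else 0) ∂μ ≤ 2 * I := by
    rw [← integral_finsetSum _ fun k _ => hΓi _, hI, ← integral_const_mul]
    refine integral_mono_ae (integrable_finsetSum _ fun k _ => hΓi _)
      ((integrable_coe _).const_mul _) ?_
    filter_upwards [Γ.grad_nonneg u] with x hx using sum_ite_dyadic_le ha hx N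
  -- The pointwise dyadic bound, integrated: low values of `g` go to the `L¹` term, high ones to the
  -- level sets.
  have hmain : B ≤ (2 * a) ^ (p - 1) * J + ∑ k ∈ Finset.range N,
      4 ^ p * ((a * 2 ^ k) ^ p * ∫ x, (if 2 * (a * 2 ^ k) ≤ g x then (1 : ℝ) else 0) ∂μ) := by
    have h1 : B ≤ ∫ x, ((2 * a) ^ (p - 1) * g x + ∑ k ∈ Finset.range N,
        (4 * (a * 2 ^ k)) ^ p * (if 2 * (a * 2 ^ k) ≤ g x then (1 : ℝ) else 0)) ∂μ := by
      refine integral_mono_of_nonneg (Eventually.of_forall fun x => Real.rpow_nonneg (hg0 x) _)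
        ((hgi.const_mul _).add (integrable_finsetSum _ fun k _ => (hχi _).const_mul _))
        (Eventually.of_forall fun x => rpow_le_dyadic ha (hg0 x) hp1 (hgN x))
    rw [integral_add (hgi.const_mul _)
      (integrable_finsetSum _ fun k _ => (hχi _).const_mul _), integral_const_mul,
      integral_finsetSum _ fun k _ => (hχi _).const_mul _] at h1
    refine h1.trans (add_le_add le_rfl (Finset.sum_le_sum fun k _ => ?_))
    rw [integral_const_mul, Real.mul_rpow (by norm_num) (by positivity), mul_assoc]
  have hlev : ∑ k ∈ Finset.range N,
      4 ^ p * ((a * 2 ^ k) ^ p * ∫ x, (if 2 * (a * 2 ^ k) ≤ g x then (1 : ℝ) else 0) ∂μ) ≤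
      4 ^ p * (4 * √2 * C₁) * a ^ (p - 1) * I := by
    calc _ ≤ ∑ k ∈ Finset.range N, 4 ^ p * (2 * √2 * C₁ * a ^ (p - 1) *
          ∫ x, (if a * 2 ^ k ≤ g x ∧ g x ≤ 2 * (a * 2 ^ k) then Γ.grad u x else 0) ∂μ) := by
          refine Finset.sum_le_sum fun k _ => ?_
          exact mul_le_mul_of_nonneg_left
            (hP.level_set_le hone hloc hC₁ hBE hM hQ hU hp hg hg0 hu hB ha hap k) (by positivity)
      _ = 4 ^ p * (2 * √2 * C₁ * a ^ (p - 1)) * ∑ k ∈ Finset.range N,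
          ∫ x, (if a * 2 ^ k ≤ g x ∧ g x ≤ 2 * (a * 2 ^ k) then Γ.grad u x else 0) ∂μ := by
          rw [Finset.mul_sum]
          exact Finset.sum_congr rfl fun k _ => by ring
      _ ≤ 4 ^ p * (2 * √2 * C₁ * a ^ (p - 1)) * (2 * I) := by gcongr
      _ = 4 ^ p * (4 * √2 * C₁) * a ^ (p - 1) * I := by ring
  rw [Real.mul_rpow (by norm_num) ha.le] at hmain
  set D := 4 ^ p * (4 * √2 * C₁) + 2 ^ (p - 1) with hD
  have hBle : B ≤ a ^ (p - 1) * (D * (I + J)) := by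
    have e1 : 0 ≤ 4 ^ p * (4 * √2 * C₁) * a ^ (p - 1) * J := by positivity
    have e2 : 0 ≤ 2 ^ (p - 1) * a ^ (p - 1) * I := by positivity
    rw [hD]
    linarith
  -- Since `a^p = 2MB`, the bound on `B` carries a factor `a^(p-1)` that can be divided out.
  have haa : a ≤ 2 * M * (D * (I + J)) := by
    have e1 : a ^ p = a ^ (p - 1) * a := by
      rw [← Real.rpow_add_one ha.ne']; congr 1; ring
    have e2 : 0 < a ^ (p - 1) := by positivity
    refine le_of_mul_le_mul_left ?_ e2
    rw [← e1, hap]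
    calc 2 * M * B ≤ 2 * M * (a ^ (p - 1) * (D * (I + J))) := by gcongr
      _ = a ^ (p - 1) * (2 * M * (D * (I + J))) := by ring
  calc B ^ p⁻¹ ≤ a := Real.rpow_le_rpow hB0 (by nlinarith) (by positivity)
    _ ≤ 2 * M * D * (I + J) := by rw [mul_assoc (2 * M)]; exact haa

/-- The Sobolev inequality for continuous functions in `Dom ℰ`. -/
theorem sobolev_of_continuous {p : ℝ} (hp : p = Q / (Q - 1)) {g : X → ℝ} (hg : Continuous g)
    {u : E.dom} (hu : ∀ᵐ x ∂μ, (u : Lp ℝ 2 μ) x = g x) :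
    eLpNorm (u : Lp ℝ 2 μ) (ENNReal.ofReal p) μ ≤
      ENNReal.ofReal (2 * M * (4 ^ p * (4 * √2 * C₁) + 2 ^ (p - 1))) *
        (ENNReal.ofReal (∫ x, Γ.grad u x ∂μ) + eLpNorm (u : Lp ℝ 2 μ) 1 μ) := by
  have hQ1 : 0 < Q - 1 := by linarith
  have hp1 : 1 < p := by rw [hp, lt_div_iff₀ hQ1]; linarith
  have hp0 : 0 < p := by linarith
  obtain ⟨C, hC⟩ := (isCompact_univ (X := X)).exists_bound_of_continuousOn hg.continuousOn
  have huC : ∀ᵐ x ∂μ, |(u : Lp ℝ 2 μ) x| ≤ C := by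
    filter_upwards [hu] with x hx using by rw [hx]; exact hC x trivial
  have hφ : ∀ a b : ℝ, |(|a| - |b|)| ≤ |a - b| := fun a b => abs_abs_sub_abs_le a b
  -- Taking absolute values is a contraction, so it stays in the domain and does not increase the
  -- gradient.
  obtain ⟨w, hw⟩ := hP.exists_comp hone (φ := fun r => |r|) (L := 1) continuous_abs
    (by simpa using hφ) huC
  have hwg : ∀ᵐ x ∂μ, (w : Lp ℝ 2 μ) x = |g x| := by
    filter_upwards [hw, hu] with x h1 h2 using by rw [h1, h2]
  have hS := hP.sobolev_of_nonneg hone hloc hC₁ hBE hM hQ hU hp hg.abs (fun x => abs_nonneg _) hwg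
  have hI : ∫ x, Γ.grad w x ∂μ ≤ ∫ x, Γ.grad u x ∂μ :=
    integral_mono_ae (integrable_coe _) (integrable_coe _)
      (hP.grad_contraction hone Γ continuous_abs hφ huC hw)
  have hmem : ∀ q : ℝ≥0∞, MemLp g q μ := fun q =>
    MemLp.of_bound hg.aestronglyMeasurable C (Eventually.of_forall fun x => hC x trivial)
  have e1 : eLpNorm (u : Lp ℝ 2 μ) (ENNReal.ofReal p) μ =
      ENNReal.ofReal ((∫ x, |g x| ^ p ∂μ) ^ p⁻¹) := by
    rw [eLpNorm_congr_ae hu, (hmem _).eLpNorm_eq_integral_rpow_norm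
      (by simpa using hp0) ENNReal.ofReal_ne_top, ENNReal.toReal_ofReal hp0.le]
    rfl
  have e2 : eLpNorm (u : Lp ℝ 2 μ) 1 μ = ENNReal.ofReal (∫ x, |g x| ∂μ) := by
    rw [eLpNorm_congr_ae hu, (hmem _).eLpNorm_eq_integral_rpow_norm one_ne_zero ENNReal.one_ne_top]
    simp
  have hI0 : 0 ≤ ∫ x, Γ.grad u x ∂μ := integral_nonneg_of_ae (Γ.grad_nonneg u)
  have hJ0 : 0 ≤ ∫ x, |g x| ∂μ := integral_nonneg fun x => abs_nonneg _
  rw [e1, e2, ← ENNReal.ofReal_add hI0 hJ0, ← ENNReal.ofReal_mul (by positivity)]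
  refine ENNReal.ofReal_le_ofReal (hS.trans ?_)
  gcongr

end IsHeatSemigroup

end DirichletForm

open DirichletForm

/-! ## One-forms of bounded fibre norm -/

section OneForms

variable {X : Type*} [MeasurableSpace X] {μ : Measure X} [TopologicalSpace X]
  {E : DirichletForm μ} (Γ : CarreDuChamp E)

omit [TopologicalSpace X] in
theorem mulL1_mul (γ : Lp ℝ 1 μ) (b g : BddMeas X) :
    mulL1 μ γ (b * g) = mulL1 μ (mulL1 μ γ g) b := by
  refine Lp.ext ?_
  filter_upwards [mulL1_apply γ (b * g), mulL1_apply (mulL1 μ γ g) b, mulL1_apply γ g]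
    with x h1 h2 h3
  rw [h1, h2, h3]
  simp [mul_assoc]

namespace SimpleForm

/-- Multiplication of simple one-forms by a bounded function. -/
def mulForm (b : BddMeas X) : SimpleForm Γ →ₗ[ℝ] SimpleForm Γ :=
  LinearMap.lTensor E.contDom (LinearMap.mulLeft ℝ b)

theorem mulForm_tmul (b : BddMeas X) (f : E.contDom) (g : BddMeas X) :
    mulForm Γ b (tmul Γ f g) = tmul Γ f (b * g) := rfl

theorem fiberInner_mulForm (b : BddMeas X) (ω η : SimpleForm Γ) :
    fiberInner Γ (mulForm Γ b ω) η = mulL1 μ (fiberInner Γ ω η) b := by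
  have key : ∀ (f₁ : E.contDom) (g₁ : BddMeas X) (η : SimpleForm Γ),
      fiberInner Γ (mulForm Γ b (tmul Γ f₁ g₁)) η = mulL1 μ (fiberInner Γ (tmul Γ f₁ g₁) η) b := by
    intro f₁ g₁ η
    obtain ⟨S, hS⟩ := TensorProduct.exists_finset (R := ℝ) (M := E.contDom) (N := BddMeas X) η
    have h : η = ∑ s ∈ S, tmul Γ s.1 s.2 := hS
    rw [h]
    simp only [map_sum, LinearMap.sum_apply, mulForm_tmul, fiberInner_tmul, ← mulL1_mul, mul_assoc]
  obtain ⟨S, hS⟩ := TensorProduct.exists_finset (R := ℝ) (M := E.contDom) (N := BddMeas X) ω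
  have h : ω = ∑ s ∈ S, tmul Γ s.1 s.2 := hS
  rw [h]
  simp only [map_sum, LinearMap.sum_apply, key]

theorem fiberInner_mulForm_ae (b : BddMeas X) (ω η : SimpleForm Γ) :
    ∀ᵐ x ∂μ, fiberInner Γ (mulForm Γ b ω) η x = (b : X → ℝ) x * fiberInner Γ ω η x := by
  rw [fiberInner_mulForm]
  exact mulL1_apply _ _

theorem fiberInner_mulForm_self_ae (b : BddMeas X) (ω : SimpleForm Γ) :
    ∀ᵐ x ∂μ, fiberInner Γ (mulForm Γ b ω) (mulForm Γ b ω) x =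
      (b : X → ℝ) x ^ 2 * fiberInner Γ ω ω x := by
  filter_upwards [fiberInner_mulForm_ae Γ b ω (mulForm Γ b ω), fiberInner_mulForm_ae Γ b ω ω]
    with x h1 h2
  rw [h1, fiberInner_symm, h2]
  ring

theorem norm_sqrtLp (ω : SimpleForm Γ) : ‖sqrtLp (fiberInner Γ ω ω)‖ = ‖ω‖ := by
  refine (sq_eq_sq₀ (norm_nonneg _) (norm_nonneg _)).1 ?_
  rw [norm_sq_eq, ← real_inner_self_eq_norm_sq, inner_eq_integral]
  refine integral_congr_ae ?_
  filter_upwards [sqrtLp_apply (fiberInner Γ ω ω), fiberInner_self_nonneg Γ ω] with x h1 h2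
  rw [h1, Real.mul_self_sqrt h2]

theorem sqrtLp_add_le (ω η : SimpleForm Γ) : ∀ᵐ x ∂μ,
    sqrtLp (fiberInner Γ (ω + η) (ω + η)) x ≤
      sqrtLp (fiberInner Γ ω ω) x + sqrtLp (fiberInner Γ η η) x := by
  have he : fiberInner Γ (ω + η) (ω + η) =
      (fiberInner Γ ω ω + (2 : ℝ) • fiberInner Γ ω η) + fiberInner Γ η η := by
    simp only [map_add, LinearMap.add_apply]
    rw [fiberInner_symm Γ η ω]
    module
  filter_upwards [Lp.coeFn_add (fiberInner Γ ω ω + (2 : ℝ) • fiberInner Γ ω η)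
      (fiberInner Γ η η), Lp.coeFn_add (fiberInner Γ ω ω) ((2 : ℝ) • fiberInner Γ ω η),
    Lp.coeFn_smul (2 : ℝ) (fiberInner Γ ω η), fiberInner_sq_le Γ ω η,
    fiberInner_self_nonneg Γ ω, fiberInner_self_nonneg Γ η, sqrtLp_apply (fiberInner Γ ω ω),
    sqrtLp_apply (fiberInner Γ η η), sqrtLp_apply (fiberInner Γ (ω + η) (ω + η))]
    with x h1 h2 h3 h4 h5 h6 h7 h8 h9
  rw [h9, h7, h8, he, h1, Pi.add_apply, h2, Pi.add_apply, h3, Pi.smul_apply, smul_eq_mul]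
  refine Real.sqrt_le_iff.2 ⟨by positivity, ?_⟩
  have h10 : fiberInner Γ ω η x ≤ √(fiberInner Γ ω ω x) * √(fiberInner Γ η η x) := by
    rw [← Real.sqrt_mul h5]
    exact Real.le_sqrt_of_sq_le h4
  nlinarith [Real.sq_sqrt h5, Real.sq_sqrt h6]

theorem sqrtLp_smul {c : ℝ} (hc : 0 ≤ c) (ω : SimpleForm Γ) : ∀ᵐ x ∂μ,
    sqrtLp (fiberInner Γ (c • ω) (c • ω)) x = c * sqrtLp (fiberInner Γ ω ω) x := by
  have he : fiberInner Γ (c • ω) (c • ω) = (c ^ 2) • fiberInner Γ ω ω := by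
    simp only [map_smul, LinearMap.smul_apply, smul_smul, sq]
  filter_upwards [Lp.coeFn_smul (c ^ 2) (fiberInner Γ ω ω), sqrtLp_apply (fiberInner Γ ω ω),
    sqrtLp_apply (fiberInner Γ (c • ω) (c • ω))] with x h1 h2 h3
  rw [h3, h2, he, h1, Pi.smul_apply, smul_eq_mul, Real.sqrt_mul (sq_nonneg c), Real.sqrt_sq hc]

/-- The embedding `f ↦ f ⊗ 1` of `𝒞` into the simple one-forms. -/
def diff : E.contDom →ₗ[ℝ] SimpleForm Γ := (TensorProduct.mk ℝ E.contDom (BddMeas X)).flip 1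

theorem sqrtLp_diff (f : E.contDom) :
    sqrtLp (fiberInner Γ (diff Γ f) (diff Γ f)) = Γ.grad (E.contDomIncl f) := by
  have h : fiberInner Γ (diff Γ f) (diff Γ f) =
      Γ.toFun (E.contDomIncl f) (E.contDomIncl f) := by
    change fiberInner Γ (tmul Γ f 1) (tmul Γ f 1) = _
    rw [fiberInner_tmul]
    refine Lp.ext ?_
    filter_upwards [mulL1_apply (Γ.toFun (E.contDomIncl f) (E.contDomIncl f)) (1 * 1)] with x hx
    rw [hx]; simp
  rw [h]
  rfl

/-- Evaluation of the second factor at a point: a left inverse of `diff`. -/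
def evalAt (x : X) : SimpleForm Γ →ₗ[ℝ] E.contDom :=
  (TensorProduct.rid ℝ E.contDom).toLinearMap ∘ₗ
    LinearMap.lTensor E.contDom ((LinearMap.proj x).comp (BddMeas X).toSubmodule.subtype)

theorem evalAt_diff (x : X) (f : E.contDom) : evalAt Γ x (diff Γ f) = f := by
  change TensorProduct.rid ℝ E.contDom (f ⊗ₜ[ℝ] ((1 : X → ℝ) x)) = f
  simp

variable [IsProbabilityMeasure μ]

theorem integral_sqrtLp_le (ω : SimpleForm Γ) :
    ∫ x, sqrtLp (fiberInner Γ ω ω) x ∂μ ≤ ‖ω‖ :=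
  (integral_le_norm _).trans (norm_sqrtLp Γ ω).le

end SimpleForm

variable [IsProbabilityMeasure μ]

omit [IsProbabilityMeasure μ] in
theorem tendsto_fiberNorm {ω : ℕ → SimpleForm Γ} {η : OneForm Γ}
    (h : Tendsto (fun n => (ω n : OneForm Γ)) atTop (𝓝 η)) :
    Tendsto (fun n => sqrtLp (SimpleForm.fiberInner Γ (ω n) (ω n))) atTop (𝓝 (fiberNorm Γ η)) := by
  have hc : Continuous (fiberNorm Γ) := UniformSpace.Completion.continuous_extension
  refine ((hc.tendsto η).comp h).congr fun n => ?_
  exact fiberNorm_coe Γ (ω n)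

/-- Duality between the fibrewise `L¹` and `L^∞` norms of one-forms. -/
theorem fiberNorm_le_of_inner_le {η : OneForm Γ} {C : ℝ}
    (hC : 0 ≤ C) (H : ∀ ω : SimpleForm Γ, inner ℝ η (ω : OneForm Γ) ≤
      C * ∫ x, sqrtLp (SimpleForm.fiberInner Γ ω ω) x ∂μ) :
    ∀ᵐ x ∂μ, fiberNorm Γ η x ≤ C := by
  obtain ⟨ω, hω⟩ : ∃ ω : ℕ → SimpleForm Γ, Tendsto (fun n => (ω n : OneForm Γ)) atTop (𝓝 η) := by
    obtain ⟨z, hz, hlim⟩ := mem_closure_iff_seq_limit.1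
      (UniformSpace.Completion.denseRange_coe (α := SimpleForm Γ) η)
    choose ω hω using hz
    exact ⟨ω, by simpa only [hω] using hlim⟩
  set N := fiberNorm Γ η with hN
  let Nn : ℕ → Lp ℝ 2 μ := fun n => sqrtLp (SimpleForm.fiberInner Γ (ω n) (ω n))
  have hNn : Tendsto Nn atTop (𝓝 N) := tendsto_fiberNorm Γ hω
  -- Testing `H` on the approximations of `η` restricted to `A` gives `∫_A N² ≤ C ∫_A N` in the
  -- limit. As `N > C ≥ 0` on `A`, this forces `A` to be null.
  let A : Set X := {x | C < N x}
  have hA : MeasurableSet A :=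
    measurableSet_lt measurable_const (Lp.stronglyMeasurable N).measurable
  let b : BddMeas X := ⟨A.indicator 1, measurable_one.indicator hA, 1, fun x => by
    by_cases h : x ∈ A <;> simp [h]⟩
  have hb01 : ∀ x, (b : X → ℝ) x = 0 ∨ (b : X → ℝ) x = 1 := fun x => by
    by_cases h : x ∈ A
    · right; exact Set.indicator_of_mem h _
    · left; exact Set.indicator_of_notMem h _
  have hbm : AEStronglyMeasurable (b : X → ℝ) μ := b.2.1.aestronglyMeasurable
  have hb1 : ∀ᵐ x ∂μ, |(b : X → ℝ) x| ≤ 1 := Eventually.of_forall fun x => by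
    rcases hb01 x with h | h <;> simp [h]
  have hχ : classOf μ (b : X → ℝ) =ᵐ[μ] (b : X → ℝ) := classOf_ae hbm hb1
  have e1 : ∀ w : Lp ℝ 2 μ, inner ℝ (classOf μ fun x => (b : X → ℝ) x * w x) w =
      ∫ x, (b : X → ℝ) x * w x ^ 2 ∂μ := fun w => by
    rw [inner_eq_integral]
    refine integral_congr_ae ?_
    filter_upwards [classOf_mul_ae hbm hb1 w] with x hx
    rw [hx]; ring
  have e2 : ∀ w : Lp ℝ 2 μ, inner ℝ (classOf μ (b : X → ℝ)) w = ∫ x, (b : X → ℝ) x * w x ∂μ :=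
    fun w => by
    rw [inner_eq_integral]
    refine integral_congr_ae ?_
    filter_upwards [hχ] with x hx
    rw [hx]
  have hstep : ∀ n, inner ℝ (classOf μ fun x => (b : X → ℝ) x * Nn n x) (Nn n) ≤
      C * inner ℝ (classOf μ (b : X → ℝ)) (Nn n) +
        ‖(ω n : OneForm Γ) - η‖ * ‖(ω n : OneForm Γ)‖ := by
    intro n
    set ζ := SimpleForm.mulForm Γ b (ω n) with hζ
    have h1 : inner ℝ (ω n : OneForm Γ) (ζ : OneForm Γ) =
        inner ℝ (classOf μ fun x => (b : X → ℝ) x * Nn n x) (Nn n) := by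
      rw [UniformSpace.Completion.inner_coe, real_inner_comm, SimpleForm.inner_def, e1]
      refine integral_congr_ae ?_
      filter_upwards [SimpleForm.fiberInner_mulForm_ae Γ b (ω n) (ω n),
        sqrtLp_apply (SimpleForm.fiberInner Γ (ω n) (ω n)),
        SimpleForm.fiberInner_self_nonneg Γ (ω n)] with x h2 h3 h4
      rw [h2]
      simp only [Nn]
      rw [h3, Real.sq_sqrt h4]
    have h2 : ∫ x, sqrtLp (SimpleForm.fiberInner Γ ζ ζ) x ∂μ =
        inner ℝ (classOf μ (b : X → ℝ)) (Nn n) := by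
      rw [e2]
      refine integral_congr_ae ?_
      filter_upwards [SimpleForm.fiberInner_mulForm_self_ae Γ b (ω n),
        sqrtLp_apply (SimpleForm.fiberInner Γ (ω n) (ω n)),
        sqrtLp_apply (SimpleForm.fiberInner Γ ζ ζ)] with x h2 h3 h4
      simp only [Nn]
      rw [h4, h3, h2]
      rcases hb01 x with h | h <;> simp [h]
    have h3 : ‖ζ‖ ≤ ‖ω n‖ := by
      refine (sq_le_sq₀ (norm_nonneg _) (norm_nonneg _)).1 ?_
      rw [SimpleForm.norm_sq_eq, SimpleForm.norm_sq_eq]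
      refine integral_mono_ae (L1.integrable_coeFn _) (L1.integrable_coeFn _) ?_
      filter_upwards [SimpleForm.fiberInner_mulForm_self_ae Γ b (ω n),
        SimpleForm.fiberInner_self_nonneg Γ (ω n)] with x h4 h5
      rw [h4]
      rcases hb01 x with h | h <;> simp [h, h5]
    have h4 := H ζ
    rw [h2] at h4
    have h5 : inner ℝ (ω n : OneForm Γ) (ζ : OneForm Γ) =
        inner ℝ η (ζ : OneForm Γ) + inner ℝ ((ω n : OneForm Γ) - η) (ζ : OneForm Γ) := by
      rw [← inner_add_left]; congr 1; abel
    have h6 : inner ℝ ((ω n : OneForm Γ) - η) (ζ : OneForm Γ) ≤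
        ‖(ω n : OneForm Γ) - η‖ * ‖(ω n : OneForm Γ)‖ := by
      refine (real_inner_le_norm _ _).trans ?_
      rw [UniformSpace.Completion.norm_coe, UniformSpace.Completion.norm_coe]
      gcongr
    rw [← h1, h5]
    linarith
  have hlim1 : Tendsto (fun n => inner ℝ (classOf μ fun x => (b : X → ℝ) x * Nn n x) (Nn n)) atTop
      (𝓝 (inner ℝ (classOf μ fun x => (b : X → ℝ) x * N x) N)) :=
    (tendsto_classOf_mul hbm hb1 hNn).inner (𝕜 := ℝ) hNn
  have hlim2 : Tendsto (fun n => C * inner ℝ (classOf μ (b : X → ℝ)) (Nn n) +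
      ‖(ω n : OneForm Γ) - η‖ * ‖(ω n : OneForm Γ)‖) atTop
      (𝓝 (C * inner ℝ (classOf μ (b : X → ℝ)) N + 0 * ‖η‖)) :=
    ((tendsto_const_nhds.inner (𝕜 := ℝ) hNn).const_mul C).add
      ((tendsto_iff_norm_sub_tendsto_zero.1 hω).mul hω.norm)
  have hle := le_of_tendsto_of_tendsto' hlim1 hlim2 hstep
  rw [e1, e2, zero_mul, add_zero, ← integral_const_mul, ← sub_nonneg, ← integral_sub] at hle
  rotate_left
  · exact (integrable_bdd_mul (integrable_coe N) hbm hb1).const_mul C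
  · exact integrable_bdd_mul (Lp.memLp N).integrable_sq hbm hb1
  have hpos : ∀ x, (b : X → ℝ) x * N x ^ 2 - C * ((b : X → ℝ) x * N x) =
      if x ∈ A then N x * (N x - C) else 0 := fun x => by
    by_cases h : x ∈ A
    · have : (b : X → ℝ) x = 1 := Set.indicator_of_mem h _
      rw [if_pos h, this]; ring
    · have : (b : X → ℝ) x = 0 := Set.indicator_of_notMem h _
      rw [if_neg h, this]; ring
  have hnn : ∀ x, 0 ≤ (b : X → ℝ) x * N x ^ 2 - C * ((b : X → ℝ) x * N x) := fun x => by
    rw [hpos]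
    split_ifs with h
    · have h : C < N x := h
      exact mul_nonneg (hC.trans h.le) (by linarith)
    · exact le_rfl
  have hzero : ∫ x, ((b : X → ℝ) x * N x ^ 2 - C * ((b : X → ℝ) x * N x)) ∂μ = 0 := by
    refine le_antisymm ?_ (integral_nonneg hnn)
    have : ∫ x, ((b : X → ℝ) x * N x ^ 2 - C * ((b : X → ℝ) x * N x)) ∂μ =
        -∫ x, (C * ((b : X → ℝ) x * N x) - (b : X → ℝ) x * N x ^ 2) ∂μ := by
      rw [← integral_neg]
      simp
    linarith
  rw [integral_eq_zero_iff_of_nonneg hnn] at hzero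
  · filter_upwards [hzero] with x hx
    rw [Pi.zero_apply, hpos] at hx
    by_contra hcon
    have h : C < N x := not_le.1 hcon
    rw [if_pos (show x ∈ A from h)] at hx
    rcases mul_eq_zero.1 hx with h' | h' <;> linarith
  · exact (integrable_bdd_mul (Lp.memLp N).integrable_sq hbm hb1).sub
      ((integrable_bdd_mul (integrable_coe N) hbm hb1).const_mul C)

/-- Every linear functional on `𝒞` dominated by the fibrewise `L¹` norm of the differential is
represented by a one-form of fibre norm at most `1`. -/
theorem exists_oneForm_of_le (Λ : E.contDom →ₗ[ℝ] ℝ)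
    (hΛ : ∀ f, Λ f ≤ ∫ x, Γ.grad (E.contDomIncl f) x ∂μ) :
    ∃ η : OneForm Γ, (∀ᵐ x ∂μ, fiberNorm Γ η x ≤ 1) ∧
      ∀ f : E.contDom, inner ℝ η (SimpleForm.diff Γ f : OneForm Γ) = Λ f := by
  obtain ⟨x₀⟩ : Nonempty X := nonempty_of_isProbabilityMeasure μ
  -- Hahn–Banach with the fibrewise `L¹` norm as sublinear majorant. Composing `Λ` with `evalAt`
  -- gives a linear functional on the range of `diff` without choosing preimages.
  obtain ⟨g, hg1, hg2⟩ := exists_extension_of_le_sublinear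
    ((Λ.comp (SimpleForm.evalAt Γ x₀)).toPMap (LinearMap.range (SimpleForm.diff Γ)))
    (fun ω => ∫ x, sqrtLp (SimpleForm.fiberInner Γ ω ω) x ∂μ)
    (fun c hc ω => by
      rw [← integral_const_mul]
      exact integral_congr_ae (SimpleForm.sqrtLp_smul Γ hc.le ω))
    (fun ω η => by
      rw [← integral_add (integrable_coe _) (integrable_coe _)]
      exact integral_mono_ae (integrable_coe _) ((integrable_coe _).add (integrable_coe _))
        (SimpleForm.sqrtLp_add_le Γ ω η))
    (by
      rintro ⟨_, f, rfl⟩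
      change Λ (SimpleForm.evalAt Γ x₀ (SimpleForm.diff Γ f)) ≤
        ∫ x, sqrtLp (SimpleForm.fiberInner Γ (SimpleForm.diff Γ f) (SimpleForm.diff Γ f)) x ∂μ
      rw [SimpleForm.evalAt_diff, SimpleForm.sqrtLp_diff]
      exact hΛ f)
  -- On a probability space the `L¹` majorant is below the norm of `ℋ`, so the functional extends to
  -- the completion and Riesz represents it.
  have hgb : ∀ ω, ‖g ω‖ ≤ 1 * ‖ω‖ := fun ω => by
    rw [one_mul, Real.norm_eq_abs, abs_le]
    have h1 := (hg2 ω).trans (SimpleForm.integral_sqrtLp_le Γ ω)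
    have h2 := (hg2 (-ω)).trans (SimpleForm.integral_sqrtLp_le Γ (-ω))
    rw [map_neg, norm_neg] at h2
    exact ⟨by linarith, h1⟩
  let G : OneForm Γ →L[ℝ] ℝ :=
    (g.mkContinuous 1 hgb).extend (UniformSpace.Completion.toComplL (𝕜 := ℝ) (E := SimpleForm Γ))
  have hG : ∀ ω : SimpleForm Γ, G (ω : OneForm Γ) = g ω := fun ω =>
    ContinuousLinearMap.extend_eq (g.mkContinuous 1 hgb)
      (e := UniformSpace.Completion.toComplL (𝕜 := ℝ) (E := SimpleForm Γ))
      UniformSpace.Completion.denseRange_coe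
      (UniformSpace.Completion.isUniformInducing_coe _) ω
  let η : OneForm Γ := (InnerProductSpace.toDual ℝ (OneForm Γ)).symm G
  have hη : ∀ ω : SimpleForm Γ, inner ℝ η (ω : OneForm Γ) = g ω := fun ω => by
    rw [InnerProductSpace.toDual_symm_apply, hG]
  refine ⟨η, fiberNorm_le_of_inner_le Γ zero_le_one fun ω => ?_, fun f => ?_⟩
  · rw [hη, one_mul]; exact hg2 ω
  · rw [hη]
    have := hg1 ⟨SimpleForm.diff Γ f, f, rfl⟩
    change g (SimpleForm.diff Γ f) = Λ (SimpleForm.evalAt Γ x₀ (SimpleForm.diff Γ f)) at this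
    rwa [SimpleForm.evalAt_diff] at this

omit [IsProbabilityMeasure μ] in
/-- The codifferential of a one-form is determined by testing against `𝒞`. -/
theorem codifferential_eq (hdense : Dense (E.contDom : Set (Lp ℝ 2 μ))) {η : OneForm Γ}
    {ψ : Lp ℝ 2 μ} (h : ∀ f : E.contDom,
      inner ℝ η (SimpleForm.diff Γ f : OneForm Γ) = inner ℝ ψ (f : Lp ℝ 2 μ)) :
    ∃ hη : η ∈ (codifferential Γ).domain, codifferential Γ ⟨η, hη⟩ = ψ := by
  have hgraph : ∀ x : (exteriorDerivative Γ).domain,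
      ((x : Lp ℝ 2 μ), exteriorDerivative Γ x) ∈
        closure ((exteriorDerivativeCore Γ).graph : Set (Lp ℝ 2 μ × OneForm Γ)) := by
    intro x
    have hx : _ ∈ (exteriorDerivativeCore Γ).closure.graph := (exteriorDerivative Γ).mem_graph x
    -- For a non-closable operator `closure` returns the operator itself, so its graph lies in the
    -- closure of the core's graph in either case.
    by_cases hc : (exteriorDerivativeCore Γ).IsClosable
    · rw [← hc.graph_closure_eq_closure_graph] at hx
      exact hx
    · rw [LinearPMap.closure_def' hc] at hx
      exact subset_closure hx
  have key : ∀ x : (exteriorDerivative Γ).domain,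
      inner ℝ ψ (x : Lp ℝ 2 μ) = inner ℝ η (exteriorDerivative Γ x) := by
    intro x
    have hcl : IsClosed {q : Lp ℝ 2 μ × OneForm Γ | inner ℝ ψ q.1 = inner ℝ η q.2} :=
      isClosed_eq (by fun_prop) (by fun_prop)
    refine closure_minimal ?_ hcl (hgraph x)
    rintro ⟨u, ω⟩ hq
    obtain ⟨f, hf1, hf2⟩ := (LinearPMap.mem_graph_iff _).1 hq
    change inner ℝ ψ u = inner ℝ η ω
    simp only at hf1 hf2
    rw [← hf1, ← hf2]
    exact (h f).symm
  have hmem : η ∈ (codifferential Γ).domain :=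
    LinearPMap.mem_adjoint_domain_of_exists η ⟨ψ, key⟩
  refine ⟨hmem, LinearPMap.adjoint_apply_eq ?_ ⟨η, hmem⟩ key⟩
  exact hdense.mono (LinearPMap.le_closure (exteriorDerivativeCore Γ)).1

end OneForms

/-! ## The energy of smoothed functions of bounded variation -/

/-- Fatou's lemma along an almost everywhere convergent subsequence. -/
theorem eLpNorm_le_of_tendsto {X : Type*} [MeasurableSpace X] {μ : Measure X} {p : ℝ≥0∞}
    {u : ℕ → Lp ℝ 2 μ} {v : Lp ℝ 2 μ} (huv : Tendsto u atTop (𝓝 v)) {b : ℕ → ℝ≥0∞} {B : ℝ≥0∞}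
    (hb : ∀ n, eLpNorm (u n) p μ ≤ b n) (hB : Tendsto b atTop (𝓝 B)) : eLpNorm v p μ ≤ B := by
  obtain ⟨ns, hns, hlim⟩ := (tendstoInMeasure_of_tendsto_Lp huv).exists_seq_tendsto_ae
  refine (Lp.eLpNorm_lim_le_liminf_eLpNorm (fun n => Lp.aestronglyMeasurable (u (ns n))) v
    hlim).trans ?_
  rw [← (hB.comp hns.tendsto_atTop).liminf_eq]
  exact liminf_le_liminf (Eventually.of_forall fun n => hb (ns n))

namespace DirichletForm

variable {X : Type*} [MeasurableSpace X] [TopologicalSpace X] [CompactSpace X]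
  {μ : Measure X} {E : DirichletForm μ}

theorem IsRegular.dense_contDom (hreg : E.IsRegular) : Dense (E.contDom : Set (Lp ℝ 2 μ)) := by
  refine Metric.dense_iff.2 fun u r hr => ?_
  obtain ⟨w, hw, hwd⟩ := Metric.dense_iff.1 E.dense_dom u (r / 2) (half_pos hr)
  obtain ⟨v, ⟨g, hg, -, hvg⟩, hv⟩ := hreg.dense_form ⟨w, hwd⟩ ((r / 2) ^ 2) (by positivity)
  refine ⟨v, ?_, v.2, BoundedContinuousFunction.mkOfCompact ⟨g, hg⟩, hvg⟩
  have h1 : ‖w - v‖ < r / 2 := by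
    refine lt_of_pow_lt_pow_left₀ 2 (half_pos hr).le (lt_of_le_of_lt ?_ hv)
    exact le_add_of_nonneg_left (E.nonneg _)
  rw [Metric.mem_ball] at hw ⊢
  rw [← dist_eq_norm, dist_comm] at h1
  linarith [dist_triangle (v : Lp ℝ 2 μ) w u]

namespace IsHeatSemigroup

variable [IsProbabilityMeasure μ] {P : ℝ → Lp ℝ 2 μ →L[ℝ] Lp ℝ 2 μ} (hP : E.IsHeatSemigroup P)
  (hone : E.HasLaplacian (oneLp μ) 0) {Γ : CarreDuChamp E} {C₁ : ℝ} (hC₁ : 0 < C₁)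
  (hBE : WeakBakryEmery Γ P C₁ 0)

omit [TopologicalSpace X] [CompactSpace X] in
/-- A functional dominated by `u ↦ ∫ √Γ(P_s u) dμ` that detects `∫ √Γ(w) dμ`. -/
theorem exists_functional {s : ℝ} (hs : 0 < s) (w : E.dom) :
    ∃ ψ : Lp ℝ 2 μ, (∀ u, inner ℝ ψ u ≤ ∫ x, Γ.grad (hP.toDom hs u) x ∂μ) ∧
      ∀ u, hP.toDom hs u = w → inner ℝ ψ u = ∫ x, Γ.grad w x ∂μ := by
  -- Where `√Γ(w)` vanishes the inverse is 0 by convention, so the integrand vanishes there,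
  -- consistently with the target `√Γ(w) = 0`.
  have hm : AEStronglyMeasurable (fun x => (Γ.grad w x)⁻¹) μ :=
    (Lp.stronglyMeasurable (Γ.grad w)).measurable.inv.aestronglyMeasurable
  have hdom : ∀ u : E.dom, ∀ᵐ x ∂μ, ‖(Γ.grad w x)⁻¹ * Γ.toFun u w x‖ ≤ Γ.grad u x := fun u => by
    filter_upwards [Γ.abs_toFun_le u w, Γ.grad_nonneg u, Γ.grad_nonneg w] with x h1 h2 h3
    rw [norm_mul, Real.norm_eq_abs, Real.norm_eq_abs, abs_of_nonneg (inv_nonneg.2 h3)]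
    calc (Γ.grad w x)⁻¹ * |Γ.toFun u w x| ≤ (Γ.grad w x)⁻¹ * (Γ.grad u x * Γ.grad w x) := by gcongr
      _ = Γ.grad u x * ((Γ.grad w x)⁻¹ * Γ.grad w x) := by ring
      _ ≤ Γ.grad u x := mul_le_of_le_one_right h2 (inv_mul_le_one)
  have hint : ∀ u : E.dom, Integrable (fun x => (Γ.grad w x)⁻¹ * Γ.toFun u w x) μ := fun u =>
    (integrable_coe (Γ.grad u)).mono' (hm.mul (Lp.aestronglyMeasurable _)) (hdom u)
  let Λ : Lp ℝ 2 μ →ₗ[ℝ] ℝ :=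
    { toFun u := ∫ x, (Γ.grad w x)⁻¹ * Γ.toFun (hP.toDom hs u) w x ∂μ
      map_add' u v := by
        rw [← integral_add (hint _) (hint _)]
        refine integral_congr_ae ?_
        filter_upwards [Lp.coeFn_add (Γ.toFun (hP.toDom hs u) w) (Γ.toFun (hP.toDom hs v) w)]
          with x hx
        rw [map_add, map_add, LinearMap.add_apply, hx, Pi.add_apply, mul_add]
      map_smul' c u := by
        rw [RingHom.id_apply, smul_eq_mul, ← integral_const_mul]
        refine integral_congr_ae ?_
        filter_upwards [Lp.coeFn_smul c (Γ.toFun (hP.toDom hs u) w)] with x hx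
        rw [map_smul, map_smul, LinearMap.smul_apply, hx, Pi.smul_apply, smul_eq_mul]
        ring }
  have hΛ : ∀ u, |Λ u| ≤ ∫ x, Γ.grad (hP.toDom hs u) x ∂μ := fun u =>
    norm_integral_le_of_norm_le (integrable_coe _) (hdom _)
  obtain ⟨K, hK0, hK⟩ := Γ.exists_norm_grad_le
  -- The smoothing by `P_s` bounds the energy by the `L²` norm, so the functional is represented by
  -- an element of `L²`.
  have hb : ∀ u, ‖Λ u‖ ≤ √(K * (s⁻¹ + 1)) * ‖u‖ := fun u => by
    refine (hΛ u).trans ((integral_le_norm _).trans ?_)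
    refine le_of_sq_le_sq ((hK _).trans ?_) (by positivity)
    rw [mul_pow, Real.sq_sqrt (by positivity), mul_assoc]
    refine mul_le_mul_of_nonneg_left ?_ hK0
    rw [normSq, add_mul, one_mul]
    exact add_le_add (hP.energy_smoothing hs u)
      (pow_le_pow_left₀ (norm_nonneg _) (hP.norm_apply_le hs.le u) 2)
  have hinner : ∀ u, inner ℝ ((InnerProductSpace.toDual ℝ (Lp ℝ 2 μ)).symm
      (Λ.mkContinuous _ hb)) u = Λ u := fun u => InnerProductSpace.toDual_symm_apply
  refine ⟨_, fun u => (hinner u).trans_le ((le_abs_self _).trans (hΛ u)), fun u hu => ?_⟩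
  rw [hinner]
  change ∫ x, (Γ.grad w x)⁻¹ * Γ.toFun (hP.toDom hs u) w x ∂μ = _
  refine integral_congr_ae ?_
  filter_upwards [Γ.grad_sq w] with x hx
  rw [hu, ← hx]
  by_cases h : Γ.grad w x = 0
  · simp [h]
  · field_simp

include hP hone hC₁ hBE

/-- The energy of `P_s F` is controlled by the variation of `F`. -/
theorem integral_grad_le_var (hreg : E.IsRegular) {f : X → ℝ} {F : Lp ℝ 2 μ} (hF : F =ᵐ[μ] f)
    {s : ℝ} (hs : 0 < s) :
    ENNReal.ofReal (∫ x, Γ.grad (hP.toDom hs F) x ∂μ) ≤ ENNReal.ofReal C₁ * Var Γ f := by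
  obtain ⟨ψ, hψ1, hψ2⟩ := hP.exists_functional (Γ := Γ) hs (hP.toDom hs F)
  -- Domination on `𝒞`: `⟨ψ, f⟩ ≤ ∫ √Γ(P_s f) ≤ C₁ ∫ P_s √Γ(f) = C₁ ∫ √Γ(f)`, by Bakry–Émery and
  -- conservation of mass. Dividing by `C₁` makes the one-form admissible in `Var`.
  obtain ⟨η, hη1, hη2⟩ := exists_oneForm_of_le Γ
    ((innerₛₗ ℝ (C₁⁻¹ • ψ)).comp E.contDom.subtype) fun f => by
      change inner ℝ (C₁⁻¹ • ψ) (f : Lp ℝ 2 μ) ≤ _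
      rw [real_inner_smul_left, inv_mul_le_iff₀ hC₁, ← hP.integral_apply hone hs.le,
        ← integral_const_mul]
      exact (hψ1 f).trans (integral_mono_ae (integrable_coe _) ((integrable_coe _).const_mul _)
        (hP.grad_le hBE hs (E.contDomIncl f)))
  obtain ⟨hmem, hη3⟩ := codifferential_eq Γ hreg.dense_contDom hη2
  have h1 : ∫ x, Γ.grad (hP.toDom hs F) x ∂μ =
      C₁ * ∫ x, f x * codifferential Γ ⟨η, hmem⟩ x ∂μ := by
    have h2 : ∫ x, f x * codifferential Γ ⟨η, hmem⟩ x ∂μ = inner ℝ F (C₁⁻¹ • ψ) := by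
      rw [hη3, inner_eq_integral]
      refine integral_congr_ae ?_
      filter_upwards [hF] with x hx
      rw [hx]
    rw [h2, real_inner_smul_right, real_inner_comm, hψ2 F rfl, mul_inv_cancel_left₀ hC₁.ne']
  rw [h1, ENNReal.ofReal_mul hC₁.le]
  gcongr
  exact le_iSup₂ (f := fun (η : (codifferential Γ).domain) (_ : ∀ᵐ x ∂μ, fiberNorm Γ η x ≤ 1) =>
    ENNReal.ofReal (∫ x, f x * codifferential Γ η x ∂μ)) ⟨η, hmem⟩ hη1

/-- A function of bounded variation is a limit in `L²` of continuous functions of the domain whose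
gradients are controlled by the variation. -/
theorem exists_approx (hreg : E.IsRegular) {f : X → ℝ} {F : Lp ℝ 2 μ} (hF : F =ᵐ[μ] f)
    {ε : ℝ} (hε : 0 < ε) :
    ∃ v : E.dom, (∃ g : X → ℝ, Continuous g ∧ (v : Lp ℝ 2 μ) =ᵐ[μ] g) ∧
      ‖(v : Lp ℝ 2 μ) - F‖ ≤ ε ∧
      ENNReal.ofReal (∫ x, Γ.grad v x ∂μ) ≤ ENNReal.ofReal C₁ * Var Γ f + ENNReal.ofReal ε := by
  obtain ⟨s, hs, hsε⟩ : ∃ s : ℝ, 0 < s ∧ ‖P s F - F‖ < ε / 2 := by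
    have := (hP.tendsto_zero F).eventually (Metric.ball_mem_nhds F (half_pos hε))
    obtain ⟨s, h1, h2⟩ :=
      ((eventually_mem_nhdsWithin (a := (0 : ℝ)) (s := Set.Ioi 0)).and this).exists
    exact ⟨s, h1, by rwa [← dist_eq_norm]⟩
  obtain ⟨K, hK0, hK⟩ := Γ.exists_norm_grad_le
  -- Chosen so that the `L²` error `δ` and the gradient error `√K δ` together equal `ε / 2`.
  set δ := ε / (2 * (√K + 1)) with hδ
  have hδ0 : 0 < δ := by positivity
  obtain ⟨v, ⟨g, hg, -, hvg⟩, hv⟩ := hreg.dense_form (hP.toDom hs F) (δ ^ 2) (by positivity)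
  have hv' : E.normSq (v - hP.toDom hs F) < δ ^ 2 := by
    refine lt_of_eq_of_lt ?_ hv
    rw [← neg_sub, normSq, normSq, Submodule.coe_neg, norm_neg]
    simp only [map_neg, LinearMap.neg_apply, neg_neg]
  have hδε : √K * δ + δ = ε / 2 := by rw [hδ]; field_simp
  have h1 : ‖(v : Lp ℝ 2 μ) - P s F‖ ≤ δ := by
    refine le_of_sq_le_sq (le_trans ?_ hv'.le) hδ0.le
    exact le_add_of_nonneg_left (E.nonneg _)
  have h2 : ‖Γ.grad (v - hP.toDom hs F)‖ ≤ √K * δ := by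
    refine le_of_sq_le_sq ((hK _).trans ?_) (by positivity)
    rw [mul_pow, Real.sq_sqrt hK0]
    gcongr
  have h3 : 0 ≤ √K * δ := by positivity
  refine ⟨v, ⟨g, hg, hvg⟩, ?_, ?_⟩
  · have := norm_add_le ((v : Lp ℝ 2 μ) - P s F) (P s F - F)
    rw [sub_add_sub_cancel] at this
    linarith
  · have h4 : ∫ x, Γ.grad v x ∂μ ≤ ∫ x, Γ.grad (hP.toDom hs F) x ∂μ + ε := by
      have h5 := integral_mono_ae (integrable_coe _) ((integrable_coe _).add (integrable_coe _))
        (Γ.grad_le_add v (hP.toDom hs F))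
      have h6 := integral_add (integrable_coe (Γ.grad (hP.toDom hs F)))
        (integrable_coe (Γ.grad (v - hP.toDom hs F)))
      have h7 := integral_le_norm (Γ.grad (v - hP.toDom hs F))
      change ∫ x, Γ.grad v x ∂μ ≤ ∫ x, (_ + _) ∂μ at h5
      rw [h6] at h5
      linarith
    exact (ENNReal.ofReal_le_ofReal h4).trans (ENNReal.ofReal_add_le.trans
      (add_le_add_left (hP.integral_grad_le_var hone hC₁ hBE hreg hF hs) _))

end IsHeatSemigroup

end DirichletForm

end DirichletSpace

end

/-! ### The Sobolev inequality on `BV`. -/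

theorem mainTheorem8 {X : Type*} [MetricSpace X] [CompactSpace X] [MeasurableSpace X]
    [BorelSpace X] (μ : MeasureTheory.Measure X) [MeasureTheory.IsProbabilityMeasure μ]
    [μ.IsOpenPosMeasure]
    (E : DirichletSpace.DirichletForm μ) (hreg : E.IsRegular) (hloc : E.IsStrictlyLocal)
    (Γ : E.CarreDuChamp)
    (P : ℝ → MeasureTheory.Lp ℝ 2 μ →L[ℝ] MeasureTheory.Lp ℝ 2 μ) (hP : E.IsHeatSemigroup P)
    (C₁ : ℝ) (hC₁ : 1 ≤ C₁) (hBE : DirichletSpace.WeakBakryEmery Γ P C₁ 0)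
    (p : ℝ → X → X → ℝ) (hp : DirichletSpace.IsHeatKernel P p)
    (Q : ℝ) (hQ : 1 < Q)
    (hbound : ∃ M : ℝ, ∀ t : ℝ, 0 < t → t ≤ 1 → ∀ x y : X, t ^ (Q / 2) * p t x y ≤ M) :
    ∃ C : ℝ, 0 < C ∧ ∀ f ∈ DirichletSpace.BV Γ,
      MeasureTheory.eLpNorm f (ENNReal.ofReal (Q / (Q - 1))) μ ≤
        ENNReal.ofReal C * (DirichletSpace.Var Γ f + MeasureTheory.eLpNorm f 1 μ) := by
  have hC₁0 : 0 < C₁ := by linarith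
  have hone := DirichletSpace.DirichletForm.hasLaplacian_one hreg hloc
  obtain ⟨M, hM, hU⟩ := DirichletSpace.DirichletForm.exists_ultracontractive hp hbound
  set D : ℝ := 2 * M * (4 ^ (Q / (Q - 1)) * (4 * √2 * C₁) + 2 ^ (Q / (Q - 1) - 1)) with hD
  have hD0 : 0 < D := by positivity
  -- The factor `C₁` comes from the gradient bound in terms of `Var`; since `C₁ ≥ 1` it may be
  -- placed on the `L¹` term as well.
  refine ⟨D * C₁, by positivity, fun f hf => ?_⟩
  obtain ⟨⟨hfm, B, hB⟩, hVar⟩ := hf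
  set F := DirichletSpace.classOf μ f
  have hF : F =ᵐ[μ] f := DirichletSpace.classOf_ae hfm.aestronglyMeasurable (K := B)
    (Eventually.of_forall hB)
  let ε : ℕ → ℝ := fun n => 1 / ((n : ℝ) + 1)
  have hε : Tendsto ε atTop (𝓝 0) := tendsto_one_div_add_atTop_nhds_zero_nat
  choose v hvc hvF hvg using fun n : ℕ => hP.exists_approx hone hC₁0 hBE hreg hF
    (ε := ε n) Nat.one_div_pos_of_nat
  have hlim : Tendsto (fun n => (v n : Lp ℝ 2 μ)) atTop (𝓝 F) :=
    tendsto_iff_norm_sub_tendsto_zero.2 (squeeze_zero (fun n => norm_nonneg _) hvF hε)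
  have hε' : Tendsto (fun n => ENNReal.ofReal (ε n)) atTop (𝓝 0) := by
    simpa using ENNReal.tendsto_ofReal hε
  have h1 : ∀ n, eLpNorm (v n : Lp ℝ 2 μ) 1 μ ≤ eLpNorm F 1 μ + ENNReal.ofReal (ε n) := fun n => by
    have ha : eLpNorm (v n : Lp ℝ 2 μ) 1 μ ≤
        eLpNorm F 1 μ + eLpNorm ((v n : Lp ℝ 2 μ) - F : Lp ℝ 2 μ) 1 μ := by
      have hb : (v n : Lp ℝ 2 μ) =ᵐ[μ] (F : X → ℝ) + ((v n : Lp ℝ 2 μ) - F : Lp ℝ 2 μ) := by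
        filter_upwards [Lp.coeFn_sub (v n : Lp ℝ 2 μ) F] with x hx
        rw [Pi.add_apply, hx, Pi.sub_apply, add_sub_cancel]
      rw [eLpNorm_congr_ae hb]
      exact eLpNorm_add_le (Lp.aestronglyMeasurable _) (Lp.aestronglyMeasurable _) le_rfl
    refine ha.trans (add_le_add_right ?_ _)
    refine (eLpNorm_le_eLpNorm_of_exponent_le one_le_two (Lp.aestronglyMeasurable _)).trans ?_
    rw [← Lp.enorm_def, ← ofReal_norm]
    exact ENNReal.ofReal_le_ofReal (hvF n)
  -- The Sobolev inequality for the continuous approximations passes to `F` by lower semicontinuity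
  -- of the `L^p` norm, while the errors `ε n` vanish.
  have key := DirichletSpace.eLpNorm_le_of_tendsto (p := ENNReal.ofReal (Q / (Q - 1))) hlim
    (b := fun n => ENNReal.ofReal D * ((ENNReal.ofReal C₁ * DirichletSpace.Var Γ f +
      ENNReal.ofReal (ε n)) + (eLpNorm F 1 μ + ENNReal.ofReal (ε n))))
    (B := ENNReal.ofReal D * ((ENNReal.ofReal C₁ * DirichletSpace.Var Γ f + 0) +
      (eLpNorm F 1 μ + 0)))
    (fun n => by
      obtain ⟨g, hg, hvng⟩ := hvc n
      refine (hP.sobolev_of_continuous hone hloc hC₁0.le hBE hM hQ hU rfl hg hvng).trans ?_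
      exact mul_le_mul_right (add_le_add (hvg n) (h1 n)) _)
    (ENNReal.Tendsto.const_mul ((tendsto_const_nhds.add hε').add (tendsto_const_nhds.add hε'))
      (Or.inr ENNReal.ofReal_ne_top))
  rw [eLpNorm_congr_ae hF, eLpNorm_congr_ae hF, add_zero, add_zero] at key
  refine key.trans ?_
  rw [ENNReal.ofReal_mul hD0.le, mul_assoc, mul_add (ENNReal.ofReal C₁)]
  gcongr
  exact le_mul_of_one_le_left' (by simpa using hC₁)
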